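/- Let $A$ be a finite alphabet and let $\xi : A \to A^*$ be a primitive proper substitution (all words $\xi(b)$, $b\in A$, start with the same letter, and all end with the same letter). Let $\Omega\subset A^{\mathbb Z}$ be its subshift, that is, the set of the bi-infinite sequences all of whose factors occur in some $\xi^n(b)$, $n\ge 0$, $b \in A$; let $S$ be the shift on $\Omega$ and $\mu$ the shift-invariant Borel probability measure on $\Omega$. Let $M$ be the incidence matrix of $\xi$ ($M_{a,b}$ is the number of occurrences of $a$ in $\xi(b)$), and let $E^s\subset\mathbb R^{A}$ be the sum of the (real) generalised eigenspaces of $M^t$ for the eigenvalues $\lambda$ with $0<|\lambda|<1$. Put $d-1=\dim E^s$ and assume Hypotheses P: (i) the characteristic polynomial of $M$ has exactly one root of modulus greater than one; (ii) $\alpha_1,\dots,\alpha_{d-1}$ are real numbers such that $1,\alpha_1,\dots,\alpha_{d-1}$ are linearly independent over $\mathbb Q$ and every $e^{2 i\pi\alpha_j}$ is an eigenvalue of $(\Omega,\mu,S)$ (there is a nonzero $f\in L^2(\mu)$ with $f\circ S=e^{2i\pi\alpha_j}f$); (iii) the dominant eigenvalue $\beta$ of $M$ satisfies $\beta\,|\det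 (M^t|_{E^s})|=1$. Let $\xi$ also denote the map induced on $A^{\mathbb Z}$ by concatenation, and write $[a]=\{x\in\Omega: x_0=a\}$. For $k\ge1$ let $r_k(x)=\min\{j\ge 0: S^jx\in\xi^{k-1}(\Omega)\}$ and let $s_k(x)\in\mathbb Z^{A}$ be the vector with coordinates $s_k(x)_a=\#\{ i : r_k(x)\le i<r_{k+1}(x),\ S^ix\in\xi^{k-1}([a])\}$. Then there are vectors $v(1),\dots,v(d-1)\in\mathbb R^A$ and $w(1),\dots,w(d-1)\in\mathbb Z^A$ with $$\alpha_j(1,\dots,1)^t=v(j)+w(j)\quad\text{and}\quad (M^t)^kv(j)\to0\ \ (k\to\infty)\qquad (1\le j\le d-1).$$ For every such choice, the series in $$F:\Omega\to\mathbb R^{d-1},\qquad F(x)=\Big(\sum_{k=1}^{\infty}\big\langle s_k(x),(M^t)^{k-1}v(j)\big\rangle\Big)_{1\le j\le d-1}$$ converge absolutely for all $x\in\Omega$ and, denoting by $\pi:\mathbb R^{d-1}\to\mathbb R^{d-1}/\mathbb Z^{d-1}$ the canonical projection, the map $Z:\Omega\to\mathbb Z\cup\{\infty\}$, $Z(x)=\#\,(\pi\circ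 F)^{-1}(\{\pi\circ F(x)\})$, is finite and constant $\mu$-almost everywhere. -/

import Mathlib

open MeasureTheory Filter Topology Matrix

namespace PisotSubst

section Substitutions

variable {A : Type*}

/-- The extension of `ξ : A → A*` to a morphism of the free monoid `A*`. -/
def onWord (ξ : A → List A) (u : List A) : List A := u.flatMap ξ

/-- The word `ξⁿ(b)`. -/
def iter (ξ : A → List A) (n : ℕ) (b : A) : List A := (onWord ξ)^[n] [b]

/-- `ξ` is a substitution: the image of some letter `a` begins with `a`, and the length of
`ξⁿ(b)` tends to infinity for every letter `b`. -/
def IsSubstitution (ξ : A → List A) : Prop :=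
  (∃ a, (ξ a).head? = some a) ∧ ∀ b, Tendsto (fun n => (iter ξ n b).length) atTop atTop

/-- `ξ` is proper: all the words `ξ(b)` start with the same letter, and all of them end with the
same letter. -/
def IsProper (ξ : A → List A) : Prop :=
  (∃ a, ∀ b, (ξ b).head? = some a) ∧ ∃ a, ∀ b, (ξ b).getLast? = some a

/-- The language of `ξ`: the words that occur in some `ξⁿ(b)`. -/
def language (ξ : A → List A) : Set (List A) := {u | ∃ n b, u <:+: iter ξ n b}

/-- The shift on bi-infinite sequences. -/
def shift (x : ℤ → A) : ℤ → A := fun i => x (i + 1)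

/-- The substitutive subshift `Ω` of `ξ`: the bi-infinite sequences all of whose factors belong to
the language of `ξ`. -/
def Omega (ξ : A → List A) : Set (ℤ → A) :=
  {x | ∀ (i : ℤ) (n : ℕ), List.ofFn (fun j : Fin n => x (i + (j : ℕ))) ∈ language ξ}

theorem shift_mem_Omega {ξ : A → List A} {x : ℤ → A} (hx : x ∈ Omega ξ) : shift x ∈ Omega ξ := by
  intro i n
  have h := hx (i + 1) n
  have e : (fun j : Fin n => shift x (i + (j : ℕ))) = fun j : Fin n => x (i + 1 + (j : ℕ)) := by
    funext j
    simp only [shift]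
    congr 1
    ring
  rw [e]
  exact h

/-- The shift `S` restricted to `Ω`. -/
def shiftOmega (ξ : A → List A) (x : Omega ξ) : Omega ξ := ⟨shift x.1, shift_mem_Omega x.2⟩

/-- The action of `ξ` on bi-infinite sequences by concatenation,
`… x₋₁ . x₀ x₁ … ↦ … ξ(x₋₁) . ξ(x₀) ξ(x₁) …`.
The entry of index `n ≥ 0` is read in `ξ(x₀) ⋯ ξ(xₙ)`; the entry of index `-(n+1)` is read, from
right to left, in `ξ(x₋ₙ₋₁) ⋯ ξ(x₋₁)`. When `ξ` is non-erasing these words are long enough, and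
the default value `x 0` is never used. -/
def onSeq (ξ : A → List A) (x : ℤ → A) : ℤ → A
  | Int.ofNat n =>
      ((List.ofFn fun j : Fin (n + 1) => x ((j : ℕ) : ℤ)).flatMap ξ)[n]?.getD (x 0)
  | Int.negSucc n =>
      ((List.ofFn fun j : Fin (n + 1) => x (Int.negSucc j)).flatMap
        fun b => (ξ b).reverse)[n]?.getD (x 0)

/-- The set `ξᵏ([a])`, where `[a]` is the cylinder `{x ∈ Ω | x₀ = a}`. -/
def base (ξ : A → List A) (k : ℕ) (a : A) : Set (ℤ → A) :=
  (onSeq ξ)^[k] '' {x | x ∈ Omega ξ ∧ x 0 = a}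

/-- The entrance time of `x` in `ξᵏ(Ω)`: the least `j ≥ 0` with `Sʲ x ∈ ξᵏ(Ω)`. -/
noncomputable def entranceTime (ξ : A → List A) (k : ℕ) (x : ℤ → A) : ℕ :=
  sInf {j : ℕ | shift^[j] x ∈ (onSeq ξ)^[k] '' Omega ξ}

open Classical in
/-- The vector that counts, for each letter `a`, the visits of the orbit of `x` to `ξᵏ([a])` from
its entrance in `ξᵏ(Ω)` (included) until its entrance in `ξᵏ⁺¹(Ω)` (excluded). -/
noncomputable def visits (ξ : A → List A) (k : ℕ) (x : ℤ → A) (a : A) : ℕ :=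
  ((Finset.Ico (entranceTime ξ k x) (entranceTime ξ (k + 1) x)).filter
    fun i => shift^[i] x ∈ base ξ k a).card

end Substitutions

section Matrices

variable {A : Type*} [Fintype A] [DecidableEq A]

/-- The incidence matrix of `ξ`: the entry `(i, j)` is the number of occurrences of the letter `i`
in the word `ξ(j)`. -/
def incidence (R : Type*) [Semiring R] (ξ : A → List A) : Matrix A A R :=
  Matrix.of fun i j => ((ξ j).count i : R)

/-- The endomorphism of `ℝᴬ` given by the transpose of the incidence matrix. -/
noncomputable def transp (ξ : A → List A) : (A → ℝ) →ₗ[ℝ] (A → ℝ) :=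
  (incidence ℝ ξ)ᵀ.mulVecLin

/-- The stable space `Eˢ` of the transpose `L` of the incidence matrix: the sum of the generalised
eigenspaces for the eigenvalues `λ` with `0 < |λ| < 1`. It consists of the vectors `v` with
`Lᵏ v → 0` that lie in the part of `ℝᴬ` on which `L` is invertible, the intersection of the
ranges of the powers of `L`. -/
noncomputable def stableSpace (ξ : A → List A) : Submodule ℝ (A → ℝ) where
  carrier := {v | Tendsto (fun k : ℕ => (transp ξ ^ k) v) atTop (𝓝 0) ∧
    ∀ k : ℕ, v ∈ LinearMap.range (transp ξ ^ k)}
  add_mem' := by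
    rintro u v ⟨hu, hu'⟩ ⟨hv, hv'⟩
    refine ⟨?_, fun k => add_mem (hu' k) (hv' k)⟩
    simpa using hu.add hv
  zero_mem' := ⟨by simp, fun k => zero_mem _⟩
  smul_mem' := by
    rintro c v ⟨hv, hv'⟩
    refine ⟨?_, fun k => Submodule.smul_mem _ _ (hv' k)⟩
    simpa using hv.const_smul c

theorem transp_mem_stableSpace (ξ : A → List A) :
    ∀ v ∈ stableSpace ξ, transp ξ v ∈ stableSpace ξ := by
  rintro v ⟨hv, hv'⟩
  refine ⟨?_, fun k => ?_⟩
  · refine ((tendsto_add_atTop_iff_nat 1).2 hv).congr fun k => ?_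
    rw [pow_succ]
    rfl
  · obtain ⟨u, rfl⟩ := hv' k
    exact ⟨transp ξ u, by rw [← Module.End.mul_apply, ← Module.End.mul_apply, ← pow_succ, ← pow_succ']⟩

/-- `z` is a root of the characteristic polynomial of the incidence matrix. -/
def IsCharRoot (ξ : A → List A) (z : ℂ) : Prop := (incidence ℂ ξ).charpoly.IsRoot z

/-- `β` is the Perron number of `ξ`: the dominant root of the characteristic polynomial. -/
def IsPerronNumber (ξ : A → List A) (β : ℝ) : Prop :=
  IsCharRoot ξ (β : ℂ) ∧ ∀ z : ℂ, IsCharRoot ξ z → z ≠ (β : ℂ) → ‖z‖ < β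

/-- `l` is an eigenvalue of the measurable dynamical system `(X, μ, T)`: there is a nonzero
`f ∈ L²(μ)` with `f ∘ T = l f`. -/
def IsEigenvalue {X : Type*} [MeasurableSpace X] (μ : Measure X) (T : X → X) (l : ℂ) : Prop :=
  ∃ f : X → ℂ, MemLp f 2 μ ∧ ¬ f =ᵐ[μ] 0 ∧ (fun x => f (T x)) =ᵐ[μ] fun x => l * f x

/-- The hypotheses on `ξ`, on the shift-invariant probability measure `μ` of its subshift, and on
the real numbers `α₁, …, αₙ` with `n = dim Eˢ` (which is `d - 1`). -/
structure HypothesesP [MeasurableSpace A] (ξ : A → List A) (μ : Measure (Omega ξ)) {n : ℕ}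
    (α : Fin n → ℝ) : Prop where
  subst : IsSubstitution ξ
  primitive : (incidence ℝ ξ).IsPrimitive
  proper : IsProper ξ
  unique_root : ∃! z : ℂ, IsCharRoot ξ z ∧ 1 < ‖z‖
  dim_eq : Module.finrank ℝ (stableSpace ξ) = n
  eigenvalue : ∀ i, IsEigenvalue μ (shiftOmega ξ)
    (Complex.exp (2 * (Real.pi : ℂ) * Complex.I * (α i : ℂ)))
  indep : LinearIndependent ℚ (Fin.cons 1 α : Fin (n + 1) → ℝ)
  perron_det : ∃ β : ℝ, IsPerronNumber ξ β ∧
    β * |LinearMap.det ((transp ξ).restrict (transp_mem_stableSpace ξ))| = 1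

/-- The vectors `v(i)`, `w(i)` split `αᵢ (1, …, 1) = v(i) + w(i)`, where `w(i)` is an integer vector
and the iterates of `v(i)` under the transpose of the incidence matrix tend to `0`. -/
structure IsSplitting (ξ : A → List A) {n : ℕ} (α : Fin n → ℝ) (v : Fin n → A → ℝ)
    (w : Fin n → A → ℤ) : Prop where
  split : ∀ i a, α i = v i a + (w i a : ℝ)
  tendsto : ∀ i, Tendsto (fun k : ℕ => (transp ξ ^ k) (v i)) atTop (𝓝 0)

/-- The `k`-th term of the `i`-th coordinate of `F(x)`. -/
noncomputable def term (ξ : A → List A) {n : ℕ} (v : Fin n → A → ℝ) (x : ℤ → A) (i : Fin n)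
    (k : ℕ) : ℝ :=
  (fun a => (visits ξ k x a : ℝ)) ⬝ᵥ (transp ξ ^ k) (v i)

/-- The map `F : Ω → ℝⁿ`. -/
noncomputable def mapF (ξ : A → List A) {n : ℕ} (v : Fin n → A → ℝ) (x : Omega ξ) : Fin n → ℝ :=
  fun i => ∑' k, term ξ v x.1 i k

/-- The canonical projection `π` from `ℝⁿ` to the torus `ℝⁿ/ℤⁿ`. -/
def toTorus {n : ℕ} (p : Fin n → ℝ) : Fin n → UnitAddCircle := fun i => (p i : UnitAddCircle)

/-- `Z(x)`, the cardinality (possibly infinite) of the fibre of `π ∘ F` through `x`. -/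
noncomputable def fibreCard (ξ : A → List A) {n : ℕ} (v : Fin n → A → ℝ) (x : Omega ξ) : ℕ∞ :=
  Set.encard {y : Omega ξ | toTorus (mapF ξ v y) = toTorus (mapF ξ v x)}

end Matrices

end PisotSubst

/-! Let L be the transpose of M. An eigenvalue e^{2πiα} with α irrational excludes a common period
of the points of Ω, and a primitive substitution without such a period is recognizable: for each k
the sets Sⁱξᵏ([a]), 0 ≤ i < |ξᵏ(a)|, are the floors of towers that partition Ω into clopen sets
(`recognizable`, `IsAperiodicPrimitive.isClopen_piece`).

The splitting. By properness a fixed share of Ω nearly returns after |ξᵏ(a)| steps, which forces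
α_j|ξᵏ(a)| → 0 modulo 1 (`IsAperiodicPrimitive.tendsto_pow_length`). These lengths are the
coordinates of Lᵏ(1,…,1), so rounding splits α_j Lᴷ(1,…,1) for some K. To undo Lᴷ over the integers,
hypothesis (iii) is used: it bounds the product of the nonzero eigenvalues of M by 1 in modulus, so
this integer is ±1 and L is invertible over ℤ on its eventual range (`exists_pow_eq_pow_succ_mul`).

The rotation. The terms of F are locally constant and decay geometrically, so F is continuous.
Modulo 1 the partial sums of F_j are α_j times the entrance time in ξᴷ(Ω), whence G = π∘F satisfies
G∘S = G − α (`IsAperiodicPrimitive.toTorus_mapF_shiftOmega`). By rational independence this rotation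
is uniquely ergodic, and G carries μ to the Haar measure.

Finiteness. Let N(t) be the cardinality of G⁻¹(t). Properness makes the floors separate points, so
N(t) is the liminf of the number of floors of level k whose image contains t
(`IsAperiodicPrimitive.liminf_hitCount`). The images of the floors of one tower are translates of
each other, so Fatou's lemma bounds ∫N by the liminf of the sums over a of |ξᵏ(a)| times the Haar
measure of G(ξᵏ([a])). Applying ξ to a point replaces v by Lv in F, so beyond some level each
further level multiplies the volume of F(ξᵏ([a])) by |det L| on Eˢ, that is by 1/β, while |ξᵏ(a)| ≤
Cβᵏ. The bound is therefore uniform in k (`IsAperiodicPrimitive.exists_lintegral_hitCount_le`).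
Hence N is finite almost everywhere; being invariant under an ergodic rotation, it is almost
everywhere constant. -/

namespace PisotSubst

/-! ### Bi-infinite concatenations and the cells they are made of -/

section Concatenation

variable {A B C : Type*}

/-- The position at which the image of the letter of index `j` begins in the concatenation of the
words `σ (y i)`. -/
def pos (σ : A → List B) (y : ℤ → A) : ℤ → ℤ
  | Int.ofNat n => ∑ i ∈ Finset.range n, ((σ (y i)).length : ℤ)
  | Int.negSucc n => -∑ i ∈ Finset.range (n + 1), ((σ (y (Int.negSucc i))).length : ℤ)

@[simp] theorem pos_zero (σ : A → List B) (y : ℤ → A) : pos σ y 0 = 0 := by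
  change pos σ y (Int.ofNat 0) = 0
  simp [pos]

theorem pos_natCast (σ : A → List B) (y : ℤ → A) (n : ℕ) :
    pos σ y n = ∑ i ∈ Finset.range n, ((σ (y i)).length : ℤ) := rfl

theorem pos_negSucc (σ : A → List B) (y : ℤ → A) (n : ℕ) :
    pos σ y (Int.negSucc n) =
      -∑ i ∈ Finset.range (n + 1), ((σ (y (Int.negSucc i))).length : ℤ) := rfl

theorem pos_add_one (σ : A → List B) (y : ℤ → A) (j : ℤ) :
    pos σ y (j + 1) = pos σ y j + (σ (y j)).length := by
  obtain n | n := j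
  · change pos σ y ((n : ℤ) + 1) = pos σ y (n : ℤ) + _
    have : ((n : ℤ) + 1) = ((n + 1 : ℕ) : ℤ) := by push_cast; rfl
    rw [this, pos_natCast, pos_natCast, Finset.sum_range_succ]
    rfl
  · obtain _ | n := n
    · have : Int.negSucc 0 + 1 = 0 := rfl
      rw [this, pos_zero, pos_negSucc]
      simp
    · have : Int.negSucc (n + 1) + 1 = Int.negSucc n := rfl
      rw [this, pos_negSucc, pos_negSucc, Finset.sum_range_succ _ (n + 1)]
      ring

theorem pos_strictMono {σ : A → List B} (hσ : ∀ a, σ a ≠ []) (y : ℤ → A) :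
    StrictMono (pos σ y) := by
  refine strictMono_int_of_lt_succ fun j => ?_
  rw [pos_add_one]
  have := List.length_pos_iff.2 (hσ (y j))
  omega

theorem le_pos {σ : A → List B} (hσ : ∀ a, σ a ≠ []) (y : ℤ → A) (j : ℤ) (hj : 0 ≤ j) :
    j ≤ pos σ y j := by
  induction j, hj using Int.leInduction with
  | base => simp
  | succ j _ ih =>
    rw [pos_add_one]
    have := List.length_pos_iff.2 (hσ (y j))
    omega

theorem pos_le {σ : A → List B} (hσ : ∀ a, σ a ≠ []) (y : ℤ → A) (j : ℤ) (hj : j ≤ 0) :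
    pos σ y j ≤ j := by
  induction j, hj using Int.leInductionDown with
  | base => simp
  | pred j _ ih =>
    have h := pos_add_one σ y (j - 1)
    rw [sub_add_cancel] at h
    have := List.length_pos_iff.2 (hσ (y (j - 1)))
    omega

/-- Every position lies in the image of exactly one letter. -/
theorem exists_cell {σ : A → List B} (hσ : ∀ a, σ a ≠ []) (y : ℤ → A) (n : ℤ) :
    ∃ (j : ℤ) (t : ℕ), t < (σ (y j)).length ∧ pos σ y j + t = n := by
  obtain ⟨j, hj, hmax⟩ := Int.exists_greatest_of_bdd (P := fun j => pos σ y j ≤ n)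
    ⟨max n 0, fun z hz => by
      by_contra! h
      have := le_pos hσ y z (by omega)
      omega⟩
    ⟨min n 0, (pos_le hσ y _ (min_le_right _ _)).trans (min_le_left _ _)⟩
  have h1 : n < pos σ y (j + 1) := by
    by_contra! h
    have := hmax _ h
    omega
  rw [pos_add_one] at h1
  exact ⟨j, (n - pos σ y j).toNat, by omega, by omega⟩

theorem cell_unique {σ : A → List B} (hσ : ∀ a, σ a ≠ []) (y : ℤ → A) {j j' : ℤ} {t t' : ℕ}
    (ht : t < (σ (y j)).length) (ht' : t' < (σ (y j')).length)
    (h : pos σ y j + t = pos σ y j' + t') : j = j' ∧ t = t' := by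
  have key : j = j' := by
    rcases lt_trichotomy j j' with hlt | heq | hgt
    · have := (pos_strictMono hσ y).monotone (show j + 1 ≤ j' by omega)
      rw [pos_add_one] at this
      omega
    · exact heq
    · have := (pos_strictMono hσ y).monotone (show j' + 1 ≤ j by omega)
      rw [pos_add_one] at this
      omega
  subst key
  exact ⟨rfl, by omega⟩

/-- Only the lengths of the words matter, so the positions for `iter ξ k` also serve for its
labelled version `label ξ k`. -/
theorem pos_congr {σ : A → List B} {τ : A → List C} {y : ℤ → A}
    (h : ∀ a, (σ a).length = (τ a).length) (j : ℤ) : pos σ y j = pos τ y j := by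
  obtain n | n := j
  · change pos σ y (n : ℤ) = pos τ y (n : ℤ)
    simp [pos_natCast, h]
  · simp [pos_negSucc, h]

/-- The bi-infinite concatenation of the words `σ (y j)`. -/
noncomputable def conc [Nonempty B] (σ : A → List B) (y : ℤ → A) (n : ℤ) : B :=
  Classical.epsilon fun b => ∃ (j : ℤ) (t : ℕ), pos σ y j + t = n ∧ (σ (y j))[t]? = some b

theorem conc_spec [Nonempty B] {σ : A → List B} (hσ : ∀ a, σ a ≠ []) (y : ℤ → A) {j : ℤ} {t : ℕ}
    (ht : t < (σ (y j)).length) : (σ (y j))[t]? = some (conc σ y (pos σ y j + t)) := by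
  have : ∃ b, ∃ (j' : ℤ) (t' : ℕ), pos σ y j' + t' = pos σ y j + t ∧ (σ (y j'))[t']? = some b :=
    ⟨(σ (y j))[t], j, t, rfl, List.getElem?_eq_getElem ht⟩
  obtain ⟨j', t', h1, h2⟩ := Classical.epsilon_spec this
  have ht' : t' < (σ (y j')).length := by
    by_contra! h
    rw [List.getElem?_eq_none h] at h2
    cases h2
  obtain ⟨rfl, rfl⟩ := cell_unique hσ y ht' ht h1
  exact h2

/-- The cells cover ℤ, so reading each cell determines the sequence. The identities between
concatenations below are reduced to this. -/
theorem eq_conc [Nonempty B] {σ : A → List B} (hσ : ∀ a, σ a ≠ []) {y : ℤ → A} {x : ℤ → B}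
    (h : ∀ (j : ℤ) (t : ℕ), t < (σ (y j)).length → (σ (y j))[t]? = some (x (pos σ y j + t))) :
    x = conc σ y := by
  funext n
  obtain ⟨j, t, ht, rfl⟩ := exists_cell hσ y n
  have h1 := h j t ht
  rw [conc_spec hσ y ht] at h1
  exact (Option.some.inj h1).symm

theorem pos_shift (σ : A → List B) (y : ℤ → A) (i j : ℤ) :
    pos σ (fun n => y (n + i)) j = pos σ y (j + i) - pos σ y i := by
  induction j using Int.induction_on with
  | zero => simp
  | succ j ih =>
    rw [pos_add_one, ih, show (j : ℤ) + 1 + i = (j + i) + 1 by ring, pos_add_one]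
    ring
  | pred j ih =>
    have h1 := pos_add_one σ (fun n => y (n + i)) (-j - 1)
    have h2 := pos_add_one σ y (-j - 1 + i)
    rw [show (-j - 1 : ℤ) + 1 = -j by ring, ih] at h1
    rw [show (-j - 1 + i : ℤ) + 1 = -j + i by ring] at h2
    linarith

theorem conc_shift [Nonempty B] {σ : A → List B} (hσ : ∀ a, σ a ≠ []) (y : ℤ → A) (i : ℤ) :
    conc σ (fun n => y (n + i)) = fun n => conc σ y (n + pos σ y i) := by
  symm
  refine eq_conc hσ fun j t ht => ?_
  rw [conc_spec hσ y ht, pos_shift]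
  congr 2
  ring

theorem getElem?_flatMap_take (τ : B → List C) (l : List B) (s t : ℕ) (hs : s < l.length)
    (ht : t < (τ l[s]).length) :
    (l.flatMap τ)[((l.take s).flatMap τ).length + t]? = (τ l[s])[t]? := by
  conv_lhs => rw [← List.take_append_drop s l, List.flatMap_append]
  rw [List.getElem?_append_right (by simp)]
  rw [List.drop_eq_getElem_cons hs, List.flatMap_cons]
  rw [List.getElem?_append_left]
  · simp
  · simpa using ht

theorem flatMap_ne_nil {σ : A → List B} {τ : B → List C} (hσ : ∀ a, σ a ≠ [])
    (hτ : ∀ b, τ b ≠ []) (a : A) : (σ a).flatMap τ ≠ [] := by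
  obtain ⟨b, hb⟩ := List.exists_mem_of_ne_nil _ (hσ a)
  intro h
  rw [List.flatMap_eq_nil_iff] at h
  exact hτ b (h b hb)

theorem pos_conc_add [Nonempty B] {σ : A → List B} {τ : B → List C} (hσ : ∀ a, σ a ≠ [])
    (y : ℤ → A) (j : ℤ) (t : ℕ) (ht : t ≤ (σ (y j)).length) :
    pos τ (conc σ y) (pos σ y j + t) =
      pos τ (conc σ y) (pos σ y j) + (((σ (y j)).take t).flatMap τ).length := by
  induction t with
  | zero => simp
  | succ t ih =>
    have h1 := conc_spec hσ y (show t < (σ (y j)).length by omega)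
    rw [List.getElem?_eq_getElem (by omega)] at h1
    rw [Nat.cast_succ, ← add_assoc, pos_add_one, ih (by omega), ← Option.some.inj h1]
    rw [← List.take_concat_get' _ _ (show t < (σ (y j)).length by omega), List.flatMap_append]
    simp
    ring

theorem pos_conc [Nonempty B] {σ : A → List B} {τ : B → List C} (hσ : ∀ a, σ a ≠ [])
    (y : ℤ → A) (j : ℤ) :
    pos τ (conc σ y) (pos σ y j) = pos (fun a => (σ a).flatMap τ) y j := by
  have key : ∀ j : ℤ, pos τ (conc σ y) (pos σ y (j + 1)) =
      pos τ (conc σ y) (pos σ y j) + ((σ (y j)).flatMap τ).length := by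
    intro j
    rw [pos_add_one, pos_conc_add hσ y j _ le_rfl, List.take_length]
  induction j using Int.induction_on with
  | zero => simp
  | succ j ih => rw [key, ih, pos_add_one]
  | pred j ih =>
    have h1 := key (-j - 1)
    have h2 := pos_add_one (fun a => (σ a).flatMap τ) y (-j - 1)
    rw [show (-j - 1 : ℤ) + 1 = -j by ring] at h1 h2
    linarith

theorem conc_conc [Nonempty B] [Nonempty C] {σ : A → List B} {τ : B → List C}
    (hσ : ∀ a, σ a ≠ []) (hτ : ∀ b, τ b ≠ []) (y : ℤ → A) :
    conc τ (conc σ y) = conc (fun a => (σ a).flatMap τ) y := by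
  symm
  refine eq_conc hτ fun j t ht => ?_
  obtain ⟨i, s, hs, rfl⟩ := exists_cell hσ y j
  have h1 := conc_spec hσ y hs
  rw [List.getElem?_eq_getElem hs] at h1
  have h1 := Option.some.inj h1
  rw [← h1] at ht
  have h2 := getElem?_flatMap_take τ (σ (y i)) s t hs ht
  rw [← h1, ← h2, pos_conc_add hσ y i s hs.le, pos_conc hσ, add_assoc, ← Nat.cast_add]
  refine conc_spec (flatMap_ne_nil hσ hτ) y ?_
  by_contra! hcon
  rw [List.getElem?_eq_none hcon, List.getElem?_eq_getElem ht] at h2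
  cases h2

theorem conc_singleton [Nonempty A] (y : ℤ → A) :
    conc (fun a => [a]) y = y := by
  have hp : ∀ j, pos (fun a : A => [a]) y j = j := by
    intro j
    induction j using Int.induction_on with
    | zero => simp
    | succ j ih => rw [pos_add_one, ih]; simp
    | pred j ih =>
      have h2 := pos_add_one (fun a : A => [a]) y (-j - 1)
      rw [show (-j - 1 : ℤ) + 1 = -j by ring] at h2
      simp at h2
      linarith
  symm
  refine eq_conc (by simp) fun j t ht => ?_
  simp at ht
  subst ht
  simp [hp]

/-- The images of consecutive letters, read in a one-sided sequence. -/
theorem getElem?_flatMap_ofFn (τ : A → List B) (g : ℕ → A) (N j t : ℕ) (hj : j < N)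
    (ht : t < (τ (g j)).length) :
    ((List.ofFn fun i : Fin N => g i).flatMap τ)[∑ i ∈ Finset.range j, (τ (g i)).length + t]? =
      (τ (g j))[t]? := by
  have h := getElem?_flatMap_take τ (List.ofFn fun i : Fin N => g i) j t (by simpa using hj)
    (by simpa using ht)
  have h2 : (((List.ofFn fun i : Fin N => g i).take j).flatMap τ).length =
      ∑ i ∈ Finset.range j, (τ (g i)).length := by
    clear h ht
    induction j with
    | zero => simp
    | succ j ih =>
      rw [← List.take_concat_get' _ _ (show j < (List.ofFn fun i : Fin N => g i).length by
        simp; omega), List.flatMap_append, List.length_append, ih (by omega),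
        Finset.sum_range_succ]
      simp
  rw [h2] at h
  simpa using h

theorem onSeq_eq_conc [Nonempty A] {ξ : A → List A} (hξ : ∀ a, ξ a ≠ []) (x : ℤ → A) :
    onSeq ξ x = conc ξ x := by
  refine eq_conc hξ fun j t ht => ?_
  obtain j | j := j
  · change _ = some (onSeq ξ x (pos ξ x (j : ℤ) + t))
    have e : pos ξ x (j : ℤ) + t =
        Int.ofNat (∑ i ∈ Finset.range j, (ξ (x i)).length + t) := by
      rw [pos_natCast, Int.ofNat_eq_natCast]; push_cast; rfl
    rw [e]
    -- No image is empty, so the letters that `onSeq` reads before cutting include the one of index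
    -- j.
    have hle : j ≤ ∑ i ∈ Finset.range j, (ξ (x i)).length := by
      have h := le_pos hξ x (j : ℤ) (by omega)
      rw [pos_natCast] at h
      exact_mod_cast h
    have h := getElem?_flatMap_ofFn ξ (fun i => x (i : ℤ))
      (∑ i ∈ Finset.range j, (ξ (x i)).length + t + 1) j t (by omega) ht
    rw [onSeq, h]
    change (ξ (x j))[t]? = _
    have ht : t < (ξ (x j)).length := ht
    rw [List.getElem?_eq_getElem ht]
    rfl
  -- On the negative side `onSeq` reads reversed words: rank t from the left is rank u from the
  -- right.
  · set u := (ξ (x (Int.negSucc j))).length - 1 - t with hu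
    have e : pos ξ x (Int.negSucc j) + t =
        Int.negSucc (∑ i ∈ Finset.range j, (ξ (x (Int.negSucc i))).length + u) := by
      rw [pos_negSucc, Finset.sum_range_succ, Int.negSucc_eq (_ + u), Nat.cast_add, Nat.cast_sum]
      have : (u : ℤ) = (ξ (x (Int.negSucc j))).length - 1 - t := by omega
      rw [this]
      ring
    rw [e]
    have hle : j ≤ ∑ i ∈ Finset.range j, (ξ (x (Int.negSucc i))).length := by
      calc j = ∑ i ∈ Finset.range j, 1 := by simp
        _ ≤ _ := Finset.sum_le_sum fun i _ => List.length_pos_iff.2 (hξ _)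
    have h := getElem?_flatMap_ofFn (fun b => (ξ b).reverse) (fun i => x (Int.negSucc i))
      (∑ i ∈ Finset.range j, (ξ (x (Int.negSucc i))).length + u + 1) j u (by omega)
      (by simp; omega)
    simp only [List.length_reverse] at h
    rw [onSeq, h, List.getElem?_reverse (by omega),
      show (ξ (x (Int.negSucc j))).length - 1 - u = t by omega, List.getElem?_eq_getElem ht]
    rfl

end Concatenation


/-! ### Iterates of the substitution, factors, locality of concatenation -/

section Iterates

variable {A B C : Type*}

theorem iterate_onWord (ξ : A → List A) (n : ℕ) (u : List A) :
    (onWord ξ)^[n] u = u.flatMap (iter ξ n) := by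
  induction u with
  | nil =>
    induction n with
    | zero => rfl
    | succ n ih => rw [Function.iterate_succ_apply', ih]; rfl
  | cons a u ih =>
    have key : ∀ (n : ℕ) (v w : List A),
        (onWord ξ)^[n] (v ++ w) = (onWord ξ)^[n] v ++ (onWord ξ)^[n] w := by
      intro n
      induction n with
      | zero => intro v w; rfl
      | succ n ih =>
        intro v w
        rw [Function.iterate_succ_apply, Function.iterate_succ_apply,
          Function.iterate_succ_apply, ← ih]
        simp [onWord]
    rw [List.flatMap_cons, ← ih, iter, ← key]
    rfl

@[simp] theorem iter_zero (ξ : A → List A) (b : A) : iter ξ 0 b = [b] := rfl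

@[simp] theorem iter_one (ξ : A → List A) (b : A) : iter ξ 1 b = ξ b := by
  simp [iter, onWord]

theorem iter_add (ξ : A → List A) (m n : ℕ) (b : A) :
    iter ξ (m + n) b = (iter ξ m b).flatMap (iter ξ n) := by
  rw [← iterate_onWord, iter, iter, ← Function.iterate_add_apply, add_comm]

theorem iter_succ (ξ : A → List A) (n : ℕ) (b : A) :
    iter ξ (n + 1) b = (iter ξ n b).flatMap ξ := by
  rw [iter_add]
  congr 1
  funext a
  simp

theorem iter_ne_nil {ξ : A → List A} (hξ : ∀ a, ξ a ≠ []) (n : ℕ) (b : A) : iter ξ n b ≠ [] := by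
  induction n with
  | zero => simp
  | succ n ih =>
    rw [iter_add]
    refine fun h => ?_
    rw [List.flatMap_eq_nil_iff] at h
    obtain ⟨c, hc⟩ := List.exists_mem_of_ne_nil _ ih
    exact hξ c (by simpa using h c hc)

theorem length_iter_pos {ξ : A → List A} (hξ : ∀ a, ξ a ≠ []) (n : ℕ) (b : A) :
    0 < (iter ξ n b).length := List.length_pos_iff.2 (iter_ne_nil hξ n b)

theorem conc_iter_add [Nonempty A] {ξ : A → List A} (hξ : ∀ a, ξ a ≠ []) (m n : ℕ) (y : ℤ → A) :
    conc (iter ξ (m + n)) y = conc (iter ξ n) (conc (iter ξ m) y) := by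
  rw [conc_conc (iter_ne_nil hξ m) (iter_ne_nil hξ n)]
  congr 1
  funext a
  exact iter_add ξ m n a

theorem conc_iter_zero [Nonempty A] (ξ : A → List A) (y : ℤ → A) : conc (iter ξ 0) y = y :=
  conc_singleton y

theorem conc_iter_one [Nonempty A] (ξ : A → List A) (y : ℤ → A) :
    conc (iter ξ 1) y = conc ξ y := by
  congr 1
  funext a
  simp

theorem iterate_onSeq [Nonempty A] {ξ : A → List A} (hξ : ∀ a, ξ a ≠ []) (k : ℕ) (x : ℤ → A) :
    (onSeq ξ)^[k] x = conc (iter ξ k) x := by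
  induction k with
  | zero => rw [conc_iter_zero]; rfl
  | succ k ih =>
    rw [Function.iterate_succ_apply', ih, conc_iter_add hξ, conc_iter_one, onSeq_eq_conc hξ]

theorem iterate_shift (j : ℕ) (x : ℤ → A) : shift^[j] x = fun n => x (n + j) := by
  induction j with
  | zero => simp
  | succ j ih =>
    rw [Function.iterate_succ_apply', ih]
    funext n
    simp only [shift]
    congr 1
    push_cast
    ring

/-- The factor of length `n` at position `i`. -/
def window (x : ℤ → A) (i : ℤ) (n : ℕ) : List A := List.ofFn fun j : Fin n => x (i + (j : ℕ))

@[simp] theorem length_window (x : ℤ → A) (i : ℤ) (n : ℕ) : (window x i n).length = n := by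
  simp [window]

theorem getElem?_window (x : ℤ → A) (i : ℤ) {n j : ℕ} (hj : j < n) :
    (window x i n)[j]? = some (x (i + j)) := by
  simp [window, hj]

theorem window_add (x : ℤ → A) (i : ℤ) (m n : ℕ) :
    window x i (m + n) = window x i m ++ window x (i + m) n := by
  apply List.ext_getElem?
  intro j
  rcases lt_or_ge j m with h | h
  · rw [getElem?_window _ _ (by omega), List.getElem?_append_left (by simpa using h),
      getElem?_window _ _ h]
  · rw [List.getElem?_append_right (by simpa using h), length_window]
    rcases lt_or_ge j (m + n) with h' | h'
    · rw [getElem?_window _ _ h', getElem?_window _ _ (by omega)]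
      congr 2
      omega
    · rw [List.getElem?_eq_none (by simpa using h'), List.getElem?_eq_none (by simp; omega)]

theorem window_infix (x : ℤ → A) {i i' : ℤ} {n n' : ℕ} (h : i' ≤ i) (h' : i + n ≤ i' + n') :
    window x i n <:+: window x i' n' := by
  obtain ⟨s, hs⟩ := Int.eq_ofNat_of_zero_le (show 0 ≤ i - i' by omega)
  obtain ⟨t, ht⟩ := Int.eq_ofNat_of_zero_le (show 0 ≤ i' + n' - (i + n) by omega)
  have e : n' = s + n + t := by omega
  have e' : i' + s = i := by omega
  rw [e, window_add, window_add, e']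
  exact ⟨_, _, rfl⟩

theorem window_one (x : ℤ → A) (i : ℤ) : window x i 1 = [x i] := by
  simp [window]

theorem window_two (x : ℤ → A) (i : ℤ) : window x i 2 = [x i, x (i + 1)] := by
  rw [show 2 = 1 + 1 from rfl, window_add, window_one, window_one]
  simp

theorem window_conc_letter [Nonempty B] {σ : A → List B} (hσ : ∀ a, σ a ≠ []) (y : ℤ → A)
    (j : ℤ) : window (conc σ y) (pos σ y j) (σ (y j)).length = σ (y j) := by
  apply List.ext_getElem?
  intro t
  rcases lt_or_ge t (σ (y j)).length with h | h
  · rw [getElem?_window _ _ h, conc_spec hσ y h]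
  · rw [List.getElem?_eq_none (by simpa using h), List.getElem?_eq_none h]

theorem window_conc [Nonempty B] {σ : A → List B} (hσ : ∀ a, σ a ≠ []) (y : ℤ → A)
    (j : ℤ) (n : ℕ) : window (conc σ y) (pos σ y j) ((window y j n).flatMap σ).length =
      (window y j n).flatMap σ ∧
      pos σ y (j + n) = pos σ y j + ((window y j n).flatMap σ).length := by
  induction n with
  | zero => simp [window]
  | succ n ih =>
    rw [window_add, List.flatMap_append, List.length_append, window_add, ih.1, ← ih.2, window_one]
    simp only [List.flatMap_cons, List.flatMap_nil, List.append_nil]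
    refine ⟨by rw [window_conc_letter hσ], ?_⟩
    push_cast
    rw [← add_assoc, pos_add_one, ih.2]
    ring

theorem pos_eq_of_agree {σ : A → List B} {y y' : ℤ → A} {j : ℤ}
    (h : ∀ i, |i| ≤ |j| → y i = y' i) : pos σ y j = pos σ y' j := by
  obtain n | n := j
  · change pos σ y (n : ℤ) = pos σ y' (n : ℤ)
    rw [pos_natCast, pos_natCast]
    refine Finset.sum_congr rfl fun i hi => ?_
    rw [h]
    simp at hi ⊢
    omega
  · rw [pos_negSucc, pos_negSucc]
    congr 1
    refine Finset.sum_congr rfl fun i hi => ?_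
    rw [h]
    simp only [Finset.mem_range] at hi
    rw [Int.negSucc_eq, Int.negSucc_eq, abs_neg, abs_neg, abs_of_nonneg (by positivity),
      abs_of_nonneg (by positivity)]
    omega

theorem abs_cell_le {σ : A → List B} (hσ : ∀ a, σ a ≠ []) (y : ℤ → A) {j : ℤ} {t : ℕ}
    (ht : t < (σ (y j)).length) : |j| ≤ |pos σ y j + t| := by
  rcases le_or_gt 0 j with h | h
  · have := le_pos hσ y j h
    rw [abs_of_nonneg h, abs_of_nonneg (by omega)]
    omega
  · have h1 := pos_le hσ y (j + 1) (by omega)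
    rw [pos_add_one] at h1
    rw [abs_of_neg h, abs_of_neg (by omega)]
    omega

/-- Non-empty images push positions away from the origin, so the cell of position n has index at
most |n| in modulus. Continuity of `conc` rests on this. -/
theorem conc_eq_of_agree [Nonempty B] {σ : A → List B} (hσ : ∀ a, σ a ≠ []) {y y' : ℤ → A} {n : ℤ}
    (h : ∀ i, |i| ≤ |n| → y i = y' i) : conc σ y n = conc σ y' n := by
  obtain ⟨j, t, ht, rfl⟩ := exists_cell hσ y n
  have hj := abs_cell_le hσ y ht
  have h1 := conc_spec hσ y ht
  rw [h j hj] at h1 ht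
  rw [conc_spec hσ y' ht, pos_eq_of_agree fun i hi => (h i (hi.trans hj)).symm] at h1
  exact (Option.some.inj h1).symm

theorem pos_sub_le {σ : A → List B} {H : ℕ} (hH : ∀ a, (σ a).length ≤ H) (y : ℤ → A) {i j : ℤ}
    (hij : i ≤ j) : pos σ y j - pos σ y i ≤ H * (j - i) := by
  induction j, hij using Int.leInduction with
  | base => simp
  | succ j _ ih =>
    rw [pos_add_one]
    have := hH (y j)
    have : ((σ (y j)).length : ℤ) ≤ H := by exact_mod_cast this
    linarith

theorem le_pos_sub {σ : A → List B} {H : ℕ} (hH : ∀ a, H ≤ (σ a).length) (y : ℤ → A) {i j : ℤ}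
    (hij : i ≤ j) : H * (j - i) ≤ pos σ y j - pos σ y i := by
  induction j, hij using Int.leInduction with
  | base => simp
  | succ j _ ih =>
    rw [pos_add_one]
    have := hH (y j)
    have : (H : ℤ) ≤ (σ (y j)).length := by exact_mod_cast this
    linarith

end Iterates

/-! ### Desubstitution of the points of the subshift -/

section Language

variable {A : Type*} {ξ : A → List A}

theorem mem_language_of_infix {u v : List A} (h : v <:+: u) (hu : u ∈ language ξ) :
    v ∈ language ξ := by
  obtain ⟨n, b, hb⟩ := hu
  exact ⟨n, b, h.trans hb⟩

theorem infix_flatMap (σ : A → List A) {u v : List A} (h : u <:+: v) :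
    u.flatMap σ <:+: v.flatMap σ := by
  obtain ⟨s, t, rfl⟩ := h
  exact ⟨s.flatMap σ, t.flatMap σ, by simp⟩

theorem flatMap_iter_mem_language {u : List A} (hu : u ∈ language ξ) (k : ℕ) :
    u.flatMap (iter ξ k) ∈ language ξ := by
  obtain ⟨n, b, hb⟩ := hu
  exact ⟨n + k, b, by rw [iter_add]; exact infix_flatMap _ hb⟩

theorem mem_Omega_iff {x : ℤ → A} : x ∈ Omega ξ ↔ ∀ i n, window x i n ∈ language ξ := Iff.rfl

theorem shiftBy_mem_Omega {x : ℤ → A} (hx : x ∈ Omega ξ) (j : ℤ) :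
    (fun n => x (n + j)) ∈ Omega ξ := by
  intro i n
  have h := hx (i + j) n
  convert h using 4
  ring

theorem conc_mem_Omega [Nonempty A] (hξ : ∀ a, ξ a ≠ []) (k : ℕ) {y : ℤ → A} (hy : y ∈ Omega ξ) :
    conc (iter ξ k) y ∈ Omega ξ := by
  have hk := iter_ne_nil hξ k
  rw [mem_Omega_iff]
  intro i n
  obtain ⟨j, t, ht, rfl⟩ := exists_cell hk y i
  have h1 := window_conc hk y j (t + n)
  have h2 := le_pos_sub (H := 1) (fun a => length_iter_pos hξ k a) y
    (show j ≤ j + (t + n : ℕ) by omega)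
  refine mem_language_of_infix ?_ (flatMap_iter_mem_language (mem_Omega_iff.1 hy j (t + n)) k)
  rw [← h1.1]
  refine window_infix _ (by omega) ?_
  rw [← h1.2]
  push_cast at h2 ⊢
  linarith

/-- Ultrafilters on a finite set are principal. A limit along the hyperfilter replaces a diagonal
extraction. -/
theorem exists_eventually_eq [Finite A] (f : ℕ → A) :
    ∃ a, ∀ᶠ n in (hyperfilter ℕ : Filter ℕ), f n = a := by
  obtain ⟨a, ha⟩ := Ultrafilter.eq_pure_of_finite ((hyperfilter ℕ).map f)
  refine ⟨a, ?_⟩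
  have : {a} ∈ (hyperfilter ℕ).map f := by rw [ha]; exact Set.mem_singleton a
  exact this

/-- A finite version of the desubstitution of a point of `Ω`. -/
theorem exists_local_desubstitution [Finite A] [Nonempty A] (hξ : ∀ a, ξ a ≠ []) {H : ℕ}
    (hH : ∀ a, (ξ a).length ≤ H) {x : ℤ → A} (hx : x ∈ Omega ξ) (N : ℕ) (hN : 1 ≤ N) :
    ∃ (y : ℤ → A) (i : ℕ), i < H ∧ i < (ξ (y 0)).length ∧
      (∀ n : ℤ, |n| ≤ N → x n = conc ξ y (n + i)) ∧
      ∀ (j : ℤ) (n : ℕ), H * (|j| + n + 1) ≤ N → window y j n ∈ language ξ := by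
  obtain ⟨m, b, hmb⟩ := mem_Omega_iff.1 hx (-N) (2 * N + 1)
  -- The factor has length 2N + 1 ≥ 3, so it does not occur in a single letter and one ξ can be
  -- removed.
  obtain _ | m := m
  · have := hmb.length_le
    simp at this
    omega
  rw [iter_succ] at hmb
  set u := iter ξ m b with hu
  obtain ⟨s, t, hst⟩ := hmb
  -- The value b outside u is a filler; the final bound on j and n keeps the factors considered
  -- inside u.
  set y₀ : ℤ → A := fun j => u[j.toNat]?.getD b with hy₀
  have hwu : window y₀ 0 u.length = u := by
    apply List.ext_getElem?
    intro j
    rcases lt_or_ge j u.length with h | h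
    · rw [getElem?_window _ _ h]
      simp [hy₀, List.getElem?_eq_getElem h]
    · rw [List.getElem?_eq_none (by simpa using h), List.getElem?_eq_none h]
  obtain ⟨h1, h2⟩ := window_conc hξ y₀ 0 u.length
  rw [hwu, pos_zero] at h1 h2
  rw [zero_add, zero_add] at h2
  have hlen : (u.flatMap ξ).length = s.length + (2 * N + 1) + t.length := by
    rw [← hst]; simp [add_assoc]
  have hxy : ∀ n : ℤ, |n| ≤ N → x n = conc ξ y₀ (n + (s.length + N)) := by
    intro n hn
    rw [abs_le] at hn
    obtain ⟨q, hq⟩ := Int.eq_ofNat_of_zero_le (show 0 ≤ n + N by omega)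
    have e1 := getElem?_window x (-N) (show q < 2 * N + 1 by omega)
    have e2 := getElem?_window (conc ξ y₀) 0 (n := (u.flatMap ξ).length)
      (show s.length + q < (u.flatMap ξ).length by omega)
    rw [h1, ← hst, List.append_assoc, List.getElem?_append_right (by omega),
      List.getElem?_append_left (by simp; omega), Nat.add_sub_cancel_left, e1] at e2
    have := Option.some.inj e2
    rw [show -(N : ℤ) + q = n by omega] at this
    rw [this]
    congr 1
    push_cast
    omega
  -- The origin of x sits at position |s| + N of ξ(u); c is the index of the letter whose image
  -- contains it.
  obtain ⟨c, i, hi, hci⟩ := exists_cell hξ y₀ (s.length + N)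
  refine ⟨fun n => y₀ (n + c), i, hi.trans_le (hH _), by simpa using hi, ?_, ?_⟩
  · intro n hn
    rw [hxy n hn, conc_shift hξ]
    simp only
    congr 1
    omega
  · intro j n hjn
    have hc0 : 0 ≤ c := by
      by_contra! hc
      have := pos_le hξ y₀ (c + 1) (by omega)
      rw [pos_add_one] at this
      omega
    have hcu : c ≤ u.length := by
      by_contra! hc
      have := (pos_strictMono hξ y₀).monotone hc.le
      omega
    have hHi : (i : ℤ) < H := by exact_mod_cast hi.trans_le (hH _)
    have b1 := pos_sub_le hH y₀ hc0
    rw [pos_zero] at b1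
    have b2 := pos_sub_le hH y₀ hcu
    have b3 : (s.length : ℤ) + (2 * N + 1) ≤ pos ξ y₀ u.length := by
      rw [h2, hlen]; push_cast; omega
    have hHpos : (0 : ℤ) < H := by omega
    -- On each side of the origin ξ(u) has at least N positions, and a letter of u accounts for at
    -- most H of them.
    have k1 : 0 ≤ c + j := by
      by_contra! hcon
      have : -j ≤ |j| := neg_le_abs j
      nlinarith
    have k2 : c + j + n ≤ u.length := by
      by_contra! hcon
      have : j ≤ |j| := le_abs_self j
      nlinarith
    have hw : window (fun n => y₀ (n + c)) j n = window y₀ (c + j) n := by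
      simp only [window]
      congr 1
      funext k
      congr 1
      ring
    rw [hw]
    refine mem_language_of_infix (u := u) ?_ ⟨m, b, List.infix_refl _⟩
    rw [← hwu]
    exact window_infix _ (by omega) (by omega)

/-- Every point of `Ω` is a shift of a point of `ξ(Ω)`. -/
theorem exists_desubstitution_one [Finite A] [Nonempty A] (hξ : ∀ a, ξ a ≠ []) {x : ℤ → A}
    (hx : x ∈ Omega ξ) : ∃ y ∈ Omega ξ, ∃ i < (ξ (y 0)).length,
      x = fun n => conc ξ y (n + i) := by
  obtain ⟨H, hH⟩ : ∃ H, ∀ a, (ξ a).length ≤ H := by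
    obtain ⟨H, hH⟩ := (Set.finite_range fun a => (ξ a).length).bddAbove
    exact ⟨H, fun a => hH ⟨a, rfl⟩⟩
  choose y i hiH hi hxy hw using fun N : ℕ =>
    exists_local_desubstitution hξ hH hx (N + 1) (by omega)
  -- Compactness: the desubstitutions of larger and larger windows converge coordinatewise along the
  -- hyperfilter, and so do their offsets, which are bounded by H.
  choose z hz using fun j : ℤ => exists_eventually_eq fun N => y N j
  obtain ⟨i₀, hi₀⟩ := exists_eventually_eq fun N => (⟨i N, hiH N⟩ : Fin H)
  have hag : ∀ m : ℤ, ∀ᶠ N in (hyperfilter ℕ : Filter ℕ), ∀ j, |j| ≤ |m| → y N j = z j := by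
    intro m
    have : ∀ᶠ N in (hyperfilter ℕ : Filter ℕ), ∀ j ∈ Finset.Icc (-|m|) |m|, y N j = z j :=
      (Filter.eventually_all_finset _).2 fun j _ => hz j
    filter_upwards [this] with N hN j hj
    rw [abs_le] at hj
    exact hN j (Finset.mem_Icc.2 hj)
  have hlarge : ∀ m : ℕ, ∀ᶠ N in (hyperfilter ℕ : Filter ℕ), m ≤ N := by
    intro m
    have : ∀ᶠ N in atTop, m ≤ N := eventually_ge_atTop m
    rw [← Nat.cofinite_eq_atTop] at this
    exact Filter.hyperfilter_le_cofinite this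
  refine ⟨z, ?_, i₀, ?_, ?_⟩
  · rw [mem_Omega_iff]
    intro j n
    obtain ⟨N, h1, h2⟩ := ((hag (|j| + n)).and (hlarge (H * (j.natAbs + n + 1)))).exists
    have h3 := hw N j n (by
      have : ((H * (j.natAbs + n + 1) : ℕ) : ℤ) ≤ N := by exact_mod_cast h2
      push_cast at this ⊢
      linarith)
    convert h3 using 1
    simp only [window]
    congr 1
    funext k
    rw [h1]
    have hk := k.2
    rw [abs_of_nonneg (show 0 ≤ |j| + (n : ℤ) by positivity)]
    refine (abs_add_le _ _).trans ?_
    simp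
  · obtain ⟨N, h1, h2⟩ := ((hag 0).and hi₀).exists
    rw [← h1 0 (by simp), ← h2]
    exact hi N
  · funext n
    obtain ⟨N, h1, h2, h3⟩ := ((hag (n + i₀)).and ((hlarge n.natAbs).and hi₀)).exists
    rw [hxy N n (by rw [Int.abs_eq_natAbs]; omega)]
    have : i N = i₀ := by rw [← h3]
    rw [this]
    exact conc_eq_of_agree hξ h1

theorem exists_desubstitution [Finite A] [Nonempty A] (hξ : ∀ a, ξ a ≠ []) (k : ℕ) {x : ℤ → A}
    (hx : x ∈ Omega ξ) : ∃ y ∈ Omega ξ, ∃ i < (iter ξ k (y 0)).length,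
      x = fun n => conc (iter ξ k) y (n + i) := by
  induction k with
  | zero => exact ⟨x, hx, 0, by simp, by simp [conc_iter_zero]⟩
  | succ k ih =>
    obtain ⟨y, hy, i, hi, rfl⟩ := ih
    obtain ⟨z, hz, j, hj, rfl⟩ := exists_desubstitution_one hξ hy
    have e1 : conc (iter ξ k) (fun n => conc ξ z (n + j)) =
        fun n => conc (iter ξ (k + 1)) z (n + pos (iter ξ k) (conc ξ z) j) := by
      rw [conc_shift (iter_ne_nil hξ k), add_comm k 1, conc_iter_add hξ, conc_iter_one]
    have e2 := pos_conc_add (τ := iter ξ k) hξ z 0 j hj.le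
    simp only [pos_zero, zero_add] at e2
    refine ⟨z, hz, (((ξ (z 0)).take j).flatMap (iter ξ k)).length + i, ?_, ?_⟩
    · have h1 := conc_spec hξ z hj
      rw [pos_zero, zero_add, List.getElem?_eq_getElem hj] at h1
      have h1 := Option.some.inj h1
      simp only [zero_add, ← h1] at hi
      have h3 : iter ξ (k + 1) (z 0) = ((ξ (z 0)).take j).flatMap (iter ξ k) ++
          (iter ξ k (ξ (z 0))[j] ++ ((ξ (z 0)).drop (j + 1)).flatMap (iter ξ k)) := by
        rw [add_comm, iter_add, iter_one]
        conv_lhs => rw [← List.take_append_drop j (ξ (z 0)), List.drop_eq_getElem_cons hj]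
        rw [List.flatMap_append, List.flatMap_cons]
      rw [h3]
      simp
      omega
    · rw [e1, e2]
      funext n
      beta_reduce
      congr 1
      push_cast
      ring

end Language

/-! ### Consequences of primitivity for words and lengths -/

section Primitive

variable {A : Type*} {ξ : A → List A}

theorem count_flatMap [Fintype A] [DecidableEq A] (σ : A → List A) (u : List A) (a : A) :
    (u.flatMap σ).count a = ∑ b, (σ b).count a * u.count b := by
  induction u with
  | nil => simp
  | cons c u ih =>
    have h : ∀ b, (c :: u).count b = u.count b + if c = b then 1 else 0 := fun b => by
      simp [List.count_cons]
    rw [List.flatMap_cons, List.count_append, ih]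
    simp_rw [h, mul_add, Finset.sum_add_distrib]
    simp [add_comm]

theorem incidence_pow_apply [Fintype A] [DecidableEq A] (R : Type*) [CommSemiring R]
    (ξ : A → List A) (k : ℕ) (a b : A) :
    (incidence R ξ ^ k) a b = ((iter ξ k b).count a : R) := by
  induction k generalizing a b with
  | zero =>
    rw [pow_zero, iter_zero, Matrix.one_apply, List.count_singleton]
    by_cases h : a = b
    · simp [h]
    · simp [h, Ne.symm h]
  | succ k ih =>
    rw [iter_succ, count_flatMap, pow_succ', Matrix.mul_apply]
    push_cast
    refine Finset.sum_congr rfl fun c _ => ?_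
    rw [ih]
    rfl

theorem exists_forall_mem_iter [Fintype A] [DecidableEq A] (hξ : ∀ a, ξ a ≠ [])
    (hp : (incidence ℝ ξ).IsPrimitive) : ∃ p, ∀ n ≥ p, ∀ a b, a ∈ iter ξ n b := by
  obtain ⟨p, -, hp⟩ := hp.exists_pos_pow
  refine ⟨p, fun n hn => ?_⟩
  induction n, hn using Nat.le_induction with
  | base =>
    intro a b
    have := hp a b
    rw [incidence_pow_apply] at this
    exact List.count_pos_iff.1 (by exact_mod_cast this)
  | succ n _ ih =>
    intro a b
    rw [add_comm, iter_add, iter_one, List.mem_flatMap]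
    obtain ⟨c, hc⟩ := List.exists_mem_of_ne_nil _ (hξ b)
    exact ⟨c, hc, ih a c⟩

theorem iter_infix_iter {m n : ℕ} {b c : A} (h : c ∈ iter ξ m b) :
    iter ξ n c <:+: iter ξ (m + n) b := by
  rw [iter_add]
  obtain ⟨s, t, hst⟩ := List.append_of_mem h
  rw [hst]
  exact ⟨s.flatMap (iter ξ n), t.flatMap (iter ξ n), by simp⟩

/-- There are finitely many pairs, so one exponent serves them all. Pairs are what is needed to
carry a period of ξᵖ⁺ᵏ(b) across the junction of two consecutive words ξᵏ(c)ξᵏ(d). -/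
theorem exists_pair_infix_iter [Fintype A] [DecidableEq A] (hξ : ∀ a, ξ a ≠ [])
    (hp : (incidence ℝ ξ).IsPrimitive) :
    ∃ p, ∀ b c d, [c, d] ∈ language ξ → [c, d] <:+: iter ξ p b := by
  obtain ⟨p, hp⟩ := exists_forall_mem_iter hξ hp
  have : ∀ q : A × A, ∃ n, ∀ m ≥ n, ∀ b, [q.1, q.2] ∈ language ξ → [q.1, q.2] <:+: iter ξ m b := by
    intro q
    by_cases h : [q.1, q.2] ∈ language ξ
    · obtain ⟨n, b, hb⟩ := h
      refine ⟨p + n, fun m hm b' _ => ?_⟩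
      have := hb.trans (iter_infix_iter (m := m - n) (hp (m - n) (by omega) b b'))
      rwa [Nat.sub_add_cancel (by omega)] at this
    · exact ⟨0, fun m _ b h' => absurd h' h⟩
  choose n hn using this
  exact ⟨Finset.univ.sup n, fun b c d h =>
    hn (c, d) _ (Finset.le_sup (f := n) (Finset.mem_univ (c, d))) b h⟩

theorem length_flatMap_eq_sum [Fintype A] [DecidableEq A] (σ : A → List A) (u : List A) :
    (u.flatMap σ).length = ∑ c, u.count c * (σ c).length := by
  induction u with
  | nil => simp
  | cons c u ih =>
    have h : ∀ b, (c :: u).count b = u.count b + if c = b then 1 else 0 := fun b => by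
      simp [List.count_cons]
    rw [List.flatMap_cons, List.length_append, ih]
    simp_rw [h, add_mul, Finset.sum_add_distrib]
    simp [add_comm]

theorem length_flatMap_le {σ : A → List A} {H : ℕ} (u : List A)
    (h : ∀ a, (σ a).length ≤ H) : (u.flatMap σ).length ≤ u.length * H := by
  induction u with
  | nil => simp
  | cons c u ih =>
    rw [List.flatMap_cons, List.length_append, List.length_cons, add_mul]
    have := h c
    omega

theorem length_iter_mono (hξ : ∀ a, ξ a ≠ []) {m n : ℕ} (h : m ≤ n) (a : A) :
    (iter ξ m a).length ≤ (iter ξ n a).length := by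
  induction n, h using Nat.le_induction with
  | base => exact le_rfl
  | succ n _ ih =>
    refine ih.trans ?_
    rw [iter_succ]
    generalize iter ξ n a = u
    induction u with
    | nil => simp
    | cons c u ih =>
      rw [List.flatMap_cons, List.length_append, List.length_cons]
      have := List.length_pos_iff.2 (hξ c)
      omega

/-- The lengths of the words `ξᵏ(a)` are comparable. -/
theorem exists_length_iter_le [Fintype A] [DecidableEq A] (hξ : ∀ a, ξ a ≠ [])
    (hp : (incidence ℝ ξ).IsPrimitive) :
    ∃ C, 0 < C ∧ ∀ k a b, (iter ξ k a).length ≤ C * (iter ξ k b).length := by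
  obtain ⟨p, hp⟩ := exists_forall_mem_iter hξ hp
  obtain ⟨H, hH⟩ := (Set.finite_range fun a => (iter ξ p a).length).bddAbove
  have hH : ∀ a, (iter ξ p a).length ≤ H := fun a => hH ⟨a, rfl⟩
  refine ⟨H + 1, by omega, fun k a b => ?_⟩
  refine le_trans ?_ (Nat.mul_le_mul_right _ (Nat.le_succ H))
  rcases le_or_gt k p with hk | hk
  · calc _ ≤ _ := length_iter_mono hξ hk a
      _ ≤ H := hH a
      _ ≤ _ := Nat.le_mul_of_pos_right _ (length_iter_pos hξ k b)
  -- Beyond p, the word of a consists of at most H words ξᵏ⁺¹(c), each of which occurs in the word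
  -- of b because c occurs in ξᵖ(b).
  · obtain ⟨k, rfl⟩ := Nat.exists_eq_add_of_lt hk
    rw [show p + k + 1 = p + (k + 1) by ring]
    have h1 : ∀ c, (iter ξ (k + 1) c).length ≤ (iter ξ (p + (k + 1)) b).length := fun c =>
      (iter_infix_iter (hp p le_rfl c b)).length_le
    calc (iter ξ (p + (k + 1)) a).length
        ≤ (iter ξ p a).length * (iter ξ (p + (k + 1)) b).length := by
          conv_lhs => rw [iter_add]
          exact length_flatMap_le _ h1
      _ ≤ _ := Nat.mul_le_mul_right _ (hH a)

end Primitive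


/-! ### Recognizability of aperiodic primitive substitutions -/

section Recognizability

variable {A B : Type*} {ξ : A → List A}

/-- When every image has length at least w, a window of radius R fixes the concatenation up to
distance wR. The scale w matters for the pigeonhole argument below. -/
theorem conc_eq_of_agree_of_le [Nonempty B] {σ : A → List B} (hσ : ∀ a, σ a ≠ []) {w R : ℕ}
    (hw : ∀ a, w ≤ (σ a).length) {y y' : ℤ → A} (h : ∀ j : ℤ, |j| ≤ R → y j = y' j)
    {n : ℤ} (hn : |n| ≤ w * R) : conc σ y n = conc σ y' n := by
  obtain ⟨j, t, ht, rfl⟩ := exists_cell hσ y n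
  have hj : |j| ≤ R := by
    rw [abs_le] at hn ⊢
    by_contra! hcon
    rcases lt_or_ge j 0 with h0 | h0
    · have h1 : j < -R := by
        by_contra! h1
        have := hcon h1
        omega
      have h2 := le_pos_sub hw y (show j + 1 ≤ 0 by omega)
      rw [pos_add_one, pos_zero] at h2
      have : (w : ℤ) * R ≤ w * (0 - (j + 1)) := by
        apply mul_le_mul_of_nonneg_left <;> omega
      omega
    · have h1 : (R : ℤ) < j := hcon (by omega)
      have h2 := le_pos_sub hw y h0
      rw [pos_zero] at h2
      rcases Nat.eq_zero_or_pos w with rfl | hw0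
      · have := le_pos hσ y j h0
        simp at hn
        omega
      · have : (w : ℤ) * R < w * (j - 0) := by
          apply mul_lt_mul_of_pos_left <;> omega
        omega
  have hag : ∀ i, |i| ≤ |j| → y i = y' i := fun i hi => h i (hi.trans hj)
  have h1 := conc_spec hσ y ht
  rw [h j hj] at h1 ht
  rw [conc_spec hσ y' ht, pos_eq_of_agree fun i hi => (hag i hi).symm] at h1
  exact (Option.some.inj h1).symm

/-- A short period of a word `ξᵏ(b)` propagates to the whole subshift. -/
theorem periodic_of_period_iter [Fintype A] [DecidableEq A] [Nonempty A] (hξ : ∀ a, ξ a ≠ [])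
    {p : ℕ} (hp : ∀ b c d, [c, d] ∈ language ξ → [c, d] <:+: iter ξ p b) {k q : ℕ} {b : A}
    (hq : ∀ a, q ≤ (iter ξ k a).length)
    (hper : ∀ t, t + q < (iter ξ (p + k) b).length →
      (iter ξ (p + k) b)[t]? = (iter ξ (p + k) b)[t + q]?) :
    ∀ x ∈ Omega ξ, ∀ n : ℤ, x (n + q) = x n := by
  have hk := iter_ne_nil hξ k
  intro x hx n
  obtain ⟨y, hy, i, -, rfl⟩ := exists_desubstitution hξ k hx
  beta_reduce
  rw [show n + q + i = n + i + q by ring]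
  generalize n + i = m
  obtain ⟨j, t, ht, rfl⟩ := exists_cell hk y m
  obtain ⟨h1, -⟩ := window_conc hk y j 2
  have h2 := mem_Omega_iff.1 hy j 2
  rw [window_two] at h1 h2
  have hlen : (List.flatMap (iter ξ k) [y j, y (j + 1)]).length =
      (iter ξ k (y j)).length + (iter ξ k (y (j + 1))).length := by simp
  have hqj := hq (y (j + 1))
  -- The pair at cell j occurs in ξᵖ(b), so its image occurs in ξᵖ⁺ᵏ(b); as q is at most the length
  -- of the second image, t and t + q both lie in it.
  have h3 := infix_flatMap (iter ξ k) (hp b _ _ h2)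
  rw [← iter_add] at h3
  obtain ⟨s, u, hsu⟩ := h3
  have e : ∀ t' < (List.flatMap (iter ξ k) [y j, y (j + 1)]).length,
      (iter ξ (p + k) b)[s.length + t']? = some (conc (iter ξ k) y (pos (iter ξ k) y j + t')) := by
    intro t' ht'
    have := getElem?_window (conc (iter ξ k) y) (pos (iter ξ k) y j) ht'
    rw [h1] at this
    rw [← this, ← hsu, List.append_assoc, List.getElem?_append_right (by omega),
      List.getElem?_append_left (by omega), Nat.add_sub_cancel_left]
  have e1 := e t (by omega)
  have e2 := e (t + q) (by omega)
  have hlen2 : (iter ξ (p + k) b).length =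
      s.length + (List.flatMap (iter ξ k) [y j, y (j + 1)]).length + u.length := by
    rw [← hsu]; simp [add_assoc]
  rw [hper _ (by omega), add_assoc, e2] at e1
  rw [add_assoc]
  push_cast at e1
  exact Option.some.inj e1

/-- The word `ξᵏ(a)` with each place labelled by the letter `a` and its rank. -/
def label (ξ : A → List A) (k : ℕ) (a : A) : List (A × ℕ) :=
  (List.range (iter ξ k a).length).map fun t => (a, t)

@[simp] theorem length_label (k : ℕ) (a : A) : (label ξ k a).length = (iter ξ k a).length := by
  simp [label]

theorem label_ne_nil (hξ : ∀ a, ξ a ≠ []) (k : ℕ) (a : A) : label ξ k a ≠ [] := by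
  rw [← List.length_pos_iff, length_label]
  exact length_iter_pos hξ k a

/-- The sequence that gives, at each place of `ξᵏ(y)`, the letter of `y` from which this place
comes and its rank in the image of this letter. -/
noncomputable def coding [Nonempty A] (ξ : A → List A) (k : ℕ) (y : ℤ → A) : ℤ → A × ℕ :=
  conc (label ξ k) y

theorem coding_apply [Nonempty A] (hξ : ∀ a, ξ a ≠ []) (k : ℕ) (y : ℤ → A) {j : ℤ} {t : ℕ}
    (ht : t < (iter ξ k (y j)).length) :
    coding ξ k y (pos (iter ξ k) y j + t) = (y j, t) := by
  have h := conc_spec (label_ne_nil hξ k) y (j := j) (t := t) (by simpa using ht)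
  rw [pos_congr (τ := iter ξ k) (length_label k)] at h
  rw [coding, ← Option.some_inj, ← h]
  simp [label, ht]

theorem coding_shift [Nonempty A] (hξ : ∀ a, ξ a ≠ []) (k : ℕ) (y : ℤ → A) (i : ℤ) :
    coding ξ k (fun n => y (n + i)) = fun n => coding ξ k y (n + pos (iter ξ k) y i) := by
  rw [coding, conc_shift (label_ne_nil hξ k), pos_congr (τ := iter ξ k) (length_label k)]
  rfl

/-- The coding of level `l` as a function of the coding of level `m + l`. -/
def relabel (ξ : A → List A) (m l : ℕ) (c : A × ℕ) : A × ℕ :=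
  (((iter ξ m c.1).flatMap (label ξ l))[c.2]?).getD c

/-- A place of ξᵐ⁺ˡ(a) determines its place in the words ξˡ(c) of which ξᵐ⁺ˡ(a) consists. Codings of
lower level are thus letter-to-letter functions of those of higher level. -/
theorem coding_conc [Nonempty A] (hξ : ∀ a, ξ a ≠ []) (m l : ℕ) (y : ℤ → A) (n : ℤ) :
    coding ξ l (conc (iter ξ m) y) n = relabel ξ m l (coding ξ (m + l) y n) := by
  have hlen : ∀ a, ((iter ξ m a).flatMap (label ξ l)).length = (iter ξ (m + l) a).length := by
    intro a
    rw [iter_add, List.length_flatMap, List.length_flatMap]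
    simp
  obtain ⟨j, t, ht, rfl⟩ := exists_cell (iter_ne_nil hξ (m + l)) y n
  rw [coding_apply hξ _ y ht, coding, conc_conc (iter_ne_nil hξ m) (label_ne_nil hξ l), relabel,
    ← pos_congr (σ := fun a => (iter ξ m a).flatMap (label ξ l)) hlen]
  have := conc_spec (flatMap_ne_nil (iter_ne_nil hξ m) (label_ne_nil hξ l)) y
    (j := j) (t := t) (by rw [hlen]; exact ht)
  simp only at this ⊢
  rw [this]
  rfl

theorem length_take_flatMap_lt {σ : A → List B} (hσ : ∀ a, σ a ≠ []) {u : List A} {r r' : ℕ}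
    (h : r < r') (h' : r' ≤ u.length) :
    ((u.take r).flatMap σ).length < ((u.take r').flatMap σ).length := by
  obtain ⟨d, rfl⟩ := Nat.exists_eq_add_of_lt h
  rw [add_assoc, List.take_add, List.flatMap_append, List.length_append]
  have : 0 < (((u.drop r).take (d + 1)).flatMap σ).length := by
    rw [List.drop_eq_getElem_cons (by omega), List.take_succ_cons, List.flatMap_cons,
      List.length_append]
    have := List.length_pos_iff.2 (hσ u[r])
    omega
  omega

/-- Applying ξⁱ to the shift of ξ(y) by r, then desubstituting J times, brings all the i < J to the
common level J, where they can be compared. The label (u 0, s) of the origin still remembers y 0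
and, through the length of ξⁱ of the first r letters of ξ(y 0), also r. -/
theorem exists_lift [Finite A] [Nonempty A] (hξ : ∀ a, ξ a ≠ []) {y : ℤ → A} (hy : y ∈ Omega ξ)
    {r : ℕ} (hr : r < (ξ (y 0)).length) {i J : ℕ} (hiJ : i < J) :
    ∃ (u : ℤ → A) (s : ℕ), s < (iter ξ J (u 0)).length ∧
      conc (iter ξ i) (fun n => conc ξ y (n + r)) = (fun n => conc (iter ξ J) u (n + s)) ∧
      (∀ n, coding ξ i (fun n => conc ξ y (n + r)) n =
        relabel ξ (J - i) i (coding ξ J u (n + s))) ∧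
      relabel ξ (J - i - 1) (i + 1) (u 0, s) =
        (y 0, (((ξ (y 0)).take r).flatMap (iter ξ i)).length) := by
  obtain ⟨u, -, t, ht, rfl⟩ := exists_desubstitution hξ (J - i - 1) hy
  set Y := conc (iter ξ (J - i - 1)) u with hY
  beta_reduce at hr ⊢
  rw [zero_add] at hr ⊢
  set ρ := (((ξ (Y t)).take r).flatMap (iter ξ i)).length with hρ
  have hYt : coding ξ (i + 1) Y (pos (iter ξ (i + 1)) Y t + ρ) = (Y t, ρ) := by
    refine coding_apply hξ _ Y ?_
    have := length_take_flatMap_lt (iter_ne_nil hξ i) hr le_rfl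
    rw [List.take_length] at this
    rwa [add_comm i, iter_add, iter_one]
  have hρlt : ρ < (iter ξ (i + 1) (Y t)).length := by
    have := length_take_flatMap_lt (iter_ne_nil hξ i) hr le_rfl
    rw [List.take_length] at this
    rwa [add_comm i, iter_add, iter_one]
  have hpos : 0 ≤ pos (iter ξ (i + 1)) Y t := by
    have := le_pos (iter_ne_nil hξ (i + 1)) Y t (by omega)
    omega
  obtain ⟨s, hs⟩ := Int.eq_ofNat_of_zero_le (show 0 ≤ pos (iter ξ (i + 1)) Y t + ρ by omega)
  have hJ : J - i - 1 + (i + 1) = J := by omega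
  have hsJ : s < (iter ξ J (u 0)).length := by
    have h1 := (pos_strictMono (iter_ne_nil hξ (i + 1)) Y).monotone
      (show (t : ℤ) + 1 ≤ pos (iter ξ (J - i - 1)) u 1 by
        rw [show (1 : ℤ) = 0 + 1 by rfl, pos_add_one, pos_zero]; omega)
    rw [pos_conc (iter_ne_nil hξ _), pos_add_one] at h1
    have h2 : pos (fun a => (iter ξ (J - i - 1) a).flatMap (iter ξ (i + 1))) u 1 =
        (iter ξ J (u 0)).length := by
      rw [show (1 : ℤ) = 0 + 1 by rfl, pos_add_one, pos_zero, ← iter_add, hJ]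
      simp
    omega
  have hJY : conc (iter ξ (J - i)) u = conc ξ Y := by
    rw [hY, ← conc_iter_one ξ (conc _ _), ← conc_iter_add hξ, show J - i - 1 + 1 = J - i by omega]
  have hz : (fun n => conc ξ (fun n => Y (n + t)) (n + r)) =
      fun n => conc (iter ξ (J - i)) u (n + (pos ξ Y t + r)) := by
    rw [conc_shift hξ, hJY]
    funext n
    beta_reduce
    congr 1
    ring
  have hps : pos (iter ξ i) (conc (iter ξ (J - i)) u) (pos ξ Y t + r) = s := by
    rw [hJY, pos_conc_add hξ Y t r hr.le, pos_conc hξ, ← Int.ofNat_eq_natCast, ← hs]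
    congr 2
    funext a
    rw [add_comm i, iter_add, iter_one]
  refine ⟨u, s, hsJ, ?_, ?_, ?_⟩
  · rw [hz, conc_shift (iter_ne_nil hξ i), hps, ← conc_iter_add hξ, Nat.sub_add_cancel hiJ.le]
  · intro n
    rw [hz, coding_shift hξ, hps]
    beta_reduce
    rw [coding_conc hξ, Nat.sub_add_cancel hiJ.le]
  · have h1 := coding_conc hξ (J - i - 1) (i + 1) u s
    have h2 := coding_apply hξ J u (j := 0) hsJ
    rw [pos_zero, zero_add] at h2
    rw [hJ, h2] at h1
    rw [← h1, ← hYt, hs]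

/-- Places are determined by the sequence, in an aperiodic subshift. -/
theorem recognizable_origin [Fintype A] [DecidableEq A] [Nonempty A] (hξ : ∀ a, ξ a ≠ [])
    (hprim : (incidence ℝ ξ).IsPrimitive)
    (hap : ∀ q : ℕ, 0 < q → ¬ ∀ x ∈ Omega ξ, ∀ n : ℤ, x (n + q) = x n)
    {y y' : ℤ → A} (hy : y ∈ Omega ξ) (hy' : y' ∈ Omega ξ) {r r' : ℕ}
    (hr : r < (ξ (y 0)).length) (hr' : r' < (ξ (y' 0)).length)
    (h : (fun n => conc ξ y (n + r)) = fun n => conc ξ y' (n + r')) : y 0 = y' 0 ∧ r = r' := by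
  by_contra hne
  obtain ⟨p, hp⟩ := exists_pair_infix_iter hξ hprim
  obtain ⟨C, hC0, hC⟩ := exists_length_iter_le hξ hprim
  obtain ⟨P, hP⟩ := (Set.finite_range fun a => (iter ξ p a).length).bddAbove
  have hP : ∀ a, (iter ξ p a).length ≤ P := fun a => hP ⟨a, rfl⟩
  -- D bounds |ξᵖ⁺ᵏ(a)| divided by the shortest |ξᵏ(c)| independently of k. The number Q of boxes is
  -- thus known before k, which is then taken large enough for Q + 1 levels i < J.
  set D := P * C with hD
  set Q := Fintype.card ((Fin (4 * D + 1) → A) × (Fin (4 * D + 1) → A) × Fin (2 * D + 1)) with hQ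
  set k := Q + 1 with hk
  set J := p + k with hJ
  obtain ⟨a₀, ha₀⟩ := Finite.exists_min fun a => (iter ξ k a).length
  set w := (iter ξ k a₀).length with hw
  have hwpos : 0 < w := length_iter_pos hξ k a₀
  have hwJ : ∀ a, w ≤ (iter ξ J a).length := fun a =>
    (ha₀ a).trans (length_iter_mono hξ (by omega) a)
  have hJw : ∀ a, (iter ξ J a).length ≤ D * w := by
    intro a
    rw [hJ, iter_add]
    refine (length_flatMap_le _ fun c => hC k c a₀).trans ?_
    rw [hD, mul_assoc]
    exact Nat.mul_le_mul_right _ (hP a)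
  choose u s hs hconc hcod hlab using fun i : Fin (Q + 1) =>
    exists_lift hξ hy hr (show (i : ℕ) < J by have := i.2; omega)
  choose u' s' hs' hconc' hcod' hlab' using fun i : Fin (Q + 1) =>
    exists_lift hξ hy' hr' (show (i : ℕ) < J by have := i.2; omega)
  have hsb : ∀ i, s i < D * w := fun i => (hs i).trans_le (hJw _)
  have hsb' : ∀ i, s' i < D * w := fun i => (hs' i).trans_le (hJw _)
  -- Pigeonhole: the box of i records both lifts on a window of radius 2D and their relative
  -- position up to precision w. Adding D * w keeps the natural subtraction from truncating.
  set f : Fin (Q + 1) → (Fin (4 * D + 1) → A) × (Fin (4 * D + 1) → A) × Fin (2 * D + 1) :=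
    fun i => (fun m => u i ((m : ℕ) - (2 * D : ℕ)), fun m => u' i ((m : ℕ) - (2 * D : ℕ)),
      ⟨(s i + D * w - s' i) / w, by
        rw [Nat.div_lt_iff_lt_mul hwpos]
        have := hsb i
        nlinarith [Nat.sub_le (s i + D * w) (s' i)]⟩) with hf
  obtain ⟨i₁, i₂, hne', hfe⟩ := Fintype.exists_ne_map_eq_of_card_lt f (by
    rw [Fintype.card_fin, ← hQ]; omega)
  wlog hlt : i₁ < i₂ generalizing i₁ i₂
  · exact this i₂ i₁ hne'.symm hfe.symm (lt_of_le_of_ne (not_lt.1 hlt) hne'.symm)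
  simp only [hf, Prod.mk.injEq, Fin.mk.injEq] at hfe
  obtain ⟨hu, hu', hbox⟩ := hfe
  have hag : ∀ j : ℤ, |j| ≤ (2 * D : ℕ) → u i₁ j = u i₂ j := by
    intro j hj
    rw [abs_le] at hj
    have := congrFun hu ⟨(j + (2 * D : ℕ)).toNat, by omega⟩
    simp only [Int.toNat_of_nonneg (show 0 ≤ j + (2 * D : ℕ) by omega)] at this
    simpa using this
  have hag' : ∀ j : ℤ, |j| ≤ (2 * D : ℕ) → u' i₁ j = u' i₂ j := by
    intro j hj
    rw [abs_le] at hj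
    have := congrFun hu' ⟨(j + (2 * D : ℕ)).toNat, by omega⟩
    simp only [Int.toNat_of_nonneg (show 0 ≤ j + (2 * D : ℕ) by omega)] at this
    simpa using this
  have h0 : u i₁ 0 = u i₂ 0 := hag 0 (by simp)
  have h0' : u' i₁ 0 = u' i₂ 0 := hag' 0 (by simp)
  -- the two relative positions of the words
  set o₁ : ℤ := s i₁ - s' i₁ with ho₁
  set o₂ : ℤ := s i₂ - s' i₂ with ho₂
  have hX : ∀ i : Fin (Q + 1), ∀ n : ℤ,
      conc (iter ξ J) (u i) (n + (s i - s' i)) = conc (iter ξ J) (u' i) n := by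
    intro i n
    have h1 := hconc i
    rw [h, hconc' i] at h1
    have := congrFun h1 (n - s' i)
    simp only [sub_add_cancel] at this
    rw [this]
    congr 1
    ring
  by_cases ho : o₁ = o₂
  · -- equal relative positions: the coding of the second pair contradicts that of the first one
    have hJ2 : J - i₂ + i₂ = J := by have := i₂.2; omega
    have e : ∀ {a : A} {v : ℤ → A} {S : ℕ}, v 0 = a → S < (iter ξ J a).length →
        coding ξ J v S = (a, S) := by
      intro a v S hv hS
      subst hv
      have := coding_apply hξ J v (j := 0) hS
      rwa [pos_zero, zero_add] at this
    -- At place s i₁ − s i₂ the second pair of lifts shows the labels (u i₁ 0, s i₁) and (u' i₁ 0,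
    -- s' i₁) of the first. Both must relabel to the coding of level i₂ of the same sequence, the
    -- one in `h`.
    have c1 := hcod i₂ ((s i₁ : ℤ) - s i₂)
    have c2 := hcod' i₂ ((s i₁ : ℤ) - s i₂)
    rw [sub_add_cancel, e h0.symm (hs i₁)] at c1
    rw [show (s i₁ : ℤ) - s i₂ + s' i₂ = s' i₁ by omega, e h0'.symm (hs' i₁), ← h, c1] at c2
    -- Since i₁ + 1 ≤ i₂, relabelling from level J to level i₁ + 1 factors through level i₂. Equal
    -- labels there give equal labels at level i₁ + 1, which contain y 0 and r.
    have key : ∀ {a : A} {S : ℕ}, S < (iter ξ J a).length →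
        relabel ξ (J - i₁ - 1) (i₁ + 1) (a, S) =
          relabel ξ (i₂ - i₁ - 1) (i₁ + 1) (relabel ξ (J - i₂) i₂ (a, S)) := by
      intro a S hS
      have hlt' : (i₁ : ℕ) < i₂ := hlt
      have a1 := coding_conc hξ (J - i₁ - 1) (i₁ + 1) (fun _ => a) S
      have a2 := coding_conc hξ (i₂ - i₁ - 1) (i₁ + 1) (conc (iter ξ (J - i₂)) fun _ => a) S
      rw [show (i₂ : ℕ) - i₁ - 1 + (i₁ + 1) = i₂ by omega, coding_conc hξ (J - i₂) i₂, hJ2,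
        e rfl hS, ← conc_iter_add hξ, show J - (i₂ : ℕ) + (i₂ - i₁ - 1) = J - i₁ - 1 by omega] at a2
      rw [a2, show J - (i₁ : ℕ) - 1 + (i₁ + 1) = J by omega, e rfl hS] at a1
      exact a1.symm
    have k1 := key (hs i₁)
    rw [c2, ← key (hs' i₁), hlab, hlab', Prod.mk.injEq] at k1
    obtain ⟨k1, k2⟩ := k1
    refine hne ⟨k1, ?_⟩
    rw [← k1] at k2 hr'
    rcases lt_trichotomy r r' with h | h | h
    · have := length_take_flatMap_lt (iter_ne_nil hξ i₁) h hr'.le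
      omega
    · exact h
    · have := length_take_flatMap_lt (iter_ne_nil hξ i₁) h hr.le
      omega
  · -- distinct relative positions: a short period
    have hd : |o₁ - o₂| < w := by
      have d1 := Nat.div_add_mod (s i₁ + D * w - s' i₁) w
      have d2 := Nat.div_add_mod (s i₂ + D * w - s' i₂) w
      rw [hbox] at d1
      have m1 := Nat.mod_lt (s i₁ + D * w - s' i₁) hwpos
      have m2 := Nat.mod_lt (s i₂ + D * w - s' i₂) hwpos
      have b1 := hsb' i₁
      have b2 := hsb' i₂
      rw [abs_lt]
      omega
    -- On these windows both lifts agree for i₁ and i₂, so one and the same word matches itself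
    -- after a translation by o₂ − o₁, which is shorter than w.
    have hsh : ∀ v : ℤ, 0 ≤ v → v < (iter ξ J (u' i₁ 0)).length →
        conc (iter ξ J) (u' i₁) v = conc (iter ξ J) (u' i₁) (v + (o₂ - o₁)) := by
      intro v hv0 hv
      have hv1 : v < D * w := by
        have := hJw (u' i₁ 0)
        have : ((iter ξ J (u' i₁ 0)).length : ℤ) ≤ (D * w : ℕ) := by exact_mod_cast this
        push_cast at this
        linarith
      have hb : (w : ℤ) * (2 * D : ℕ) = D * w + D * w := by push_cast; ring
      have b0 : ((D * w : ℕ) : ℤ) = D * w := by push_cast; rfl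
      have b1 := hsb i₂
      have b2 := hsb' i₂
      have e1 : conc (iter ξ J) (u' i₁) v = conc (iter ξ J) (u' i₂) v :=
        conc_eq_of_agree_of_le (iter_ne_nil hξ J) hwJ hag' (by
          rw [abs_le]; omega)
      have e2 : conc (iter ξ J) (u i₁) (v + o₂) = conc (iter ξ J) (u i₂) (v + o₂) :=
        conc_eq_of_agree_of_le (iter_ne_nil hξ J) hwJ hag (by
          rw [abs_le]; omega)
      rw [e1, ← hX i₂ v, ← ho₂, ← e2, ← hX i₁, ← ho₁]
      congr 1
      ring
    have hget : ∀ t < (iter ξ J (u' i₁ 0)).length,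
        (iter ξ J (u' i₁ 0))[t]? = some (conc (iter ξ J) (u' i₁) t) := by
      intro t ht
      have := conc_spec (iter_ne_nil hξ J) (u' i₁) ht
      rwa [pos_zero, zero_add] at this
    rw [Int.abs_eq_natAbs] at hd
    have hJp : (iter ξ (p + k) (u' i₁ 0)).length = (iter ξ J (u' i₁ 0)).length := rfl
    refine hap (o₁ - o₂).natAbs (by omega) (periodic_of_period_iter hξ hp (k := k)
      (b := u' i₁ 0) (fun a => ?_) fun t ht => ?_)
    · have := ha₀ a
      omega
    · rw [hget _ (by omega), hget _ ht]
      congr 1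
      rcases le_total o₁ o₂ with hle | hle
      · rw [hsh t (by omega) (by omega)]
        congr 1
        omega
      · rw [hsh (t + (o₁ - o₂).natAbs : ℕ) (by omega) (by omega)]
        congr 1
        omega

/-- With the origin moved to any cell, the previous lemma says that cells with a common place have
the same letter. Starting from position 0, the cells of y and y' are then matched one after the
other in both directions. -/
theorem recognizable_one [Fintype A] [DecidableEq A] [Nonempty A] (hξ : ∀ a, ξ a ≠ [])
    (hprim : (incidence ℝ ξ).IsPrimitive)
    (hap : ∀ q : ℕ, 0 < q → ¬ ∀ x ∈ Omega ξ, ∀ n : ℤ, x (n + q) = x n)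
    {y y' : ℤ → A} (hy : y ∈ Omega ξ) (hy' : y' ∈ Omega ξ) {r r' : ℕ}
    (hr : r < (ξ (y 0)).length) (hr' : r' < (ξ (y' 0)).length)
    (h : (fun n => conc ξ y (n + r)) = fun n => conc ξ y' (n + r')) : r = r' ∧ y = y' := by
  obtain ⟨-, rfl⟩ := recognizable_origin hξ hprim hap hy hy' hr hr' h
  refine ⟨rfl, ?_⟩
  have hc : ∀ n, conc ξ y n = conc ξ y' n := by
    intro n
    have := congrFun h (n - r)
    simpa using this
  have key : ∀ (j j' : ℤ) (s s' : ℕ), s < (ξ (y j)).length → s' < (ξ (y' j')).length →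
      pos ξ y j + s = pos ξ y' j' + s' → y j = y' j' ∧ s = s' := by
    intro j j' s s' hs hs' he
    have := recognizable_origin hξ hprim hap (shiftBy_mem_Omega hy j) (shiftBy_mem_Omega hy' j')
      (r := s) (r' := s') (by simpa using hs) (by simpa using hs') (by
        rw [conc_shift hξ, conc_shift hξ]
        funext n
        simp only
        rw [hc]
        congr 1
        linarith)
    simpa using this
  have hlen : ∀ a, 0 < (ξ a).length := fun a => List.length_pos_iff.2 (hξ a)
  have hpos : ∀ j, pos ξ y j = pos ξ y' j := by
    intro j
    induction j using Int.induction_on with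
    | zero => simp
    | succ j ih =>
      have := (key j j 0 0 (hlen _) (hlen _) (by simp [ih])).1
      rw [pos_add_one, pos_add_one, ih, this]
    | pred j ih =>
      have h1 := pos_add_one ξ y (-j - 1)
      have h2 := pos_add_one ξ y' (-j - 1)
      rw [sub_add_cancel] at h1 h2
      have l1 := hlen (y (-j - 1))
      have l2 := hlen (y' (-j - 1))
      -- Going left only the ends of the two cells are known to coincide, so they are compared at
      -- their last places.
      have := (key (-j - 1) (-j - 1) ((ξ (y (-j - 1))).length - 1)
        ((ξ (y' (-j - 1))).length - 1) (by omega) (by omega) (by omega)).1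
      rw [this] at h1
      omega
  funext j
  exact (key j j 0 0 (hlen _) (hlen _) (by simp [hpos])).1

/-- Recognizability of the powers of an aperiodic primitive substitution. -/
theorem recognizable [Fintype A] [DecidableEq A] [Nonempty A] (hξ : ∀ a, ξ a ≠ [])
    (hprim : (incidence ℝ ξ).IsPrimitive)
    (hap : ∀ q : ℕ, 0 < q → ¬ ∀ x ∈ Omega ξ, ∀ n : ℤ, x (n + q) = x n) (k : ℕ)
    {y y' : ℤ → A} (hy : y ∈ Omega ξ) (hy' : y' ∈ Omega ξ) {r r' : ℕ}
    (hr : r < (iter ξ k (y 0)).length) (hr' : r' < (iter ξ k (y' 0)).length)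
    (h : (fun n => conc (iter ξ k) y (n + r)) = fun n => conc (iter ξ k) y' (n + r')) :
    r = r' ∧ y = y' := by
  induction k generalizing y y' r r' with
  | zero =>
    simp only [iter_zero, List.length_singleton, Nat.lt_one_iff] at hr hr'
    subst hr hr'
    simpa [conc_iter_zero] using h
  | succ k ih =>
    have hk := iter_ne_nil hξ k
    have split : ∀ {y : ℤ → A} {r : ℕ}, r < (iter ξ (k + 1) (y 0)).length →
        ∃ j t : ℕ, j < (ξ (y 0)).length ∧ t < (iter ξ k (conc ξ y j)).length ∧
          pos (iter ξ k) (conc ξ y) j + t = r := by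
      intro y r hr
      obtain ⟨j, t, ht, hjt⟩ := exists_cell hk (conc ξ y) r
      have hj0 : 0 ≤ j := by
        by_contra! hj
        have := (pos_strictMono hk (conc ξ y)).monotone (show j + 1 ≤ 0 by omega)
        rw [pos_add_one, pos_zero] at this
        omega
      obtain ⟨j, rfl⟩ := Int.eq_ofNat_of_zero_le hj0
      refine ⟨j, t, ?_, ht, hjt⟩
      by_contra! hj
      have h1 := pos_conc_add (τ := iter ξ k) hξ y 0 _ le_rfl
      rw [pos_zero, zero_add, pos_zero, zero_add, List.take_length] at h1
      rw [add_comm, iter_add, iter_one] at hr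
      have h2 := (pos_strictMono hk (conc ξ y)).monotone
        (show ((ξ (y 0)).length : ℤ) ≤ (j : ℤ) by exact_mod_cast hj)
      rw [h1] at h2
      omega
    obtain ⟨j, t, hj, ht, hjt⟩ := split hr
    obtain ⟨j', t', hj', ht', hjt'⟩ := split hr'
    have hkc : ∀ y : ℤ → A, conc (iter ξ (k + 1)) y = conc (iter ξ k) (conc ξ y) := by
      intro y
      rw [add_comm, conc_iter_add hξ, conc_iter_one]
    have hΩ : ∀ {y : ℤ → A}, y ∈ Omega ξ → conc ξ y ∈ Omega ξ := by
      intro y hy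
      have := conc_mem_Omega hξ 1 hy
      rwa [conc_iter_one] at this
    obtain ⟨rfl, h2⟩ := ih (shiftBy_mem_Omega (hΩ hy) j) (shiftBy_mem_Omega (hΩ hy') j')
      (r := t) (r' := t') (by simpa using ht) (by simpa using ht') (by
        rw [conc_shift hk, conc_shift hk, ← hkc, ← hkc]
        funext n
        have := congrFun h n
        simp only at this ⊢
        rw [← hjt, ← hjt'] at this
        convert this using 2 <;> ring)
    obtain ⟨rfl, rfl⟩ := recognizable_one hξ hprim hap hy hy' hj hj' h2
    exact ⟨by omega, rfl⟩

end Recognizability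


/-! ### Entrance times and visits in terms of successive desubstitutions -/

section Entrance

set_option linter.unusedSectionVars false

variable {A : Type*} [Fintype A] [DecidableEq A] {ξ : A → List A}

/-- A non-erasing primitive substitution whose subshift is not periodic. -/
structure IsAperiodicPrimitive (ξ : A → List A) : Prop where
  ne_nil : ∀ a, ξ a ≠ []
  primitive : (incidence ℝ ξ).IsPrimitive
  aperiodic : ∀ q : ℕ, 0 < q → ¬ ∀ x ∈ Omega ξ, ∀ n : ℤ, x (n + q) = x n

variable [Nonempty A]

theorem mem_image_onSeq_iff (hξ : ∀ a, ξ a ≠ []) {k : ℕ} {x : ℤ → A} :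
    x ∈ (onSeq ξ)^[k] '' Omega ξ ↔ ∃ y ∈ Omega ξ, x = conc (iter ξ k) y := by
  simp only [Set.mem_image, iterate_onSeq hξ, eq_comm]

theorem mem_base_iff (hξ : ∀ a, ξ a ≠ []) {k : ℕ} {a : A} {x : ℤ → A} :
    x ∈ base ξ k a ↔ ∃ y ∈ Omega ξ, y 0 = a ∧ x = conc (iter ξ k) y := by
  simp only [base, Set.mem_image, iterate_onSeq hξ, Set.mem_ofPred_eq]
  exact ⟨fun ⟨y, ⟨h1, h2⟩, h3⟩ => ⟨y, h1, h2, h3.symm⟩, fun ⟨y, h1, h2, h3⟩ => ⟨y, ⟨h1, h2⟩, h3.symm⟩⟩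

/-- The orbit of ξᵏ(y) meets ξᵏ(Ω) only at the beginnings of cells. This is the form in which
recognizability is used for entrance times and visits. -/
theorem IsAperiodicPrimitive.cell_of_shift_eq (h : IsAperiodicPrimitive ξ) {k : ℕ} {y z : ℤ → A}
    (hy : y ∈ Omega ξ) (hz : z ∈ Omega ξ) {j : ℤ}
    (he : (fun n => conc (iter ξ k) y (n + j)) = conc (iter ξ k) z) :
    ∃ l : ℤ, pos (iter ξ k) y l = j ∧ z = fun n => y (n + l) := by
  have hk := iter_ne_nil h.ne_nil k
  obtain ⟨l, t, ht, rfl⟩ := exists_cell hk y j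
  obtain ⟨rfl, h2⟩ := recognizable h.ne_nil h.primitive h.aperiodic k (shiftBy_mem_Omega hy l) hz
    (r := t) (r' := 0) (by simpa using ht) (length_iter_pos h.ne_nil k _) (by
      rw [conc_shift hk]
      simp only [Nat.cast_zero, add_zero]
      rw [← he]
      funext n
      congr 1
      ring)
  exact ⟨l, by simp, h2.symm⟩

theorem IsAperiodicPrimitive.conc_injective (h : IsAperiodicPrimitive ξ) {k : ℕ} {y z : ℤ → A}
    (hy : y ∈ Omega ξ) (hz : z ∈ Omega ξ) (he : conc (iter ξ k) y = conc (iter ξ k) z) : y = z :=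
  (recognizable h.ne_nil h.primitive h.aperiodic k hy hz (r := 0) (r' := 0)
    (length_iter_pos h.ne_nil k _) (length_iter_pos h.ne_nil k _) (by simpa using he)).2

theorem pos_natCast_nonneg (hξ : ∀ a, ξ a ≠ []) (k : ℕ) (y : ℤ → A) {l : ℤ}
    (h : 0 ≤ pos (iter ξ k) y l) : 0 ≤ l := by
  by_contra! hl
  have := pos_strictMono (iter_ne_nil hξ k) y hl
  rw [pos_zero] at this
  omega

theorem IsAperiodicPrimitive.shift_conc_mem_image_iff (h : IsAperiodicPrimitive ξ) {k : ℕ}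
    {y : ℤ → A} (hy : y ∈ Omega ξ) {j : ℕ} :
    shift^[j] (conc (iter ξ k) y) ∈ (onSeq ξ)^[k] '' Omega ξ ↔
      ∃ l : ℕ, pos (iter ξ k) y l = j := by
  rw [mem_image_onSeq_iff h.ne_nil, iterate_shift]
  constructor
  · rintro ⟨z, hz, he⟩
    obtain ⟨l, hl, -⟩ := h.cell_of_shift_eq hy hz he
    obtain ⟨l, rfl⟩ := Int.eq_ofNat_of_zero_le (pos_natCast_nonneg h.ne_nil k y
      (show 0 ≤ pos (iter ξ k) y l by omega))
    exact ⟨l, hl⟩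
  · rintro ⟨l, hl⟩
    exact ⟨_, shiftBy_mem_Omega hy l, by rw [conc_shift (iter_ne_nil h.ne_nil k), hl]⟩

theorem IsAperiodicPrimitive.shift_conc_mem_base_iff (h : IsAperiodicPrimitive ξ) {k : ℕ}
    {y : ℤ → A} (hy : y ∈ Omega ξ) {j : ℕ} {a : A} :
    shift^[j] (conc (iter ξ k) y) ∈ base ξ k a ↔
      ∃ l : ℕ, pos (iter ξ k) y l = j ∧ y l = a := by
  rw [mem_base_iff h.ne_nil, iterate_shift]
  constructor
  · rintro ⟨z, hz, ha, he⟩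
    obtain ⟨l, hl, rfl⟩ := h.cell_of_shift_eq hy hz he
    obtain ⟨l, rfl⟩ := Int.eq_ofNat_of_zero_le (pos_natCast_nonneg h.ne_nil k y
      (show 0 ≤ pos (iter ξ k) y l by omega))
    exact ⟨l, hl, by simpa using ha⟩
  · rintro ⟨l, hl, ha⟩
    exact ⟨_, shiftBy_mem_Omega hy l, by simpa using ha,
      by rw [conc_shift (iter_ne_nil h.ne_nil k), hl]⟩

theorem exists_shift_mem_image (hξ : ∀ a, ξ a ≠ []) (k : ℕ) {x : ℤ → A} (hx : x ∈ Omega ξ) :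
    ∃ j, (∃ a, j ≤ (iter ξ k a).length) ∧ shift^[j] x ∈ (onSeq ξ)^[k] '' Omega ξ := by
  obtain ⟨y, hy, i, hi, rfl⟩ := exists_desubstitution hξ k hx
  refine ⟨(iter ξ k (y 0)).length - i, ⟨y 0, Nat.sub_le _ _⟩, ?_⟩
  rw [mem_image_onSeq_iff hξ, iterate_shift]
  refine ⟨_, shiftBy_mem_Omega hy 1, ?_⟩
  rw [conc_shift (iter_ne_nil hξ k)]
  have := pos_add_one (iter ξ k) y 0
  rw [pos_zero, zero_add, zero_add] at this
  rw [this]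
  funext n
  congr 1
  omega

theorem shift_entranceTime_mem (hξ : ∀ a, ξ a ≠ []) (k : ℕ) {x : ℤ → A} (hx : x ∈ Omega ξ) :
    shift^[entranceTime ξ k x] x ∈ (onSeq ξ)^[k] '' Omega ξ := by
  obtain ⟨j, -, hj⟩ := exists_shift_mem_image hξ k hx
  exact Nat.sInf_mem (s := {j : ℕ | shift^[j] x ∈ (onSeq ξ)^[k] '' Omega ξ}) ⟨j, hj⟩

theorem entranceTime_le {k j : ℕ} {x : ℤ → A}
    (hj : shift^[j] x ∈ (onSeq ξ)^[k] '' Omega ξ) : entranceTime ξ k x ≤ j := Nat.sInf_le hj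

theorem entranceTime_eq_zero (hξ : ∀ a, ξ a ≠ []) {k : ℕ} {y : ℤ → A} (hy : y ∈ Omega ξ) :
    entranceTime ξ k (conc (iter ξ k) y) = 0 :=
  Nat.le_zero.1 (entranceTime_le ((mem_image_onSeq_iff hξ).2 ⟨y, hy, rfl⟩))

theorem entranceTime_le_length (hξ : ∀ a, ξ a ≠ []) {k H : ℕ}
    (hH : ∀ a, (iter ξ k a).length ≤ H) {x : ℤ → A} (hx : x ∈ Omega ξ) :
    entranceTime ξ k x ≤ H := by
  obtain ⟨j, ⟨a, ha⟩, hj⟩ := exists_shift_mem_image hξ k hx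
  exact (entranceTime_le hj).trans (ha.trans (hH a))

theorem entranceTime_shift_of_pos (hξ : ∀ a, ξ a ≠ []) {k : ℕ} {x : ℤ → A} (hx : x ∈ Omega ξ)
    (h0 : 0 < entranceTime ξ k x) : entranceTime ξ k (shift x) + 1 = entranceTime ξ k x := by
  apply le_antisymm
  · have := shift_entranceTime_mem hξ k hx
    rw [← Nat.sub_add_cancel h0, Function.iterate_succ_apply] at this
    have := entranceTime_le this
    omega
  · apply entranceTime_le
    rw [Function.iterate_succ_apply]
    exact shift_entranceTime_mem hξ k (shift_mem_Omega hx)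

theorem IsAperiodicPrimitive.entranceTime_shift_conc (h : IsAperiodicPrimitive ξ) {k : ℕ}
    {y : ℤ → A} (hy : y ∈ Omega ξ) :
    entranceTime ξ k (shift (conc (iter ξ k) y)) + 1 = (iter ξ k (y 0)).length := by
  have h1 := pos_add_one (iter ξ k) y 0
  rw [pos_zero, zero_add, zero_add] at h1
  have hl := length_iter_pos h.ne_nil k (y 0)
  apply le_antisymm
  · have : shift^[(iter ξ k (y 0)).length - 1] (shift (conc (iter ξ k) y)) ∈
        (onSeq ξ)^[k] '' Omega ξ := by
      rw [← Function.iterate_succ_apply, h.shift_conc_mem_image_iff hy]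
      exact ⟨1, by rw [Nat.cast_one, h1]; congr 1; omega⟩
    have := entranceTime_le this
    omega
  · have h2 := shift_entranceTime_mem h.ne_nil k
      (shift_mem_Omega (conc_mem_Omega h.ne_nil k hy))
    rw [← Function.iterate_succ_apply, h.shift_conc_mem_image_iff hy] at h2
    obtain ⟨l, hl⟩ := h2
    have hl0 : l ≠ 0 := by
      rintro rfl
      simp at hl
      omega
    have := (pos_strictMono (iter_ne_nil h.ne_nil k) y).monotone (show (1 : ℤ) ≤ l by omega)
    omega

open Classical in
/-- The point `y` of `Ω` such that `ξ(y)` is the first point of `ξ(Ω)` on the orbit of `x`. -/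
noncomputable def desub (ξ : A → List A) (x : ℤ → A) : ℤ → A :=
  if h : ∃ y ∈ Omega ξ, shift^[entranceTime ξ 1 x] x = conc ξ y then h.choose else x

theorem desub_spec (hξ : ∀ a, ξ a ≠ []) {x : ℤ → A} (hx : x ∈ Omega ξ) :
    desub ξ x ∈ Omega ξ ∧ shift^[entranceTime ξ 1 x] x = conc ξ (desub ξ x) := by
  have h := shift_entranceTime_mem hξ 1 hx
  rw [mem_image_onSeq_iff hξ] at h
  simp only [conc_iter_one] at h
  rw [desub, dif_pos h]
  exact h.choose_spec

theorem iterate_desub_mem_Omega (hξ : ∀ a, ξ a ≠ []) (k : ℕ) {x : ℤ → A} (hx : x ∈ Omega ξ) :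
    (desub ξ)^[k] x ∈ Omega ξ := by
  induction k with
  | zero => exact hx
  | succ k ih =>
    rw [Function.iterate_succ_apply']
    exact (desub_spec hξ ih).1

theorem IsAperiodicPrimitive.desub_conc (h : IsAperiodicPrimitive ξ) {x : ℤ → A}
    (hx : x ∈ Omega ξ) : desub ξ (conc ξ x) = x := by
  have hm := conc_mem_Omega h.ne_nil 1 hx
  have h0 := entranceTime_eq_zero h.ne_nil (k := 1) hx
  obtain ⟨h1, h2⟩ := desub_spec h.ne_nil hm
  rw [h0] at h2
  rw [conc_iter_one] at h1 h2
  refine h.conc_injective (k := 1) h1 hx ?_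
  rw [conc_iter_one, conc_iter_one, ← h2]
  rfl

theorem IsAperiodicPrimitive.iterate_desub_conc (h : IsAperiodicPrimitive ξ) (k : ℕ) {x : ℤ → A}
    (hx : x ∈ Omega ξ) : (desub ξ)^[k] (conc (iter ξ k) x) = x := by
  induction k with
  | zero => rw [conc_iter_zero]; rfl
  | succ k ih =>
    rw [conc_iter_add h.ne_nil, conc_iter_one, Function.iterate_succ_apply,
      h.desub_conc (conc_mem_Omega h.ne_nil k hx), ih]

theorem shift_of_desub_aux (hξ : ∀ a, ξ a ≠ []) {k : ℕ} {x : ℤ → A} (hx : x ∈ Omega ξ)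
    (ih : shift^[entranceTime ξ k x] x = conc (iter ξ k) ((desub ξ)^[k] x)) :
    (fun n => x (n + (entranceTime ξ k x +
      pos (iter ξ k) ((desub ξ)^[k] x) (entranceTime ξ 1 ((desub ξ)^[k] x))))) =
        conc (iter ξ (k + 1)) ((desub ξ)^[k + 1] x) := by
  have hy := iterate_desub_mem_Omega hξ k hx
  obtain ⟨-, h2⟩ := desub_spec hξ hy
  rw [Function.iterate_succ_apply', add_comm k 1, conc_iter_add hξ, conc_iter_one, ← h2,
    iterate_shift, conc_shift (iter_ne_nil hξ k), ← ih, iterate_shift]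
  funext n
  congr 1
  ring

/-- Write y for the k-th desubstitution of x. An entrance in ξᵏ⁺¹(Ω) is also one in ξᵏ(Ω), hence the
beginning of a cell of ξᵏ(y), and the index of this cell must bring y into ξ(Ω). The next entrance
time is therefore read off from the first entrance of y. -/
theorem IsAperiodicPrimitive.shift_entranceTime (h : IsAperiodicPrimitive ξ) (k : ℕ) {x : ℤ → A}
    (hx : x ∈ Omega ξ) :
    shift^[entranceTime ξ k x] x = conc (iter ξ k) ((desub ξ)^[k] x) ∧
    (entranceTime ξ (k + 1) x : ℤ) = entranceTime ξ k x +
      pos (iter ξ k) ((desub ξ)^[k] x) (entranceTime ξ 1 ((desub ξ)^[k] x)) := by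
  have step : ∀ k, shift^[entranceTime ξ k x] x = conc (iter ξ k) ((desub ξ)^[k] x) →
      (entranceTime ξ (k + 1) x : ℤ) = entranceTime ξ k x +
        pos (iter ξ k) ((desub ξ)^[k] x) (entranceTime ξ 1 ((desub ξ)^[k] x)) := by
    intro k ih
    have hk := iter_ne_nil h.ne_nil k
    have hy := iterate_desub_mem_Omega h.ne_nil k hx
    have haux := shift_of_desub_aux h.ne_nil hx ih
    set y := (desub ξ)^[k] x with hyd
    have hp0 : 0 ≤ pos (iter ξ k) y (entranceTime ξ 1 y) :=
      le_trans (by omega) (le_pos hk y _ (by omega))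
    obtain ⟨P, hP⟩ := Int.eq_ofNat_of_zero_le hp0
    rw [hP] at haux ⊢
    rw [← Int.ofNat_eq_natCast P, Int.ofNat_eq_natCast, ← Nat.cast_add, Nat.cast_inj]
    apply le_antisymm
    · apply entranceTime_le
      rw [mem_image_onSeq_iff h.ne_nil, iterate_shift]
      exact ⟨_, iterate_desub_mem_Omega h.ne_nil (k + 1) hx, by rw [← haux]; push_cast; rfl⟩
    · have hmem := shift_entranceTime_mem h.ne_nil (k + 1) hx
      rw [mem_image_onSeq_iff h.ne_nil] at hmem
      obtain ⟨z, hz, hzx⟩ := hmem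
      set j := entranceTime ξ (k + 1) x with hj
      have hξz : conc ξ z ∈ Omega ξ := by
        have := conc_mem_Omega h.ne_nil 1 hz
        rwa [conc_iter_one] at this
      rw [add_comm k 1, conc_iter_add h.ne_nil, conc_iter_one] at hzx
      have hrj : entranceTime ξ k x ≤ j :=
        entranceTime_le ((mem_image_onSeq_iff h.ne_nil).2 ⟨_, hξz, hzx⟩)
      obtain ⟨d, hd⟩ := Nat.exists_eq_add_of_le hrj
      rw [hd, add_comm (entranceTime ξ k x) d, Function.iterate_add_apply, ih, iterate_shift] at hzx
      obtain ⟨l, hl, hzl⟩ := h.cell_of_shift_eq hy hξz hzx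
      have hl0 := pos_natCast_nonneg h.ne_nil k y (show 0 ≤ pos (iter ξ k) y l by omega)
      obtain ⟨l, rfl⟩ := Int.eq_ofNat_of_zero_le hl0
      have : entranceTime ξ 1 y ≤ l := by
        apply entranceTime_le
        rw [mem_image_onSeq_iff h.ne_nil, iterate_shift]
        exact ⟨z, hz, by rw [conc_iter_one, hzl]⟩
      have := (pos_strictMono hk y).monotone
        (show ((entranceTime ξ 1 y : ℕ) : ℤ) ≤ (l : ℤ) by exact_mod_cast this)
      omega
  refine ⟨?_, ?_⟩
  · induction k with
    | zero =>
      have : entranceTime ξ 0 x = 0 := by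
        have := entranceTime_eq_zero h.ne_nil (k := 0) hx
        rwa [conc_iter_zero] at this
      rw [this, conc_iter_zero]
      rfl
    | succ k ih =>
      rw [← shift_of_desub_aux h.ne_nil hx ih, iterate_shift, step k ih]
  · apply step
    induction k with
    | zero =>
      have : entranceTime ξ 0 x = 0 := by
        have := entranceTime_eq_zero h.ne_nil (k := 0) hx
        rwa [conc_iter_zero] at this
      rw [this, conc_iter_zero]
      rfl
    | succ k ih =>
      rw [← shift_of_desub_aux h.ne_nil hx ih, iterate_shift, step k ih]

/-- Each visit is the beginning of a cell of the k-th desubstitution y, so visits to ξᵏ([a]) become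
occurrences of a among the letters of y that precede its entrance in ξ(Ω). -/
theorem IsAperiodicPrimitive.visits_eq (h : IsAperiodicPrimitive ξ) (k : ℕ) {x : ℤ → A}
    (hx : x ∈ Omega ξ) (a : A) :
    visits ξ k x a = ((Finset.range (entranceTime ξ 1 ((desub ξ)^[k] x))).filter
      fun l => (desub ξ)^[k] x (l : ℕ) = a).card := by
  obtain ⟨h1, h2⟩ := h.shift_entranceTime k hx
  have hy := iterate_desub_mem_Omega h.ne_nil k hx
  set y := (desub ξ)^[k] x with hyd
  have hk := iter_ne_nil h.ne_nil k
  have hmono := pos_strictMono hk y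
  have hnn : ∀ l : ℕ, 0 ≤ pos (iter ξ k) y l := fun l =>
    le_trans (by omega) (le_pos hk y _ (by omega))
  have hmem : ∀ d : ℕ, shift^[entranceTime ξ k x + d] x ∈ base ξ k a ↔
      ∃ l : ℕ, pos (iter ξ k) y l = d ∧ y l = a := by
    intro d
    rw [add_comm, Function.iterate_add_apply, h1, h.shift_conc_mem_base_iff hy]
  rw [visits]
  symm
  refine Finset.card_bij (fun l _ => entranceTime ξ k x + (pos (iter ξ k) y l).toNat) ?_ ?_ ?_
  · intro l hl
    simp only [Finset.mem_filter, Finset.mem_range] at hl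
    have := hmono (show (l : ℤ) < entranceTime ξ 1 y by omega)
    have := hnn l
    simp only [Finset.mem_filter, Finset.mem_Ico]
    refine ⟨⟨by omega, by omega⟩, ?_⟩
    rw [hmem]
    exact ⟨l, by omega, hl.2⟩
  · intro l _ l' _ hll
    have h3 := hnn l
    have h4 := hnn l'
    have := hmono.injective (show pos (iter ξ k) y l = pos (iter ξ k) y l' by omega)
    exact_mod_cast this
  · intro i hi
    simp only [Finset.mem_filter, Finset.mem_Ico] at hi
    obtain ⟨d, rfl⟩ := Nat.exists_eq_add_of_le hi.1.1
    obtain ⟨l, hl, ha⟩ := (hmem d).1 hi.2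
    refine ⟨l, ?_, by omega⟩
    simp only [Finset.mem_filter, Finset.mem_range]
    refine ⟨?_, ha⟩
    have := hmono.lt_iff_lt (a := (l : ℤ)) (b := (entranceTime ξ 1 y : ℤ))
    have := this.1 (by omega)
    exact_mod_cast this

theorem IsAperiodicPrimitive.visits_dotProduct (h : IsAperiodicPrimitive ξ) (k : ℕ) {x : ℤ → A}
    (hx : x ∈ Omega ξ) (u : A → ℝ) :
    (fun a => (visits ξ k x a : ℝ)) ⬝ᵥ u =
      ∑ l ∈ Finset.range (entranceTime ξ 1 ((desub ξ)^[k] x)), u ((desub ξ)^[k] x (l : ℕ)) := by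
  simp only [dotProduct, h.visits_eq k hx]
  rw [← Finset.sum_fiberwise' _ (fun l : ℕ => (desub ξ)^[k] x (l : ℤ)) u]
  simp [Finset.sum_const, nsmul_eq_mul]

/-- Together with the next lemma: ξᵏ shifts the sequence of visit vectors by k places and fills in
zeros, like a multiplication in a numeration system. -/
theorem IsAperiodicPrimitive.visits_conc_add (h : IsAperiodicPrimitive ξ) (k l : ℕ) {x : ℤ → A}
    (hx : x ∈ Omega ξ) (a : A) : visits ξ (k + l) (conc (iter ξ k) x) a = visits ξ l x a := by
  rw [h.visits_eq l hx, h.visits_eq (k + l) (conc_mem_Omega h.ne_nil k hx), add_comm k l,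
    Function.iterate_add_apply, h.iterate_desub_conc k hx]

theorem IsAperiodicPrimitive.visits_conc_of_lt (h : IsAperiodicPrimitive ξ) {k l : ℕ} (hl : l < k)
    {x : ℤ → A} (hx : x ∈ Omega ξ) (a : A) : visits ξ l (conc (iter ξ k) x) a = 0 := by
  obtain ⟨d, rfl⟩ := Nat.exists_eq_add_of_lt hl
  rw [h.visits_eq l (conc_mem_Omega h.ne_nil _ hx), show l + d + 1 = (d + 1) + l by ring,
    conc_iter_add h.ne_nil, h.iterate_desub_conc l (conc_mem_Omega h.ne_nil _ hx),
    conc_iter_add h.ne_nil, entranceTime_eq_zero h.ne_nil (conc_mem_Omega h.ne_nil d hx)]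
  rfl

theorem IsAperiodicPrimitive.exists_visits_le (h : IsAperiodicPrimitive ξ) :
    ∃ H : ℕ, ∀ x ∈ Omega ξ, ∀ k a, visits ξ k x a ≤ H := by
  obtain ⟨H, hH⟩ := (Set.finite_range fun a => (iter ξ 1 a).length).bddAbove
  refine ⟨H, fun x hx k a => ?_⟩
  rw [h.visits_eq k hx]
  refine (Finset.card_filter_le _ _).trans ?_
  rw [Finset.card_range]
  exact entranceTime_le_length h.ne_nil (fun a => hH ⟨a, rfl⟩)
    (iterate_desub_mem_Omega h.ne_nil k hx)

end Entrance


/-! ### Growth of lengths and simplicity of the Perron number -/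

section Perron

set_option linter.unusedSectionVars false

variable {A : Type*} [Fintype A] [DecidableEq A] {ξ : A → List A}

theorem transp_pow_apply (ξ : A → List A) (k : ℕ) (u : A → ℝ) (a : A) :
    (transp ξ ^ k) u a = ∑ b, ((iter ξ k a).count b : ℝ) * u b := by
  have h : (transp ξ ^ k) u = (incidence ℝ ξ ^ k)ᵀ *ᵥ u := by
    rw [transpose_pow]
    induction k with
    | zero => simp
    | succ k ih =>
      rw [pow_succ', pow_succ', Module.End.mul_apply, ih, ← Matrix.mulVec_mulVec]
      rfl
  rw [h]
  simp only [Matrix.mulVec, dotProduct, transpose_apply, incidence_pow_apply]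

theorem length_eq_sum_count (u : List A) : u.length = ∑ b, u.count b := by
  have := length_flatMap_eq_sum (fun a : A => [a]) u
  simpa using this

theorem transp_pow_one (ξ : A → List A) (k : ℕ) (a : A) :
    (transp ξ ^ k) 1 a = (iter ξ k a).length := by
  rw [transp_pow_apply, length_eq_sum_count]
  simp

/-- Lengths are supermultiplicative up to a constant, which turns the exponential rate βᵏ⁺ᵒ⁽ᵏ⁾ into
the bound Cβᵏ. -/
theorem length_iter_mul_le {C : ℕ}
    (hC : ∀ k a b, (iter ξ k a).length ≤ C * (iter ξ k b).length) (k l : ℕ) (a b : A) :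
    (iter ξ k a).length * (iter ξ l b).length ≤ C * (iter ξ (k + l) a).length := by
  rw [iter_add]
  generalize iter ξ k a = u
  induction u with
  | nil => simp
  | cons c u ih =>
    rw [List.flatMap_cons, List.length_append, List.length_cons]
    have := hC l b c
    nlinarith

-- Gelfand's formula: the lengths |ξⁿ(a)| are the row sums of the n-th power of the transposed
-- matrix, whose spectral radius is at most β.
open scoped Matrix.Norms.Operator in
theorem exists_length_iter_le_pow {β x : ℝ} (hβ : IsPerronNumber ξ β) (hβ0 : 0 < β) (hx : β < x) :
    ∃ N, ∀ n ≥ N, ∀ a, ((iter ξ n a).length : ℝ) ≤ x ^ n := by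
  have hx0 := hβ0.trans hx
  have h1 := spectrum.pow_norm_pow_one_div_tendsto_nhds_spectralRadius (incidence ℂ ξ)ᵀ
  have h2 : spectralRadius ℂ (incidence ℂ ξ)ᵀ ≤ ENNReal.ofReal β := by
    refine iSup₂_le fun z hz => ?_
    rw [Matrix.mem_spectrum_iff_isRoot_charpoly, charpoly_transpose] at hz
    have : ‖z‖ ≤ β := by
      by_cases hzβ : z = β
      · rw [hzβ, Complex.norm_real, Real.norm_of_nonneg hβ0.le]
      · exact (hβ.2 z hz hzβ).le
    change ‖z‖ₑ ≤ _
    rw [← ofReal_norm]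
    exact ENNReal.ofReal_le_ofReal this
  have h3 : ∀ᶠ n : ℕ in atTop, ENNReal.ofReal (‖(incidence ℂ ξ)ᵀ ^ n‖ ^ (1 / n : ℝ)) <
      ENNReal.ofReal x :=
    h1.eventually_lt_const (h2.trans_lt ((ENNReal.ofReal_lt_ofReal_iff hx0).2 hx))
  obtain ⟨N, hN⟩ := eventually_atTop.1 h3
  refine ⟨N + 1, fun n hn a => ?_⟩
  have h4 := (ENNReal.ofReal_lt_ofReal_iff hx0).1 (hN n (by omega))
  have hn0 : (n : ℝ) ≠ 0 := by
    have : n ≠ 0 := by omega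
    exact_mod_cast this
  have h5 : ‖(incidence ℂ ξ)ᵀ ^ n‖ ≤ x ^ n := by
    have := pow_le_pow_left₀ (by positivity) h4.le n
    rwa [← Real.rpow_natCast, ← Real.rpow_mul (norm_nonneg _), one_div_mul_cancel hn0,
      Real.rpow_one] at this
  refine le_trans ?_ h5
  rw [Matrix.linfty_opNorm_def]
  have h6 := Finset.le_sup (f := fun i => ∑ j, ‖((incidence ℂ ξ)ᵀ ^ n) i j‖₊) (Finset.mem_univ a)
  have h7 : ((∑ j, ‖((incidence ℂ ξ)ᵀ ^ n) a j‖₊ : NNReal) : ℝ) = (iter ξ n a).length := by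
    rw [length_eq_sum_count]
    push_cast
    refine Finset.sum_congr rfl fun b _ => ?_
    rw [← transpose_pow, transpose_apply, incidence_pow_apply]
    simp
  rw [← h7]
  exact_mod_cast h6

/-- The lengths of the words `ξᵏ(a)` grow at most like `βᵏ`. -/
theorem exists_length_iter_le_mul_pow [Nonempty A] (hξ : ∀ a, ξ a ≠ [])
    (hprim : (incidence ℝ ξ).IsPrimitive) {β : ℝ} (hβ : IsPerronNumber ξ β) (hβ0 : 0 < β) :
    ∃ C : ℝ, 0 < C ∧ ∀ k a, ((iter ξ k a).length : ℝ) ≤ C * β ^ k := by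
  obtain ⟨C, hC0, hC⟩ := exists_length_iter_le hξ hprim
  have hC0' : (0 : ℝ) < C := by exact_mod_cast hC0
  refine ⟨C, hC0', fun k a => ?_⟩
  rcases Nat.eq_zero_or_pos k with rfl | hk
  · simp
    exact_mod_cast hC0
  by_contra! hcon
  -- A value y > βᵏ would be amplified: |ξᵏ⁽ʲ⁺¹⁾(a)| ≥ C yʲ⁺¹ for all j, which exceeds every rate x
  -- with β < x and xᵏ < y.
  set y : ℝ := (iter ξ k a).length / C with hy
  have hyβ : β ^ k < y := by rw [hy, lt_div_iff₀ hC0']; linarith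
  obtain ⟨x, hβx, hxy⟩ : ∃ x, β < x ∧ x ^ k < y := by
    have h1 : ∀ᶠ x in 𝓝 β, x ^ k < y :=
      (continuous_pow k).continuousAt.eventually_lt_const hyβ
    have h2 : ∀ᶠ x in 𝓝[>] β, x ^ k < y := h1.filter_mono nhdsWithin_le_nhds
    obtain ⟨x, hx1, hx2⟩ := (h2.and self_mem_nhdsWithin).exists
    exact ⟨x, hx2, hx1⟩
  obtain ⟨N, hN⟩ := exists_length_iter_le_pow hβ hβ0 hβx
  have hpow : ∀ j : ℕ, y ^ (j + 1) * C ≤ (iter ξ (k * (j + 1)) a).length := by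
    intro j
    induction j with
    | zero => rw [zero_add, pow_one, mul_one, hy, div_mul_cancel₀ _ hC0'.ne']
    | succ j ih =>
      have h1 := length_iter_mul_le hC k (k * (j + 1)) a a
      have h1' : ((iter ξ k a).length : ℝ) * (iter ξ (k * (j + 1)) a).length ≤
          C * (iter ξ (k + k * (j + 1)) a).length := by exact_mod_cast h1
      rw [show k * (j + 1 + 1) = k + k * (j + 1) by ring]
      have hy' : ((iter ξ k a).length : ℝ) = y * C := by rw [hy, div_mul_cancel₀ _ hC0'.ne']
      rw [hy'] at h1'
      have hy0 : 0 < y := (pow_pos hβ0 k).trans hyβ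
      have h2 := mul_le_mul_of_nonneg_left ih (show 0 ≤ y * C by positivity)
      have h3 : C * (y ^ (j + 1 + 1) * C) ≤ C * ((iter ξ (k + k * (j + 1)) a).length : ℝ) := by
        calc C * (y ^ (j + 1 + 1) * C) = y * C * (y ^ (j + 1) * C) := by ring
          _ ≤ _ := h2.trans h1'
      exact le_of_mul_le_mul_left h3 hC0'
  have hx0 := hβ0.trans hβx
  have h1 : y ^ (N + 1) * C ≤ (x ^ k) ^ (N + 1) := by
    refine (hpow N).trans ?_
    rw [← pow_mul]
    exact hN _ (by nlinarith) a
  have h2 : (x ^ k) ^ (N + 1) < y ^ (N + 1) :=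
    pow_lt_pow_left₀ hxy (by positivity) (by omega)
  have hC1 : (1 : ℝ) ≤ C := by exact_mod_cast hC0
  have h3 : 0 < y ^ (N + 1) := pow_pos ((pow_pos hβ0 k).trans hyβ) _
  nlinarith

/-- An eigenvector for the Perron number that has a zero coordinate vanishes. -/
theorem eq_zero_of_perron_eigenvector [Nonempty A] (hξ : ∀ a, ξ a ≠ [])
    (hprim : (incidence ℝ ξ).IsPrimitive) {β : ℝ} (hβ : IsPerronNumber ξ β) (hβ0 : 0 < β)
    {x : A → ℝ} (hx : transp ξ x = β • x) {a : A} (ha : x a = 0) : x = 0 := by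
  by_contra hne
  obtain ⟨p, hp⟩ := exists_forall_mem_iter hξ hprim
  have hp := hp p le_rfl
  obtain ⟨C, hC0, hC⟩ := exists_length_iter_le_mul_pow hξ hprim hβ hβ0
  have hP : ∀ c b, (0 : ℝ) < ((iter ξ p c).count b : ℝ) := fun c b => by
    exact_mod_cast List.count_pos_iff.2 (hp b c)
  have hxk : ∀ k : ℕ, (transp ξ ^ k) x = β ^ k • x := by
    intro k
    induction k with
    | zero => simp
    | succ k ih => rw [pow_succ, Module.End.mul_apply, hx, map_smul, ih, smul_smul, pow_succ, mul_comm]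
  have hxp : ∀ c, ∑ b, ((iter ξ p c).count b : ℝ) * x b = β ^ p * x c := by
    intro c
    rw [← transp_pow_apply, hxk]
    rfl
  -- A power of the matrix is positive, so an eigenvector of constant sign with a zero coordinate
  -- vanishes; a nonzero x takes both signs.
  have hzero : (∀ b, 0 ≤ x b) → False := by
    intro h
    have h1 := hxp a
    rw [ha, mul_zero, Finset.sum_eq_zero_iff_of_nonneg fun b _ => mul_nonneg (hP a b).le (h b)] at h1
    refine hne (funext fun b => ?_)
    have := h1 b (Finset.mem_univ b)
    exact (mul_eq_zero.1 this).resolve_left (hP a b).ne'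
  have hzero' : (∀ b, x b ≤ 0) → False := by
    intro h
    have h1 := hxp a
    rw [ha, mul_zero, Finset.sum_eq_zero_iff_of_nonpos fun b _ =>
      mul_nonpos_of_nonneg_of_nonpos (hP a b).le (h b)] at h1
    refine hne (funext fun b => ?_)
    have := h1 b (Finset.mem_univ b)
    exact (mul_eq_zero.1 this).resolve_left (hP a b).ne'
  obtain ⟨b₁, hb₁⟩ : ∃ b, x b < 0 := by by_contra! h; exact hzero h
  obtain ⟨b₂, hb₂⟩ : ∃ b, 0 < x b := by by_contra! h; exact hzero' h
  -- Both signs make the triangle inequality strict in every row. By finiteness there is a uniform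
  -- factor δ > βᵖ, and |x| then grows faster than the lengths allow.
  have hstrict : ∀ c, β ^ p * |x c| < ∑ b, ((iter ξ p c).count b : ℝ) * |x b| := by
    intro c
    rw [← abs_of_pos (pow_pos hβ0 p), ← abs_mul, ← hxp, abs_lt]
    constructor
    · rw [← Finset.sum_neg_distrib]
      refine Finset.sum_lt_sum (fun b _ => ?_) ⟨b₂, Finset.mem_univ _, ?_⟩
      · nlinarith [neg_abs_le (x b), hP c b]
      · rw [abs_of_pos hb₂]; nlinarith [hP c b₂]
    · refine Finset.sum_lt_sum (fun b _ => ?_) ⟨b₁, Finset.mem_univ _, ?_⟩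
      · nlinarith [le_abs_self (x b), hP c b]
      · rw [abs_of_neg hb₁]; nlinarith [hP c b₁]
  obtain ⟨δ, hδ, hδx⟩ : ∃ δ : ℝ, β ^ p < δ ∧
      ∀ c, δ * |x c| ≤ ∑ b, ((iter ξ p c).count b : ℝ) * |x b| := by
    have h1 : ∀ c, ∀ᶠ δ in 𝓝 (β ^ p), δ * |x c| < ∑ b, ((iter ξ p c).count b : ℝ) * |x b| :=
      fun c => (by fun_prop : ContinuousAt (fun δ : ℝ => δ * |x c|) (β ^ p)).eventually_lt_const
        (hstrict c)
    have h2 : ∀ᶠ δ in 𝓝[>] (β ^ p), ∀ c, δ * |x c| < ∑ b, ((iter ξ p c).count b : ℝ) * |x b| :=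
      (eventually_all.2 h1).filter_mono nhdsWithin_le_nhds
    obtain ⟨δ, h3, h4⟩ := (h2.and self_mem_nhdsWithin).exists
    exact ⟨δ, h4, fun c => (h3 c).le⟩
  have hδ0 : 0 < δ := (pow_pos hβ0 p).trans hδ
  have hiter : ∀ (j : ℕ) c, δ ^ j * |x c| ≤ (transp ξ ^ (p * j)) (fun b => |x b|) c := by
    intro j
    induction j with
    | zero => simp
    | succ j ih =>
      intro c
      rw [mul_add, mul_one, add_comm (p * j), pow_add (transp ξ), Module.End.mul_apply, transp_pow_apply]
      calc δ ^ (j + 1) * |x c| = δ ^ j * (δ * |x c|) := by ring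
        _ ≤ δ ^ j * ∑ b, ((iter ξ p c).count b : ℝ) * |x b| :=
          mul_le_mul_of_nonneg_left (hδx c) (by positivity)
        _ = ∑ b, ((iter ξ p c).count b : ℝ) * (δ ^ j * |x b|) := by
          rw [Finset.mul_sum]
          exact Finset.sum_congr rfl fun b _ => by ring
        _ ≤ _ := Finset.sum_le_sum fun b _ => mul_le_mul_of_nonneg_left (ih b) (by positivity)
  set X := ∑ b, |x b| with hX
  have hub : ∀ j : ℕ, (transp ξ ^ (p * j)) (fun b => |x b|) b₂ ≤ X * C * (β ^ p) ^ j := by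
    intro j
    rw [transp_pow_apply]
    calc ∑ b, ((iter ξ (p * j) b₂).count b : ℝ) * |x b|
        ≤ ∑ b, ((iter ξ (p * j) b₂).count b : ℝ) * X := by
          refine Finset.sum_le_sum fun b _ => mul_le_mul_of_nonneg_left ?_ (by positivity)
          exact Finset.single_le_sum (f := fun b => |x b|) (fun _ _ => abs_nonneg _)
            (Finset.mem_univ b)
      _ = X * (iter ξ (p * j) b₂).length := by
          rw [← Finset.sum_mul, length_eq_sum_count]; push_cast; ring
      _ ≤ X * (C * β ^ (p * j)) :=
          mul_le_mul_of_nonneg_left (hC _ _) (Finset.sum_nonneg fun _ _ => abs_nonneg _)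
      _ = _ := by rw [pow_mul]; ring
  have hβp : 0 < β ^ p := pow_pos hβ0 p
  obtain ⟨j, hj⟩ := pow_unbounded_of_one_lt (X * C / |x b₂|)
    (show 1 < δ / β ^ p by rwa [one_lt_div hβp])
  have h1 := (hiter j b₂).trans (hub j)
  have h2 : 0 < |x b₂| := abs_pos.2 hb₂.ne'
  rw [div_lt_iff₀ h2, div_pow, div_mul_eq_mul_div, lt_div_iff₀ (by positivity)] at hj
  linarith

theorem charpoly_transp (ξ : A → List A) :
    (transp ξ).charpoly = (incidence ℤ ξ).charpoly.map (Int.castRingHom ℝ) := by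
  rw [transp, Matrix.charpoly_mulVecLin, charpoly_transpose, ← Matrix.charpoly_map]
  congr 1

theorem charpoly_incidence_complex (ξ : A → List A) :
    (incidence ℂ ξ).charpoly = (transp ξ).charpoly.map (algebraMap ℝ ℂ) := by
  rw [transp, Matrix.charpoly_mulVecLin, charpoly_transpose, ← Matrix.charpoly_map]
  congr 1

/-- The Perron number is a simple root of the characteristic polynomial. -/
theorem rootMultiplicity_perron_le_one [Nonempty A] (hξ : ∀ a, ξ a ≠ [])
    (hprim : (incidence ℝ ξ).IsPrimitive) {β : ℝ} (hβ : IsPerronNumber ξ β) (hβ0 : 0 < β) :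
    (incidence ℂ ξ).charpoly.rootMultiplicity (β : ℂ) ≤ 1 := by
  obtain ⟨C, hC0, hC⟩ := exists_length_iter_le_mul_pow hξ hprim hβ hβ0
  have e : ((β : ℝ) : ℂ) = algebraMap ℝ ℂ β := rfl
  rw [charpoly_incidence_complex, e, ← Polynomial.eq_rootMultiplicity_map
    (algebraMap ℝ ℂ).injective, ← LinearMap.finrank_maxGenEigenspace_eq]
  set L := transp ξ with hL
  -- there is no Jordan block
  have hker : ∀ y : A → ℝ, (L - algebraMap ℝ _ β) ((L - algebraMap ℝ _ β) y) = 0 →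
      (L - algebraMap ℝ _ β) y = 0 := by
    intro y hy
    set z := (L - algebraMap ℝ _ β) y with hz
    have h1 : L z = β • z := by
      simpa [sub_eq_zero, Module.algebraMap_end_apply] using hy
    have h2 : L y = β • y + z := by
      rw [hz]; simp [Module.algebraMap_end_apply]
    -- A Jordan block would produce growth like kβᵏ⁻¹, against the bound Cβᵏ on the lengths.
    have h3 : ∀ k : ℕ, (L ^ k) y = β ^ k • y + (k * β ^ (k - 1)) • z := by
      intro k
      induction k with
      | zero => simp
      | succ k ih =>
        rw [pow_succ', Module.End.mul_apply, ih, map_add, map_smul, map_smul, h1, h2]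
        rcases k with _ | k
        · simp
        · simp only [Nat.add_sub_cancel]
          push_cast
          module
    by_contra hne
    obtain ⟨c, hc⟩ : ∃ c, z c ≠ 0 := by
      by_contra! h
      exact hne (funext h)
    set Y := ∑ b, |y b| with hY
    have hub : ∀ k : ℕ, |(L ^ k) y c| ≤ Y * C * β ^ k := by
      intro k
      rw [hL, transp_pow_apply]
      calc |∑ b, ((iter ξ k c).count b : ℝ) * y b|
          ≤ ∑ b, |((iter ξ k c).count b : ℝ) * y b| := Finset.abs_sum_le_sum_abs _ _
        _ ≤ ∑ b, ((iter ξ k c).count b : ℝ) * Y := by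
            refine Finset.sum_le_sum fun b _ => ?_
            rw [abs_mul, Nat.abs_cast]
            refine mul_le_mul_of_nonneg_left ?_ (by positivity)
            exact Finset.single_le_sum (f := fun b => |y b|) (fun _ _ => abs_nonneg _)
              (Finset.mem_univ b)
        _ = Y * (iter ξ k c).length := by
            rw [← Finset.sum_mul, length_eq_sum_count]; push_cast; ring
        _ ≤ Y * (C * β ^ k) :=
            mul_le_mul_of_nonneg_left (hC _ _) (Finset.sum_nonneg fun _ _ => abs_nonneg _)
        _ = _ := by ring
    have h4 : ∀ k : ℕ, (k : ℝ) * |z c| ≤ (Y * C + |y c|) * β := by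
      intro k
      rcases k with _ | k
      · simp only [Nat.cast_zero, zero_mul]
        positivity
      have h5 := hub (k + 1)
      rw [h3] at h5
      simp only [Pi.add_apply, Pi.smul_apply, smul_eq_mul, Nat.add_sub_cancel] at h5
      have hβk : 0 < β ^ k := pow_pos hβ0 k
      have h6 : |((k + 1 : ℕ) : ℝ) * β ^ k * z c| ≤ Y * C * β ^ (k + 1) + β ^ (k + 1) * |y c| := by
        have h7 := abs_sub_abs_le_abs_sub (((k + 1 : ℕ) : ℝ) * β ^ k * z c) (-(β ^ (k + 1) * y c))
        rw [abs_neg, abs_mul (β ^ (k + 1)), abs_of_pos (pow_pos hβ0 (k + 1)), sub_neg_eq_add,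
          add_comm _ (β ^ (k + 1) * y c)] at h7
        linarith
      rw [abs_mul, abs_mul, Nat.abs_cast, abs_of_pos hβk, pow_succ] at h6
      refine le_of_mul_le_mul_right ?_ hβk
      linarith
    obtain ⟨k, hk⟩ := exists_nat_gt ((Y * C + |y c|) * β / |z c|)
    rw [div_lt_iff₀ (abs_pos.2 hc)] at hk
    linarith [h4 k]
  have hmax : ∀ y ∈ Module.End.maxGenEigenspace L β, L y = β • y := by
    intro y hy
    rw [Module.End.mem_maxGenEigenspace] at hy
    obtain ⟨k, hk⟩ := hy
    have hk' : ((L - algebraMap ℝ _ β) ^ k) y = 0 := by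
      rw [← hk, Algebra.algebraMap_eq_smul_one]
    have : ∀ k : ℕ, ((L - algebraMap ℝ _ β) ^ (k + 1)) y = 0 → (L - algebraMap ℝ _ β) y = 0 := by
      intro k
      induction k with
      | zero => simp
      | succ k ih =>
        intro h
        apply ih
        rw [pow_succ', Module.End.mul_apply]
        apply hker
        rw [pow_succ', Module.End.mul_apply, pow_succ', Module.End.mul_apply] at h
        exact h
    have h0 := this k (by rw [pow_succ', Module.End.mul_apply, hk', map_zero])
    simpa [sub_eq_zero, Module.algebraMap_end_apply] using h0
  obtain ⟨a⟩ := ‹Nonempty A›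
  -- An eigenvector with one zero coordinate vanishes, so a single coordinate embeds the generalised
  -- eigenspace in ℝ.
  have hinj : Function.Injective
      ((LinearMap.proj (R := ℝ) (φ := fun _ : A => ℝ) a).comp (Module.End.maxGenEigenspace L β).subtype) := by
    rw [← LinearMap.ker_eq_bot, LinearMap.ker_eq_bot']
    rintro ⟨y, hy⟩ h
    have : Nonempty A := ⟨a⟩
    exact Subtype.ext (eq_zero_of_perron_eigenvector hξ hprim hβ hβ0 (hmax y hy) h)
  have := LinearMap.finrank_le_finrank_of_injective hinj
  simpa using this

end Perron


/-! ### Invertibility over the integers on the eventual range -/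

section Unimodular

set_option linter.unusedSectionVars false

/-- At each real t this is the determinant of the block triangular map t − f. -/
theorem charpoly_eq_restrict_mul_mapQ {V : Type*} [AddCommGroup V] [Module ℝ V]
    [FiniteDimensional ℝ V] (f : V →ₗ[ℝ] V) (W : Submodule ℝ V) (hW : ∀ v ∈ W, f v ∈ W) :
    f.charpoly = (f.restrict hW).charpoly * (W.mapQ W f hW).charpoly := by
  refine Polynomial.funext fun t => ?_
  rw [Polynomial.eval_mul, LinearMap.eval_charpoly, LinearMap.eval_charpoly,
    LinearMap.eval_charpoly]
  have h : W ≤ W.comap (algebraMap ℝ (V →ₗ[ℝ] V) t - f) := fun v hv =>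
    W.sub_mem (W.smul_mem t hv) (hW v hv)
  rw [LinearMap.det_eq_det_mul_det W _ h]
  congr 2
  ext v
  rfl

theorem norm_coeff_zero_eq_prod {p : Polynomial ℂ} (hp : p.Monic) :
    ‖p.coeff 0‖ = (p.roots.map norm).prod := by
  rw [(IsAlgClosed.splits p).coeff_zero_eq_prod_roots_of_monic hp, norm_mul, norm_pow, norm_neg,
    norm_one, one_pow, one_mul]
  exact (Multiset.prod_hom p.roots (normHom : ℂ →*₀ ℝ)).symm

theorem prod_norm_le {s : Multiset ℂ} {β : ℝ} (hβ : 1 ≤ β) (hcount : s.count (β : ℂ) ≤ 1)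
    (h : ∀ z ∈ s, z ≠ β → ‖z‖ ≤ 1) : (s.map norm).prod ≤ β := by
  have h1 : ∀ s : Multiset ℂ, (∀ z ∈ s, ‖z‖ ≤ 1) → (s.map norm).prod ≤ 1 := by
    intro s
    induction s using Multiset.induction_on with
    | empty => simp
    | cons z s ih =>
      intro hs
      rw [Multiset.map_cons, Multiset.prod_cons]
      refine mul_le_one₀ (hs z (Multiset.mem_cons_self _ _)) ?_
        (ih fun y hy => hs y (Multiset.mem_cons_of_mem hy))
      exact Multiset.prod_nonneg fun y hy => by
        obtain ⟨x, -, rfl⟩ := Multiset.mem_map.1 hy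
        positivity
  by_cases hmem : (β : ℂ) ∈ s
  · obtain ⟨t, rfl⟩ := Multiset.exists_cons_of_mem hmem
    rw [Multiset.count_cons_self] at hcount
    have ht : (β : ℂ) ∉ t := Multiset.count_eq_zero.1 (by omega)
    rw [Multiset.map_cons, Multiset.prod_cons, Complex.norm_real, Real.norm_of_nonneg (by linarith)]
    have := h1 t fun z hz => h z (Multiset.mem_cons_of_mem hz) (by rintro rfl; exact ht hz)
    nlinarith
  · exact (h1 s fun z hz => h z hz (by rintro rfl; exact hmem hz)).trans hβ

variable {A : Type*} [Fintype A] [DecidableEq A] {ξ : A → List A}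

theorem norm_le_one_of_isCharRoot {β : ℝ} (hβ : IsPerronNumber ξ β) (hβ0 : 0 < β)
    (hu : ∃! z : ℂ, IsCharRoot ξ z ∧ 1 < ‖z‖) :
    1 < β ∧ ∀ z : ℂ, IsCharRoot ξ z → z ≠ β → ‖z‖ ≤ 1 := by
  have hnβ : ‖(β : ℂ)‖ = β := by rw [Complex.norm_real, Real.norm_of_nonneg hβ0.le]
  obtain ⟨z₀, ⟨h1, h2⟩, h3⟩ := hu
  have key : z₀ = β := by
    by_contra hne
    have h4 := hβ.2 z₀ h1 hne
    exact hne (h3 β ⟨hβ.1, by rw [hnβ]; linarith⟩).symm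
  subst key
  refine ⟨hnβ ▸ h2, fun z hz hne => ?_⟩
  by_contra! h
  exact hne (h3 z ⟨hz, h⟩)

/-- The transpose of the incidence matrix is invertible over `ℤ` on its eventual range. -/
theorem exists_pow_eq_pow_succ_mul [Nonempty A] (hξ : ∀ a, ξ a ≠ [])
    (hprim : (incidence ℝ ξ).IsPrimitive) {β : ℝ} (hβ : IsPerronNumber ξ β)
    (hu : ∃! z : ℂ, IsCharRoot ξ z ∧ 1 < ‖z‖)
    (hdet : β * |LinearMap.det ((transp ξ).restrict (transp_mem_stableSpace ξ))| = 1) :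
    ∃ (m : ℕ) (T : Matrix A A ℤ), Commute (incidence ℤ ξ)ᵀ T ∧
      (incidence ℤ ξ)ᵀ ^ m = (incidence ℤ ξ)ᵀ ^ (m + 1) * T := by
  have hβ0 : 0 < β := by
    by_contra! h
    have := mul_nonpos_of_nonpos_of_nonneg h
      (abs_nonneg (LinearMap.det ((transp ξ).restrict (transp_mem_stableSpace ξ))))
    linarith
  obtain ⟨hβ1, hle⟩ := norm_le_one_of_isCharRoot hβ hβ0 hu
  set p := (incidence ℤ ξ).charpoly with hp
  have hpm : p.Monic := Matrix.charpoly_monic _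
  -- Write p = Xᵐq with q(0) ≠ 0; the aim is q(0) = ±1.
  obtain ⟨q, hpq, hq⟩ := Polynomial.exists_eq_pow_rootMultiplicity_mul_and_not_dvd p hpm.ne_zero 0
  set m := p.rootMultiplicity 0 with hm
  rw [Polynomial.C_0, sub_zero] at hpq hq
  have hqm : q.Monic := (Polynomial.monic_X_pow m).of_mul_monic_left (hpq ▸ hpm)
  have hq0 : q.coeff 0 ≠ 0 := by rwa [Ne, ← Polynomial.X_dvd_iff]
  -- the complex roots
  set φ := Int.castRingHom ℂ with hφ
  set W := stableSpace ξ with hW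
  set P₁ := ((transp ξ).restrict (transp_mem_stableSpace ξ)).charpoly with hP₁
  set P₂ := (W.mapQ W (transp ξ) (transp_mem_stableSpace ξ)).charpoly with hP₂
  have hfac : (transp ξ).charpoly = P₁ * P₂ := charpoly_eq_restrict_mul_mapQ _ _ _
  have hm₁ : P₁.Monic := LinearMap.charpoly_monic _
  have hm₂ : P₂.Monic := LinearMap.charpoly_monic _
  have hpC : p.map φ = P₁.map (algebraMap ℝ ℂ) * P₂.map (algebraMap ℝ ℂ) := by
    rw [← Polynomial.map_mul, ← hfac, charpoly_transp, Polynomial.map_map]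
    congr 1
  have hpC' : p.map φ = (incidence ℂ ξ).charpoly := by
    rw [charpoly_incidence_complex, hfac, hpC, Polynomial.map_mul]
  have hroots : (p.map φ).roots =
      (P₁.map (algebraMap ℝ ℂ)).roots + (P₂.map (algebraMap ℝ ℂ)).roots := by
    rw [hpC, Polynomial.roots_mul ((hm₁.map _).mul (hm₂.map _)).ne_zero]
  have hroots' : (p.map φ).roots = m • {0} + (q.map φ).roots := by
    conv_lhs => rw [hpq]
    rw [Polynomial.map_mul, Polynomial.map_pow, Polynomial.map_X, Polynomial.roots_mul
      ((Polynomial.monic_X_pow m).mul (hqm.map _)).ne_zero, Polynomial.roots_X_pow]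
  have hroot : ∀ z ∈ (p.map φ).roots, IsCharRoot ξ z := by
    intro z hz
    rw [hpC'] at hz
    exact Polynomial.isRoot_of_mem_roots hz
  have hq0C : ∀ z ∈ (q.map φ).roots, z ≠ 0 := by
    rintro z hz rfl
    have := Polynomial.isRoot_of_mem_roots hz
    rw [Polynomial.IsRoot, ← Polynomial.coeff_zero_eq_eval_zero, Polynomial.coeff_map] at this
    exact hq0 (by simpa [hφ] using this)
  have hprod₁ : ((P₁.map (algebraMap ℝ ℂ)).roots.map norm).prod =
      |LinearMap.det ((transp ξ).restrict (transp_mem_stableSpace ξ))| := by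
    rw [← norm_coeff_zero_eq_prod (hm₁.map _), Polynomial.coeff_map,
      LinearMap.det_eq_sign_charpoly_coeff, abs_mul, abs_pow, abs_neg, abs_one, one_pow, one_mul]
    simp [hP₁]
  have hdet0 : 0 < |LinearMap.det ((transp ξ).restrict (transp_mem_stableSpace ξ))| :=
    pos_of_mul_pos_right (by rw [hdet]; exact one_pos) hβ0.le
  have h0₁ : ∀ z ∈ (P₁.map (algebraMap ℝ ℂ)).roots, z ≠ 0 := by
    rintro z hz rfl
    have : (0 : ℝ) ∈ (P₁.map (algebraMap ℝ ℂ)).roots.map norm :=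
      Multiset.mem_map.2 ⟨0, hz, norm_zero⟩
    rw [Multiset.prod_eq_zero this] at hprod₁
    exact hdet0.ne hprod₁
  -- The nonzero eigenvalues are those on Eˢ, whose moduli have product 1/β, and those on the
  -- quotient, where β occurs at most once and all the others have modulus at most 1.
  have hsplit : (q.map φ).roots = (P₁.map (algebraMap ℝ ℂ)).roots +
      (P₂.map (algebraMap ℝ ℂ)).roots.filter (· ≠ 0) := by
    have h1 := congrArg (Multiset.filter (· ≠ (0 : ℂ))) (hroots.symm.trans hroots')
    rw [Multiset.filter_add, Multiset.filter_add, Multiset.filter_eq_self.2 h0₁,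
      Multiset.filter_eq_self.2 hq0C] at h1
    rw [h1, Multiset.filter_eq_nil.2, zero_add]
    intro z hz
    have := Multiset.mem_of_mem_nsmul hz
    simpa using this
  have hprod₂ : (((P₂.map (algebraMap ℝ ℂ)).roots.filter (· ≠ 0)).map norm).prod ≤ β := by
    refine prod_norm_le hβ1.le ?_ ?_
    · calc _ ≤ (p.map φ).roots.count (β : ℂ) := by
            refine Multiset.count_le_of_le _ ((Multiset.filter_le _ _).trans ?_)
            rw [hroots]
            exact Multiset.le_add_left _ _
        _ ≤ 1 := by
            rw [Polynomial.count_roots, hpC']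
            exact rootMultiplicity_perron_le_one hξ hprim hβ hβ0
    · intro z hz hne
      refine hle z (hroot z ?_) hne
      rw [hroots]
      exact Multiset.mem_add.2 (Or.inr (Multiset.mem_of_mem_filter hz))
  have hq1 : ‖(q.map φ).coeff 0‖ ≤ 1 := by
    rw [norm_coeff_zero_eq_prod (hqm.map _), hsplit, Multiset.map_add, Multiset.prod_add, hprod₁,
      ← hdet, mul_comm β]
    exact mul_le_mul_of_nonneg_left hprod₂ (abs_nonneg _)
  have hunit : q.coeff 0 * q.coeff 0 = 1 := by
    rw [Polynomial.coeff_map, hφ, eq_intCast, Complex.norm_intCast] at hq1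
    have h1 : |q.coeff 0| ≤ 1 := by exact_mod_cast hq1
    have h2 := Int.one_le_abs hq0
    have h3 : |q.coeff 0| = 1 := le_antisymm h1 h2
    rw [← abs_mul_abs_self, h3, one_mul]
  set L := (incidence ℤ ξ)ᵀ with hL
  have hCH : L ^ m * Polynomial.aeval L q = 0 := by
    have := Matrix.aeval_self_charpoly L
    rwa [hL, charpoly_transpose, ← hp, hpq, map_mul, map_pow, Polynomial.aeval_X] at this
  refine ⟨m, -(q.coeff 0 • Polynomial.aeval L q.divX), ?_, ?_⟩
  · refine Commute.neg_right (Commute.smul_right ?_ _)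
    have := (Commute.all Polynomial.X q.divX).map (Polynomial.aeval L)
    rwa [Polynomial.aeval_X] at this
  -- By Cayley–Hamilton Lᵐq(L) = 0, and the constant term ±1 of q can be divided out over ℤ.
  · have h1 : Polynomial.aeval L q = L * Polynomial.aeval L q.divX + q.coeff 0 • 1 := by
      conv_lhs => rw [← Polynomial.X_mul_divX_add q]
      rw [map_add, map_mul, Polynomial.aeval_X, Polynomial.aeval_C, Algebra.algebraMap_eq_smul_one]
    rw [h1, mul_add, mul_smul_comm, mul_one, ← mul_assoc, ← pow_succ] at hCH
    rw [mul_neg, mul_smul_comm, eq_neg_of_add_eq_zero_left hCH, smul_neg, neg_neg, smul_smul, hunit,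
      one_smul]

theorem transp_intCast (ξ : A → List A) (k : ℕ) (w : A → ℤ) :
    (transp ξ ^ k) (fun a => (w a : ℝ)) = fun a => ((((incidence ℤ ξ)ᵀ ^ k) *ᵥ w) a : ℝ) := by
  induction k with
  | zero => simp
  | succ k ih =>
    rw [pow_succ', Module.End.mul_apply, ih, pow_succ', ← Matrix.mulVec_mulVec]
    funext a
    change ∑ b, ((ξ a).count b : ℝ) * ((((incidence ℤ ξ)ᵀ ^ k) *ᵥ w) b : ℝ) =
      ((∑ b, ((ξ a).count b : ℤ) * (((incidence ℤ ξ)ᵀ ^ k) *ᵥ w) b : ℤ) : ℝ)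
    push_cast
    rfl

end Unimodular


/-! ### Integer splittings and contracted vectors -/

section Contracting

set_option linter.unusedSectionVars false

variable {A : Type*} [Fintype A] [DecidableEq A] {ξ : A → List A}

theorem transp_pow_eq_mulVec (ξ : A → List A) (k : ℕ) (u : A → ℝ) :
    (transp ξ ^ k) u = ((incidence ℝ ξ)ᵀ ^ k) *ᵥ u := by
  funext a
  rw [transp_pow_apply, ← transpose_pow]
  simp only [Matrix.mulVec, dotProduct, transpose_apply, incidence_pow_apply]

theorem incidence_real (ξ : A → List A) :
    (incidence ℝ ξ)ᵀ = (Int.castRingHom ℝ).mapMatrix (incidence ℤ ξ)ᵀ := by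
  ext i j
  simp [incidence]

theorem pow_eq_pow_add_mul {R : Type*} [Monoid R] {L T : R} {m : ℕ}
    (h : L ^ m = L ^ (m + 1) * T) (k : ℕ) : L ^ m = L ^ (m + k) * T ^ k := by
  induction k with
  | zero => simp
  | succ k ih =>
    conv_lhs => rw [ih]
    rw [show m + (k + 1) = k + (m + 1) by ring, pow_add L k, pow_succ' T, mul_assoc,
      ← mul_assoc (L ^ (m + 1)), ← h, ← mul_assoc, ← pow_add, add_comm k]

/-- A contracted vector may have a part on which L is nilpotent, which `stableSpace` excludes;
applying Lᵐ removes it. -/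
theorem pow_transp_mem_range {m : ℕ} {T : Matrix A A ℤ}
    (hT : (incidence ℤ ξ)ᵀ ^ m = (incidence ℤ ξ)ᵀ ^ (m + 1) * T) (v : A → ℝ) (k : ℕ) :
    (transp ξ ^ m) v ∈ LinearMap.range (transp ξ ^ k) := by
  have h := congrArg (Int.castRingHom ℝ).mapMatrix (pow_eq_pow_add_mul hT k)
  rw [map_mul, map_pow, map_pow, map_pow, ← incidence_real] at h
  refine ⟨(transp ξ ^ m) (((Int.castRingHom ℝ).mapMatrix T ^ k) *ᵥ v), ?_⟩
  rw [← Module.End.mul_apply, ← pow_add, transp_pow_eq_mulVec, transp_pow_eq_mulVec, h,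
    Matrix.mulVec_mulVec, add_comm k]

/-- Let δₖ be the vector of rounding errors. Then Lδₖ − δₖ₊₁ is an integer vector that tends to 0,
so it vanishes from some K on, and δ_K is contracted by L. -/
theorem tendsto_sub_of_tendsto_round {α : ℝ}
    (hα : ∀ a, Tendsto (fun k => α * (iter ξ k a).length - round (α * (iter ξ k a).length)) atTop
      (𝓝 0)) :
    ∃ (K : ℕ) (v : A → ℝ) (w : A → ℤ), (∀ a, α * (iter ξ K a).length = v a + w a) ∧
      Tendsto (fun k : ℕ => (transp ξ ^ k) v) atTop (𝓝 0) := by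
  set ρ : ℕ → A → ℤ := fun k a => round (α * (iter ξ k a).length) with hρ
  set δ : ℕ → A → ℝ := fun k a => α * (iter ξ k a).length - ρ k a with hδ
  have hδ0 : Tendsto δ atTop (𝓝 0) := tendsto_pi_nhds.2 hα
  have hL : Continuous (transp ξ) := LinearMap.continuous_of_finiteDimensional _
  have hLδ : Tendsto (fun k => transp ξ (δ k) - δ (k + 1)) atTop (𝓝 0) := by
    have h1 : Tendsto (fun k => transp ξ (δ k)) atTop (𝓝 0) := by
      have := (hL.tendsto 0).comp hδ0
      rwa [map_zero] at this
    simpa using h1.sub (hδ0.comp (tendsto_add_atTop_nat 1))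
  have hsum : ∀ k, (fun a => α * ((iter ξ k a).length : ℝ)) = δ k + fun a => (ρ k a : ℝ) := by
    intro k
    funext a
    simp [hδ]
  have hstep : ∀ k, transp ξ (fun a => α * ((iter ξ k a).length : ℝ)) =
      fun a => α * ((iter ξ (k + 1) a).length : ℝ) := by
    intro k
    have e : ∀ k, (fun a => α * ((iter ξ k a).length : ℝ)) = α • (transp ξ ^ k) 1 := by
      intro k
      funext a
      simp [transp_pow_one]
    rw [e, e, map_smul, pow_succ', Module.End.mul_apply]
  have hint : ∀ k a, (transp ξ (δ k) - δ (k + 1)) a =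
      ((ρ (k + 1) a - ((incidence ℤ ξ)ᵀ *ᵥ ρ k) a : ℤ) : ℝ) := by
    intro k a
    have h1 := hstep k
    have h3 := transp_intCast ξ 1 (ρ k)
    rw [pow_one, pow_one] at h3
    rw [hsum k, hsum (k + 1), map_add, h3] at h1
    have h2 := congrFun h1 a
    simp only [Pi.add_apply] at h2
    rw [Pi.sub_apply]
    push_cast
    linarith
  have hev : ∀ᶠ k in atTop, transp ξ (δ k) = δ (k + 1) := by
    have h1 : ∀ a, ∀ᶠ k in atTop, (transp ξ (δ k) - δ (k + 1)) a = 0 := by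
      intro a
      have h2 := (tendsto_pi_nhds.1 hLδ a)
      have h3 := h2.abs.eventually_lt_const (u := 1) (by simp)
      filter_upwards [h3] with k hk
      rw [hint] at hk ⊢
      have : |ρ (k + 1) a - ((incidence ℤ ξ)ᵀ *ᵥ ρ k) a| < 1 := by exact_mod_cast hk
      rw [Int.abs_lt_one_iff] at this
      exact_mod_cast this
    filter_upwards [eventually_all.2 h1] with k hk
    exact sub_eq_zero.1 (funext hk)
  obtain ⟨K, hK⟩ := eventually_atTop.1 hev
  refine ⟨K, δ K, ρ K, fun a => congrFun (hsum K) a, ?_⟩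
  have : ∀ k, (transp ξ ^ k) (δ K) = δ (K + k) := by
    intro k
    induction k with
    | zero => simp
    | succ k ih => rw [pow_succ', Module.End.mul_apply, ih, hK _ (by omega)]; rfl
  simp_rw [this]
  have h2 := (tendsto_add_atTop_iff_nat K).2 hδ0
  refine h2.congr fun k => ?_
  rw [add_comm]

/-- The splitting Lᴷ(α,…,α) = v' + w' is divided by Lᴷ with the help of T: for w = Tᴷw' one finds
Lᵐ((α,…,α) − w) = TᴷLᵐv', which L contracts. The identity Lᵐ = Lᵐ⁺ᴷTᴷ holds only after
multiplication by Lᵐ, but m extra steps do not affect the limit. -/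
theorem exists_splitting {m : ℕ} {T : Matrix A A ℤ} (hc : Commute (incidence ℤ ξ)ᵀ T)
    (hT : (incidence ℤ ξ)ᵀ ^ m = (incidence ℤ ξ)ᵀ ^ (m + 1) * T) {α : ℝ}
    (hα : ∀ a, Tendsto (fun k => α * (iter ξ k a).length - round (α * (iter ξ k a).length)) atTop
      (𝓝 0)) :
    ∃ (v : A → ℝ) (w : A → ℤ), (∀ a, α = v a + w a) ∧
      Tendsto (fun k : ℕ => (transp ξ ^ k) v) atTop (𝓝 0) := by
  obtain ⟨K, v', w', hvw, hv'⟩ := tendsto_sub_of_tendsto_round hα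
  set R : Matrix A A ℤ →+* Matrix A A ℝ := (Int.castRingHom ℝ).mapMatrix with hR
  have h := congrArg R (pow_eq_pow_add_mul hT K)
  have hcR : Commute (incidence ℝ ξ)ᵀ (R T) := by
    rw [incidence_real]; exact hc.map R
  rw [map_mul, map_pow, map_pow, map_pow, ← incidence_real] at h
  set L := (incidence ℝ ξ)ᵀ with hL
  refine ⟨fun a => α - ((T ^ K) *ᵥ w') a, (T ^ K) *ᵥ w', fun a => by simp, ?_⟩
  have hw : (fun a => (((T ^ K) *ᵥ w') a : ℝ)) = (R T ^ K) *ᵥ fun a => (w' a : ℝ) := by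
    rw [← map_pow]
    funext a
    simp [hR, Matrix.mulVec, dotProduct]
  have h1 : (L ^ K) *ᵥ (fun _ : A => α) = v' + fun a => (w' a : ℝ) := by
    funext a
    rw [Pi.add_apply, ← hvw, ← transp_pow_eq_mulVec, transp_pow_apply, ← Finset.sum_mul,
      length_eq_sum_count]
    push_cast
    ring
  have hcL : ∀ i j, L ^ i * R T ^ j = R T ^ j * L ^ i := fun i j => (hcR.pow_pow i j).eq
  have key : (L ^ m) *ᵥ (fun a => α - (((T ^ K) *ᵥ w') a : ℝ)) = (R T ^ K * L ^ m) *ᵥ v' := by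
    have e : (fun a => α - (((T ^ K) *ᵥ w') a : ℝ)) =
        (fun _ => α) - (R T ^ K) *ᵥ fun a => (w' a : ℝ) := by
      rw [← hw]; rfl
    have e1 : (L ^ m) *ᵥ (fun _ : A => α) = (R T ^ K * L ^ m) *ᵥ (v' + fun a => (w' a : ℝ)) := by
      rw [← h1, Matrix.mulVec_mulVec, mul_assoc, ← pow_add, ← hcL, ← h]
    rw [e, Matrix.mulVec_sub, e1, Matrix.mulVec_add, Matrix.mulVec_mulVec, hcL]
    simp
  refine (tendsto_add_atTop_iff_nat m).1 ?_
  have h2 : ∀ k, (transp ξ ^ (k + m)) (fun a => α - (((T ^ K) *ᵥ w') a : ℝ)) =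
      (R T ^ K * L ^ m).mulVecLin ((transp ξ ^ k) v') := by
    intro k
    rw [transp_pow_eq_mulVec, transp_pow_eq_mulVec, pow_add, ← Matrix.mulVec_mulVec, key,
      Matrix.mulVecLin_apply, Matrix.mulVec_mulVec, Matrix.mulVec_mulVec, ← mul_assoc, hcL,
      mul_assoc, mul_assoc, ← pow_add, ← pow_add, add_comm]
  simp_rw [h2]
  have h3 : Continuous (R T ^ K * L ^ m).mulVecLin := LinearMap.continuous_of_finiteDimensional _
  have := (h3.tendsto 0).comp hv'
  rwa [map_zero] at this

/-- The rational independence of `1, α₁, …, αₙ` gives the real independence of the contracting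
parts of the vectors `αᵢ (1, …, 1)`. -/
theorem IsSplitting.linearIndependent [Nonempty A] (hξ : ∀ a, ξ a ≠ []) {n : ℕ} {α : Fin n → ℝ}
    {v : Fin n → A → ℝ} {w : Fin n → A → ℤ} (h : IsSplitting ξ α v w)
    (hα : LinearIndependent ℚ (Fin.cons 1 α : Fin (n + 1) → ℝ)) (m : ℕ) :
    LinearIndependent ℝ fun i => (transp ξ ^ m) (v i) := by
  set L := (incidence ℤ ξ)ᵀ with hL
  set W : Fin (n + 1) → A → ℤ :=
    Fin.cons ((L ^ m) *ᵥ (1 : A → ℤ)) fun i => (L ^ m) *ᵥ (w i) with hW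
  have hone : (fun a => (((1 : A → ℤ) a : ℤ) : ℝ)) = (1 : A → ℝ) := by funext a; simp
  have hW0 : (fun a => (W 0 a : ℝ)) = (transp ξ ^ m) 1 := by
    rw [← hone, transp_intCast]
    rfl
  have hWs : ∀ i : Fin n, (fun a => (W i.succ a : ℝ)) =
      α i • (transp ξ ^ m) 1 - (transp ξ ^ m) (v i) := by
    intro i
    have e : (fun a => (w i a : ℝ)) = α i • (1 : A → ℝ) - v i := by
      funext a
      simp [h.split i a]
    rw [← map_smul, ← map_sub, ← e, transp_intCast]
    rfl
  have hint : LinearIndependent ℤ W := by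
    rw [Fintype.linearIndependent_iff]
    intro g hg
    have hg' : (g 0 : ℝ) • (transp ξ ^ m) 1 + ∑ i : Fin n, (g i.succ : ℝ) •
        (α i • (transp ξ ^ m) 1 - (transp ξ ^ m) (v i)) = 0 := by
      simp_rw [← hWs]
      rw [← hW0]
      funext a
      have h1 := congrFun hg a
      rw [Fin.sum_univ_succ] at h1
      simp only [Pi.add_apply, Finset.sum_apply, Pi.smul_apply, smul_eq_mul, Pi.zero_apply] at h1 ⊢
      exact_mod_cast h1
    set s : ℝ := g 0 + ∑ i : Fin n, g i.succ * α i with hs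
    have hs1 : s • (transp ξ ^ m) 1 = ∑ i : Fin n, (g i.succ : ℝ) • (transp ξ ^ m) (v i) := by
      simp only [smul_sub, Finset.sum_sub_distrib, smul_smul] at hg'
      rw [← Finset.sum_smul, ← add_sub_assoc, ← add_smul, sub_eq_zero] at hg'
      exact hg'
    have hlim : Tendsto (fun k : ℕ => (transp ξ ^ k)
        (∑ i : Fin n, (g i.succ : ℝ) • (transp ξ ^ m) (v i))) atTop (𝓝 0) := by
      simp only [map_sum, map_smul]
      rw [show (0 : A → ℝ) = ∑ i : Fin n, (g i.succ : ℝ) • 0 by simp]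
      refine tendsto_finsetSum _ fun i _ => Tendsto.const_smul ?_ _
      simp only [← Module.End.mul_apply, ← pow_add]
      exact (tendsto_add_atTop_iff_nat m).2 (h.tendsto i)
    -- The right side of `hs1` is contracted, while the coordinates of Lᵏ(1,…,1) are lengths, at
    -- least 1.
    have hs0 : s = 0 := by
      by_contra hne
      rw [← hs1] at hlim
      obtain ⟨a⟩ := ‹Nonempty A›
      have h1 := (tendsto_pi_nhds.1 hlim a).abs
      have h2 := h1.eventually_lt_const (u := |s|) (by simpa using hne)
      obtain ⟨k, hk⟩ := h2.exists
      rw [map_smul, ← Module.End.mul_apply, ← pow_add, Pi.smul_apply, transp_pow_one, smul_eq_mul,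
        abs_mul, Nat.abs_cast] at hk
      have h3 : (1 : ℝ) ≤ (iter ξ (k + m) a).length := by
        exact_mod_cast length_iter_pos hξ (k + m) a
      have := abs_pos.2 hne
      nlinarith
    rw [Fintype.linearIndependent_iff] at hα
    have h0 := hα (fun i => (g i : ℚ)) (by
      rw [Fin.sum_univ_succ]
      simp only [Fin.cons_zero, Fin.cons_succ, Rat.smul_def, mul_one, Rat.cast_intCast]
      exact hs0)
    intro i
    exact_mod_cast h0 i
  -- Integer vectors independent over ℤ remain independent over ℝ. A real relation between the
  -- vectors Lᵐv(i) is one between the integer vectors Lᵐ(1,…,1) and Lᵐw(i).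
  rw [← linearIndependent_algebraMap_comp_iff (S := ℝ), Fintype.linearIndependent_iff] at hint
  rw [Fintype.linearIndependent_iff]
  intro c hc i
  have h0 := hint (Fin.cons (∑ i, c i * α i) fun i => -c i) (by
    rw [Fin.sum_univ_succ]
    simp only [Fin.cons_zero, Fin.cons_succ]
    have e : ∀ i, (algebraMap ℤ ℝ) ∘ W i = fun a => (W i a : ℝ) := fun i => rfl
    simp only [e, hW0, hWs, smul_sub, Finset.sum_sub_distrib, neg_smul, Finset.sum_neg_distrib, hc,
      smul_smul, Finset.sum_smul]
    simp) i.succ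
  simpa using h0

theorem summable_of_pow {g : ℕ → ℝ} (h0 : ∀ k, 0 ≤ g k) {K : ℕ} (hK : 0 < K)
    (h : ∀ q s : ℕ, g (K * q + s) ≤ (1 / 2) ^ q * g s) : Summable g := by
  have : NeZero K := ⟨hK.ne'⟩
  rw [← (Nat.divModEquiv K).symm.summable_iff]
  have hg : Summable fun q : ℕ × Fin K => (1 / 2 : ℝ) ^ q.1 * g q.2 :=
    Summable.mul_of_nonneg (summable_geometric_two) (Summable.of_finite
      (f := fun s : Fin K => g s)) (fun _ => by positivity) (fun _ => h0 _)
  refine Summable.of_nonneg_of_le (fun _ => h0 _) (fun q => ?_) hg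
  have e : (Nat.divModEquiv K).symm q = K * q.1 + q.2 := by
    simp [Nat.divModEquiv, mul_comm]
  simp only [Function.comp, e]
  exact h _ _

/-- In finite dimension, convergence on a basis makes the norm of some power f^K at most 1/2; decay
is then geometric along each class modulo K. -/
theorem summable_norm_pow_apply {V : Type*} [NormedAddCommGroup V] [NormedSpace ℝ V]
    [FiniteDimensional ℝ V] (f : V →L[ℝ] V)
    (hf : ∀ u, Tendsto (fun k : ℕ => (f ^ k) u) atTop (𝓝 0)) (v : V) :
    Summable fun k : ℕ => ‖(f ^ k) v‖ := by
  obtain ⟨C, hC0, hC⟩ := (Module.finBasis ℝ V).exists_opNorm_le (F := V)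
  have hlim : ∀ i, ∀ᶠ k : ℕ in atTop, ‖(f ^ k) (Module.finBasis ℝ V i)‖ ≤ 1 / (2 * C) := fun i =>
    (tendsto_zero_iff_norm_tendsto_zero.1 (hf (Module.finBasis ℝ V i))).eventually_le_const
      (by positivity)
  obtain ⟨K, hK, hK0⟩ := ((eventually_all.2 hlim).and (eventually_gt_atTop 0)).exists
  have hfK : ‖f ^ K‖ ≤ 1 / 2 := by
    refine (hC (by positivity) hK).trans (le_of_eq ?_)
    field_simp
  refine summable_of_pow (fun _ => norm_nonneg _) hK0 fun q s => ?_
  have e : (f ^ (K * q + s)) v = ((f ^ K) ^ q) ((f ^ s) v) := by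
    rw [pow_add, pow_mul]; rfl
  have e2 : ‖(f ^ K) ^ q‖ ≤ (1 / 2) ^ q := by
    rcases Nat.eq_zero_or_pos q with rfl | hq
    · rw [pow_zero, pow_zero]
      exact ContinuousLinearMap.norm_id_le
    · exact (norm_pow_le' _ hq).trans (pow_le_pow_left₀ (norm_nonneg _) hfK q)
  rw [e]
  exact (ContinuousLinearMap.le_opNorm _ _).trans
    (mul_le_mul_of_nonneg_right e2 (norm_nonneg _))

/-- The vectors that are contracted by the transpose of the incidence matrix. -/
def contracted (ξ : A → List A) : Submodule ℝ (A → ℝ) where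
  carrier := {v | Tendsto (fun k : ℕ => (transp ξ ^ k) v) atTop (𝓝 0)}
  add_mem' := fun {u v} hu hv => by
    have := Tendsto.add hu hv
    simpa using this
  zero_mem' := by simp
  smul_mem' := fun c v hv => by
    have := Tendsto.const_smul hv c
    simpa using this

theorem transp_mem_contracted (ξ : A → List A) : ∀ u ∈ contracted ξ, transp ξ u ∈ contracted ξ := by
  intro u hu
  refine ((tendsto_add_atTop_iff_nat 1).2 hu).congr fun k => ?_
  rw [pow_succ]
  rfl

theorem summable_norm_transp_pow {v : A → ℝ}
    (hv : Tendsto (fun k : ℕ => (transp ξ ^ k) v) atTop (𝓝 0)) :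
    Summable fun k : ℕ => ‖(transp ξ ^ k) v‖ := by
  let f : contracted ξ →L[ℝ] contracted ξ :=
    LinearMap.toContinuousLinearMap ((transp ξ).restrict (transp_mem_contracted ξ))
  have hf : ∀ (k : ℕ) (u : contracted ξ), (((f ^ k) u : contracted ξ) : A → ℝ) =
      (transp ξ ^ k) u := by
    intro k
    induction k with
    | zero => intro u; rfl
    | succ k ih =>
      intro u
      rw [pow_succ', pow_succ', Module.End.mul_apply, ← ih]
      rfl
  have h := summable_norm_pow_apply f (fun u => by
    rw [tendsto_subtype_rng]
    simp only [hf]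
    exact u.2) ⟨v, hv⟩
  refine h.congr fun k => ?_
  rw [← Submodule.norm_coe, hf]

end Contracting


/-! ### Rotations of the torus and Haar measure -/

section Torus

/-- The Haar probability measure of the torus. -/
noncomputable def torusMeasure (n : ℕ) : Measure (Fin n → UnitAddCircle) :=
  Measure.pi fun _ => AddCircle.haarAddCircle

instance (n : ℕ) : IsProbabilityMeasure (torusMeasure n) := by
  unfold torusMeasure
  infer_instance

instance (n : ℕ) : (torusMeasure n).IsAddLeftInvariant := by
  unfold torusMeasure
  infer_instance

variable {n : ℕ}

theorem mFourier_add_apply (k : Fin n → ℤ) (x y : Fin n → UnitAddCircle) :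
    UnitAddTorus.mFourier k (x + y) = UnitAddTorus.mFourier k x * UnitAddTorus.mFourier k y := by
  simp only [UnitAddTorus.mFourier, ContinuousMap.coe_mk, Pi.add_apply, ← Finset.prod_mul_distrib]
  refine Finset.prod_congr rfl fun i _ => ?_
  simp only [fourier_apply, smul_add, AddCircle.toCircle_add, Circle.coe_mul]

/-- The rotation multiplies the character, and so its integral, by a number other than 1. -/
theorem integral_mFourier_eq_zero {ν : Measure (Fin n → UnitAddCircle)} {a : Fin n → UnitAddCircle}
    (hν : MeasurePreserving (fun x => x + a) ν ν) {k : Fin n → ℤ}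
    (hk : UnitAddTorus.mFourier k a ≠ 1) : ∫ x, UnitAddTorus.mFourier k x ∂ν = 0 := by
  have h1 : ∫ x, UnitAddTorus.mFourier k (x + a) ∂ν = ∫ x, UnitAddTorus.mFourier k x ∂ν :=
    hν.integral_comp (MeasurableEquiv.addRight a).measurableEmbedding
      (fun x => UnitAddTorus.mFourier k x)
  simp only [mFourier_add_apply] at h1
  rw [integral_mul_const] at h1
  have h2 : (∫ x, UnitAddTorus.mFourier k x ∂ν) * (UnitAddTorus.mFourier k a - 1) = 0 := by
    rw [mul_sub, h1]; ring
  exact (mul_eq_zero.1 h2).resolve_right (sub_ne_zero.2 hk)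

/-- Unique ergodicity of the minimal rotations of the torus. -/
theorem eq_torusMeasure {ν : Measure (Fin n → UnitAddCircle)} [IsProbabilityMeasure ν]
    {a : Fin n → UnitAddCircle} (hν : MeasurePreserving (fun x => x + a) ν ν)
    (ha : ∀ k : Fin n → ℤ, k ≠ 0 → UnitAddTorus.mFourier k a ≠ 1) : ν = torusMeasure n := by
  have hinv : MeasurePreserving (fun x => x + a) (torusMeasure n) (torusMeasure n) :=
    measurePreserving_add_right _ a
  have h1 : ∀ k : Fin n → ℤ, ∫ x, UnitAddTorus.mFourier k x ∂ν =
      ∫ x, UnitAddTorus.mFourier k x ∂(torusMeasure n) := by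
    intro k
    by_cases hk : k = 0
    · subst hk
      simp [UnitAddTorus.mFourier_zero]
    · rw [integral_mFourier_eq_zero hν (ha k hk), integral_mFourier_eq_zero hinv (ha k hk)]
  have hint : ∀ (ρ : Measure (Fin n → UnitAddCircle)) [IsProbabilityMeasure ρ]
      (f : C(UnitAddTorus (Fin n), ℂ)), Integrable (fun x => f x) ρ := fun ρ _ f =>
    (BoundedContinuousFunction.mkOfCompact f).integrable ρ
  have hcont : ∀ (ρ : Measure (Fin n → UnitAddCircle)) [IsProbabilityMeasure ρ],
      Continuous fun f : C(UnitAddTorus (Fin n), ℂ) => ∫ x, f x ∂ρ := by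
    intro ρ _
    have hL : LipschitzWith 1 fun f : C(UnitAddTorus (Fin n), ℂ) => ∫ x, f x ∂ρ := by
      refine LipschitzWith.of_dist_le_mul fun f g => ?_
      rw [dist_eq_norm, ← integral_sub (hint ρ f) (hint ρ g), NNReal.coe_one, one_mul]
      refine (norm_integral_le_of_norm_le_const (C := dist f g) (ae_of_all _ fun x => ?_)).trans ?_
      · rw [← dist_eq_norm]
        exact ContinuousMap.dist_apply_le_dist x
      · simp
    exact hL.continuous
  have h2 : ∀ f : C(UnitAddTorus (Fin n), ℂ), ∫ x, f x ∂ν = ∫ x, f x ∂(torusMeasure n) := by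
    intro f
    -- Both measures have the same integrals on characters, hence on their span, which is dense in
    -- the continuous functions.
    have hcl : IsClosed {f : C(UnitAddTorus (Fin n), ℂ) |
        ∫ x, f x ∂ν = ∫ x, f x ∂(torusMeasure n)} := isClosed_eq (hcont _) (hcont _)
    have hsub : ((Submodule.span ℂ (Set.range <| UnitAddTorus.mFourier (d := Fin n)) :
        Submodule ℂ C(UnitAddTorus (Fin n), ℂ)) : Set C(UnitAddTorus (Fin n), ℂ)) ⊆
        {f : C(UnitAddTorus (Fin n), ℂ) | ∫ x, f x ∂ν = ∫ x, f x ∂(torusMeasure n)} := by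
      intro f hf
      induction hf using Submodule.span_induction with
      | mem f hf => obtain ⟨k, rfl⟩ := hf; exact h1 k
      | zero => simp
      | add f g _ _ hf hg =>
        simp only [Set.mem_ofPred_eq, ContinuousMap.add_apply] at hf hg ⊢
        rw [integral_add (hint ν f) (hint ν g), integral_add (hint _ f) (hint _ g), hf, hg]
      | smul c f _ hf =>
        simp only [Set.mem_ofPred_eq, ContinuousMap.smul_apply] at hf ⊢
        rw [integral_smul, integral_smul, hf]
    have := hcl.closure_subset_iff.2 hsub
    rw [← Submodule.topologicalClosure_coe, UnitAddTorus.span_mFourier_closure_eq_top] at this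
    exact this (Submodule.mem_top)
  refine ext_of_forall_integral_eq_of_IsFiniteMeasure fun f => ?_
  let g : C(UnitAddTorus (Fin n), ℂ) := ⟨fun x => (f x : ℂ), by
    exact Complex.continuous_ofReal.comp f.continuous⟩
  have h3 := h2 g
  have h4 : ∀ ρ : Measure (Fin n → UnitAddCircle), ∫ x, g x ∂ρ = ((∫ x, f x ∂ρ : ℝ) : ℂ) :=
    fun ρ => integral_ofReal
  rw [h4, h4] at h3
  exact_mod_cast h3

/-- Ergodicity of the minimal rotations of the torus. -/
theorem measure_eq_zero_or_one {a : Fin n → UnitAddCircle}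
    (ha : ∀ k : Fin n → ℤ, k ≠ 0 → UnitAddTorus.mFourier k a ≠ 1)
    {E : Set (Fin n → UnitAddCircle)} (hE : MeasurableSet E)
    (hEa : (fun x => x + a) ⁻¹' E = E) : torusMeasure n E = 0 ∨ torusMeasure n E = 1 := by
  by_cases h0 : torusMeasure n E = 0
  · exact Or.inl h0
  right
  have hinv : MeasurePreserving (fun x => x + a) (torusMeasure n) (torusMeasure n) :=
    measurePreserving_add_right _ a
  -- Conditioning on an invariant set gives an invariant measure, which unique ergodicity identifies
  -- with Haar measure.
  set ν := ProbabilityTheory.cond (torusMeasure n) E with hν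
  have : IsProbabilityMeasure ν := ProbabilityTheory.cond_isProbabilityMeasure h0
  have hν' : MeasurePreserving (fun x => x + a) ν ν := by
    have h1 := hinv.restrict_preimage hE
    rw [hEa] at h1
    rw [hν, ProbabilityTheory.cond]
    exact h1.smul_measure _
  have h2 := eq_torusMeasure hν' ha
  rw [← h2, hν, ProbabilityTheory.cond_apply hE, Set.inter_self,
    ENNReal.inv_mul_cancel h0 (measure_ne_top _ _)]

/-- A measurable function with values in `ℕ∞`, invariant under a minimal rotation and almost
everywhere finite, is almost everywhere constant. -/
theorem exists_ae_eq_natCast {a : Fin n → UnitAddCircle}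
    (ha : ∀ k : Fin n → ℤ, k ≠ 0 → UnitAddTorus.mFourier k a ≠ 1)
    {N : (Fin n → UnitAddCircle) → ℕ∞} (hN : ∀ c : ℕ, MeasurableSet {t | N t = c})
    (hinv : ∀ t, N (t + a) = N t) (hfin : ∀ᵐ t ∂torusMeasure n, N t ≠ ⊤) :
    ∃ c : ℕ, ∀ᵐ t ∂torusMeasure n, N t = c := by
  by_contra! hcon
  have h1 : ∀ c : ℕ, torusMeasure n {t | N t = c} = 0 := by
    intro c
    refine (measure_eq_zero_or_one ha (hN c) ?_).resolve_right fun h => hcon c ?_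
    · ext t
      simp [hinv]
    · have := (prob_compl_eq_zero_iff (hN c)).2 h
      rw [ae_iff]
      simpa [Set.compl_ofPred] using this
  have h2 : ∀ᵐ t ∂torusMeasure n, ∀ c : ℕ, N t ≠ c := by
    rw [ae_all_iff]
    intro c
    rw [ae_iff]
    simpa using h1 c
  obtain ⟨t, h3, h4⟩ := (h2.and hfin).exists
  obtain ⟨c, hc⟩ := ENat.ne_top_iff_exists.1 h4
  exact h3 c hc.symm

theorem continuous_toTorus : Continuous (toTorus : (Fin n → ℝ) → Fin n → UnitAddCircle) :=
  continuous_pi fun i => (AddCircle.continuous_mk' 1).comp (continuous_apply i)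

/-- Cut the set by the integer translates of a unit cube and move the parts into one cube. They may
overlap there, hence only an inequality. -/
theorem torusMeasure_image_toTorus_le (E : Set (Fin n → ℝ)) :
    torusMeasure n (toTorus '' E) ≤ volume E := by
  set e := UnitAddTorus.measurableEquivPiIoc (fun _ : Fin n => (0 : ℝ)) with he
  have hmp : MeasurePreserving e (torusMeasure n) (Measure.comap Subtype.val volume) :=
    UnitAddTorus.measurePreserving_equivPiIoc fun _ : Fin n => (0 : ℝ)
  set D : Set (Fin n → ℝ) := {x | ∀ i, x i ∈ Set.Ioc (0 : ℝ) (0 + 1)} with hD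
  have hDm : MeasurableSet D := MeasurableSet.univ_pi' fun i => measurableSet_Ioc
  have h1 : torusMeasure n (toTorus '' E) =
      volume (Subtype.val '' (e.symm ⁻¹' (toTorus '' E)) : Set (Fin n → ℝ)) := by
    have h2 : (Measure.comap Subtype.val volume) (e.symm ⁻¹' (toTorus '' E)) =
        volume (Subtype.val '' (e.symm ⁻¹' (toTorus '' E)) : Set (Fin n → ℝ)) :=
      (MeasurableEmbedding.subtype_coe hDm).comap_apply _ _
    rw [← h2, hmp.symm.measure_preimage_equiv]
  rw [h1]
  set Dz : (Fin n → ℤ) → Set (Fin n → ℝ) := fun z => (fun x => (fun i => (z i : ℝ)) + x) ⁻¹' D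
    with hDz
  have hsub : (Subtype.val '' (e.symm ⁻¹' (toTorus '' E)) : Set (Fin n → ℝ)) ⊆
      ⋃ z : Fin n → ℤ, (fun x => (fun i => -(z i : ℝ)) + x) ⁻¹' (E ∩ Dz z) := by
    rintro _ ⟨⟨x, hx⟩, ⟨y, hy, hyx⟩, rfl⟩
    have h2 : ∀ i, ∃ z : ℤ, x i = y i + z := by
      intro i
      have h3 : (y i : UnitAddCircle) = (x i : UnitAddCircle) := congrFun hyx i
      rw [eq_comm, ← sub_eq_zero, ← AddCircle.coe_sub, AddCircle.coe_eq_zero_iff] at h3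
      obtain ⟨z, hz⟩ := h3
      refine ⟨z, ?_⟩
      rw [zsmul_eq_mul, mul_one] at hz
      linarith
    choose z hz using h2
    refine Set.mem_iUnion.2 ⟨z, ?_⟩
    have h3 : (fun i => -(z i : ℝ)) + x = y := by
      funext i
      simp [hz]
    have h4 : (fun i => (z i : ℝ)) + y = x := by
      funext i
      simp [hz, add_comm]
    refine ⟨?_, ?_⟩
    · change (fun i => -(z i : ℝ)) + x ∈ E
      rwa [h3]
    · change (fun i => (z i : ℝ)) + ((fun i => -(z i : ℝ)) + x) ∈ D
      rw [h3, h4]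
      exact hx
  have hdisj : Pairwise fun z z' => Disjoint (Dz z) (Dz z') := by
    intro z z' hzz
    rw [Set.disjoint_left]
    intro x hx hx'
    apply hzz
    funext i
    have a1 := hx i
    have a2 := hx' i
    simp only [Pi.add_apply, Set.mem_Ioc, zero_add] at a1 a2
    have b1 : z i < z' i + 1 := by
      have : (z i : ℝ) < z' i + 1 := by linarith
      exact_mod_cast this
    have b2 : z' i < z i + 1 := by
      have : (z' i : ℝ) < z i + 1 := by linarith
      exact_mod_cast this
    omega
  have hDzm : ∀ z, MeasurableSet (Dz z) := fun z => (measurable_const_add _) hDm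
  calc _ ≤ ∑' z : Fin n → ℤ, volume ((fun x => (fun i => -(z i : ℝ)) + x) ⁻¹' (E ∩ Dz z)) :=
        (measure_mono hsub).trans (measure_iUnion_le _)
    _ = ∑' z : Fin n → ℤ, (volume.restrict E) (Dz z) := by
        refine tsum_congr fun z => ?_
        rw [measure_preimage_add, Measure.restrict_apply (hDzm z), Set.inter_comm]
    _ = (volume.restrict E) (⋃ z, Dz z) := (measure_iUnion hdisj hDzm).symm
    _ ≤ (volume.restrict E) Set.univ := measure_mono (Set.subset_univ _)
    _ = volume E := by rw [Measure.restrict_apply_univ]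

end Torus


/-! ### Clopen pieces and continuity of `mapF` -/

section TopologyOmega

set_option linter.unusedSectionVars false

variable {A : Type*} [Fintype A] [DecidableEq A] [TopologicalSpace A] [DiscreteTopology A]
  {ξ : A → List A}

theorem eventually_agree (x : ℤ → A) (R : ℕ) : ∀ᶠ y in 𝓝 x, ∀ j : ℤ, |j| ≤ R → y j = x j := by
  have h1 : ∀ᶠ y in 𝓝 x, ∀ j ∈ Finset.Icc (-(R : ℤ)) R, y j = x j := by
    rw [Filter.eventually_all_finset]
    intro j _
    have := (continuous_apply j).tendsto x (mem_nhds_discrete.2 (Set.mem_singleton (x j)))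
    exact this
  filter_upwards [h1] with y hy j hj
  rw [abs_le] at hj
  exact hy j (Finset.mem_Icc.2 hj)

theorem exists_agree_subset {x : ℤ → A} {U : Set (ℤ → A)} (hU : U ∈ 𝓝 x) :
    ∃ R : ℕ, ∀ y : ℤ → A, (∀ j : ℤ, |j| ≤ R → y j = x j) → y ∈ U := by
  rw [nhds_pi, Filter.mem_pi] at hU
  obtain ⟨I, hI, t, ht, hsub⟩ := hU
  obtain ⟨R, hR⟩ := (hI.image fun j : ℤ => j.natAbs).bddAbove
  refine ⟨R, fun y hy => hsub fun j hj => ?_⟩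
  have : j.natAbs ≤ R := hR ⟨j, hj, rfl⟩
  rw [hy j (by rw [Int.abs_eq_natAbs]; exact_mod_cast this)]
  exact mem_of_mem_nhds (ht j)

theorem continuous_of_agree {B : Type*} [TopologicalSpace B] {f : (ℤ → A) → B} (R : ℕ)
    (h : ∀ y y' : ℤ → A, (∀ j : ℤ, |j| ≤ R → y j = y' j) → f y = f y') : Continuous f := by
  rw [continuous_iff_continuousAt]
  intro x
  refine ContinuousAt.congr (f := fun _ => f x) continuousAt_const ?_
  filter_upwards [eventually_agree x R] with y hy
  exact (h y x hy).symm

theorem continuous_conc [Nonempty A] {σ : A → List A} (hσ : ∀ a, σ a ≠ []) :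
    Continuous (conc σ) := by
  refine continuous_pi fun n => continuous_of_agree n.natAbs fun y y' h => ?_
  exact conc_eq_of_agree hσ fun i hi => h i (by rwa [Int.abs_eq_natAbs n] at hi)

theorem continuous_shiftBy (i : ℤ) : Continuous fun (x : ℤ → A) (n : ℤ) => x (n + i) :=
  continuous_pi fun n => continuous_apply (n + i)

theorem continuous_shiftOmega : Continuous (shiftOmega ξ) :=
  ((continuous_shiftBy 1).comp continuous_subtype_val).subtype_mk _

theorem coe_iterate_shiftOmega (j : ℕ) (x : Omega ξ) :
    (((shiftOmega ξ)^[j] x : Omega ξ) : ℤ → A) = shift^[j] x := by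
  induction j with
  | zero => rfl
  | succ j ih =>
    rw [Function.iterate_succ_apply', Function.iterate_succ_apply', ← ih]
    rfl

theorem isClosed_Omega (ξ : A → List A) : IsClosed (Omega ξ) := by
  have : Omega ξ = ⋂ (i : ℤ) (n : ℕ), {x | window x i n ∈ language ξ} := by
    ext x
    simp [mem_Omega_iff]
  rw [this]
  refine isClosed_iInter fun i => isClosed_iInter fun n => ?_
  rw [← isOpen_compl_iff]
  refine isOpen_iff_mem_nhds.2 fun x hx => ?_
  filter_upwards [eventually_agree x (i.natAbs + n)] with y hy
  have : window y i n = window x i n := by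
    simp only [window]
    congr 1
    funext j
    refine hy _ ?_
    have := j.2
    rw [Int.abs_eq_natAbs]
    omega
  change window y i n ∉ language ξ
  rw [this]
  exact hx

instance : CompactSpace (Omega ξ) := isCompact_iff_compactSpace.1 (isClosed_Omega ξ).isCompact

/-- The set `Sⁱξᵏ([a])`. -/
def piece [Nonempty A] (ξ : A → List A) (k : ℕ) (a : A) (i : ℕ) : Set (Omega ξ) :=
  {x | ∃ y ∈ Omega ξ, y 0 = a ∧ x.1 = fun n => conc (iter ξ k) y (n + i)}

variable [Nonempty A]

theorem isClosed_piece (hξ : ∀ a, ξ a ≠ []) (k : ℕ) (a : A) (i : ℕ) :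
    IsClosed (piece ξ k a i) := by
  have h1 : IsClosed {y : ℤ → A | y ∈ Omega ξ ∧ y 0 = a} :=
    (isClosed_Omega ξ).inter
      (isClosed_eq (continuous_apply (A := fun _ : ℤ => A) (0 : ℤ)) continuous_const)
  have h2 : IsClosed ((fun (y : ℤ → A) (n : ℤ) => conc (iter ξ k) y (n + i)) ''
      {y : ℤ → A | y ∈ Omega ξ ∧ y 0 = a}) :=
    (h1.isCompact.image ((continuous_shiftBy i).comp
      (continuous_conc (iter_ne_nil hξ k)))).isClosed
  convert h2.preimage continuous_subtype_val using 1
  ext x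
  constructor
  · rintro ⟨y, h1, h2, h3⟩
    exact ⟨y, ⟨h1, h2⟩, h3.symm⟩
  · rintro ⟨y, ⟨h1, h2⟩, h3⟩
    exact ⟨y, h1, h2, h3.symm⟩

theorem exists_mem_piece (hξ : ∀ a, ξ a ≠ []) (k : ℕ) (x : Omega ξ) :
    ∃ a, ∃ i < (iter ξ k a).length, x ∈ piece ξ k a i := by
  obtain ⟨y, hy, i, hi, h⟩ := exists_desubstitution hξ k x.2
  exact ⟨y 0, i, hi, y, hy, rfl, h⟩

theorem IsAperiodicPrimitive.piece_unique (h : IsAperiodicPrimitive ξ) {k : ℕ} {a b : A} {i j : ℕ}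
    {x : Omega ξ} (hi : i < (iter ξ k a).length) (hj : j < (iter ξ k b).length)
    (hx : x ∈ piece ξ k a i) (hx' : x ∈ piece ξ k b j) : a = b ∧ i = j := by
  obtain ⟨y, hy, rfl, e⟩ := hx
  obtain ⟨z, hz, rfl, e'⟩ := hx'
  obtain ⟨rfl, rfl⟩ := recognizable h.ne_nil h.primitive h.aperiodic k hy hz hi hj (e.symm.trans e')
  exact ⟨rfl, rfl⟩

/-- The pieces of one level are finitely many closed sets that partition Ω, so each is the
complement of a closed set. -/
theorem IsAperiodicPrimitive.isClopen_piece (h : IsAperiodicPrimitive ξ) {k : ℕ} {a : A} {i : ℕ}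
    (hi : i < (iter ξ k a).length) : IsClopen (piece ξ k a i) := by
  refine ⟨isClosed_piece h.ne_nil k a i, ?_⟩
  have : piece ξ k a i = (⋃ q ∈ {q : Σ b : A, Fin (iter ξ k b).length | q ≠ ⟨a, ⟨i, hi⟩⟩},
      piece ξ k q.1 q.2)ᶜ := by
    ext x
    simp only [Set.mem_compl_iff, Set.mem_iUnion, not_exists]
    constructor
    · rintro hx ⟨b, j⟩ hq hx'
      obtain ⟨rfl, rfl⟩ := h.piece_unique hi j.2 hx hx'
      exact hq rfl
    · intro hx
      obtain ⟨b, j, hj, hx'⟩ := exists_mem_piece h.ne_nil k x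
      by_cases hq : (⟨b, ⟨j, hj⟩⟩ : Σ b : A, Fin (iter ξ k b).length) = ⟨a, ⟨i, hi⟩⟩
      · have h1 : b = a := congrArg Sigma.fst hq
        subst h1
        simp only [Sigma.mk.injEq, heq_eq_eq, Fin.mk.injEq, true_and] at hq
        subst hq
        exact hx'
      · exact absurd hx' (hx ⟨b, ⟨j, hj⟩⟩ hq)
  rw [this, isOpen_compl_iff]
  exact (Set.toFinite _).isClosed_biUnion fun q _ => isClosed_piece h.ne_nil k q.1 q.2

theorem shiftOmega_preimage_piece (k : ℕ) (a : A) (i : ℕ) :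
    shiftOmega ξ ⁻¹' piece ξ k a (i + 1) = piece ξ k a i := by
  ext x
  constructor
  · rintro ⟨y, hy, ha, h⟩
    refine ⟨y, hy, ha, ?_⟩
    funext n
    have := congrFun h (n - 1)
    simp only [shiftOmega, shift, sub_add_cancel] at this
    rw [this]
    congr 1
    push_cast
    ring
  · rintro ⟨y, hy, ha, h⟩
    refine ⟨y, hy, ha, ?_⟩
    funext n
    simp only [shiftOmega, shift, h]
    congr 1
    push_cast
    ring

theorem mem_piece_zero_iff (hξ : ∀ a, ξ a ≠ []) {k : ℕ} {a : A} {x : Omega ξ} :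
    x ∈ piece ξ k a 0 ↔ x.1 ∈ base ξ k a := by
  rw [mem_base_iff hξ]
  simp [piece]

theorem eventually_mem_iff {X : Type*} [TopologicalSpace X] {D : Set X} (hD : IsClopen D) (x : X) :
    ∀ᶠ y in 𝓝 x, (y ∈ D ↔ x ∈ D) := by
  by_cases h : x ∈ D
  · filter_upwards [hD.2.mem_nhds h] with y hy
    simp [h, hy]
  · filter_upwards [hD.compl.2.mem_nhds h] with y hy
    have : y ∉ D := hy
    simp [h, this]

theorem IsAperiodicPrimitive.eventually_shift_mem_base (h : IsAperiodicPrimitive ξ) (k j : ℕ)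
    (a : A) (x : Omega ξ) :
    ∀ᶠ y : Omega ξ in 𝓝 x, (shift^[j] y.1 ∈ base ξ k a ↔ shift^[j] x.1 ∈ base ξ k a) := by
  have h1 := (h.isClopen_piece (length_iter_pos h.ne_nil k a)).preimage
    (continuous_shiftOmega.iterate j)
  filter_upwards [eventually_mem_iff h1 x] with y hy
  simpa only [Set.mem_preimage, mem_piece_zero_iff h.ne_nil, coe_iterate_shiftOmega] using hy

theorem IsAperiodicPrimitive.eventually_entranceTime (h : IsAperiodicPrimitive ξ) (k : ℕ)
    (x : Omega ξ) : ∀ᶠ y : Omega ξ in 𝓝 x, entranceTime ξ k y.1 = entranceTime ξ k x.1 := by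
  have himg : ∀ (j : ℕ) (y : Omega ξ), shift^[j] y.1 ∈ (onSeq ξ)^[k] '' Omega ξ ↔
      ∃ a, shift^[j] y.1 ∈ base ξ k a := by
    intro j y
    simp only [mem_image_onSeq_iff h.ne_nil, mem_base_iff h.ne_nil]
    exact ⟨fun ⟨z, hz, e⟩ => ⟨_, z, hz, rfl, e⟩, fun ⟨_, z, hz, _, e⟩ => ⟨z, hz, e⟩⟩
  have h1 : ∀ᶠ y : Omega ξ in 𝓝 x, ∀ j ∈ Finset.range (entranceTime ξ k x.1 + 1), ∀ a,
      (shift^[j] y.1 ∈ base ξ k a ↔ shift^[j] x.1 ∈ base ξ k a) := by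
    rw [Filter.eventually_all_finset]
    intro j _
    rw [Filter.eventually_all]
    exact fun a => h.eventually_shift_mem_base k j a x
  filter_upwards [h1] with y hy
  have h2 : ∀ j ≤ entranceTime ξ k x.1, (shift^[j] y.1 ∈ (onSeq ξ)^[k] '' Omega ξ ↔
      shift^[j] x.1 ∈ (onSeq ξ)^[k] '' Omega ξ) := by
    intro j hj
    rw [himg, himg]
    exact exists_congr fun a => hy j (Finset.mem_range.2 (by omega)) a
  apply le_antisymm
  · exact entranceTime_le ((h2 _ le_rfl).2 (shift_entranceTime_mem h.ne_nil k x.2))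
  · by_contra! hlt
    have := entranceTime_le ((h2 _ hlt.le).1 (shift_entranceTime_mem h.ne_nil k y.2))
    omega

theorem IsAperiodicPrimitive.eventually_visits (h : IsAperiodicPrimitive ξ) (k : ℕ) (a : A)
    (x : Omega ξ) : ∀ᶠ y : Omega ξ in 𝓝 x, visits ξ k y.1 a = visits ξ k x.1 a := by
  have h1 : ∀ᶠ y : Omega ξ in 𝓝 x, ∀ j ∈ Finset.range (entranceTime ξ (k + 1) x.1),
      (shift^[j] y.1 ∈ base ξ k a ↔ shift^[j] x.1 ∈ base ξ k a) := by
    rw [Filter.eventually_all_finset]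
    exact fun j _ => h.eventually_shift_mem_base k j a x
  filter_upwards [h1, h.eventually_entranceTime k x, h.eventually_entranceTime (k + 1) x] with
    y hy e1 e2
  rw [visits, visits, e1, e2]
  congr 1
  ext i
  simp only [Finset.mem_filter, Finset.mem_Ico, and_congr_right_iff]
  exact fun hi => hy i (Finset.mem_range.2 hi.2)

theorem IsAperiodicPrimitive.continuous_term (h : IsAperiodicPrimitive ξ) {n : ℕ}
    (v : Fin n → A → ℝ) (i : Fin n) (k : ℕ) :
    Continuous fun x : Omega ξ => term ξ v x.1 i k := by
  rw [continuous_iff_continuousAt]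
  intro x
  refine ContinuousAt.congr (f := fun _ => term ξ v x.1 i k) continuousAt_const ?_
  have h1 : ∀ᶠ y : Omega ξ in 𝓝 x, ∀ a, visits ξ k y.1 a = visits ξ k x.1 a :=
    Filter.eventually_all.2 fun a => h.eventually_visits k a x
  filter_upwards [h1] with y hy
  simp only [term, hy]

theorem IsAperiodicPrimitive.exists_term_le (h : IsAperiodicPrimitive ξ) {n : ℕ}
    (v : Fin n → A → ℝ) : ∃ C : ℝ, 0 ≤ C ∧ ∀ (x : Omega ξ) (i : Fin n) (k : ℕ),
      ‖term ξ v x.1 i k‖ ≤ C * ‖(transp ξ ^ k) (v i)‖ := by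
  obtain ⟨H, hH⟩ := h.exists_visits_le
  refine ⟨Fintype.card A * H, by positivity, fun x i k => ?_⟩
  rw [term, dotProduct]
  refine (norm_sum_le _ _).trans ?_
  calc ∑ a, ‖(visits ξ k x.1 a : ℝ) * (transp ξ ^ k) (v i) a‖
      ≤ ∑ _a : A, H * ‖(transp ξ ^ k) (v i)‖ := by
        refine Finset.sum_le_sum fun a _ => ?_
        rw [norm_mul]
        refine mul_le_mul ?_ (norm_le_pi_norm _ a) (norm_nonneg _) (by positivity)
        rw [Real.norm_of_nonneg (by positivity)]
        exact_mod_cast hH x.1 x.2 k a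
    _ = _ := by simp [mul_assoc]

theorem IsAperiodicPrimitive.summable_term (h : IsAperiodicPrimitive ξ) {n : ℕ}
    {v : Fin n → A → ℝ} {i : Fin n}
    (hv : Tendsto (fun k : ℕ => (transp ξ ^ k) (v i)) atTop (𝓝 0)) (x : Omega ξ) :
    Summable (term ξ v x.1 i) := by
  obtain ⟨C, -, hC⟩ := h.exists_term_le v
  exact Summable.of_norm_bounded ((summable_norm_transp_pow hv).mul_left C) fun k => hC x i k

theorem IsAperiodicPrimitive.continuous_mapF (h : IsAperiodicPrimitive ξ) {n : ℕ}
    {v : Fin n → A → ℝ} (hv : ∀ i, Tendsto (fun k : ℕ => (transp ξ ^ k) (v i)) atTop (𝓝 0)) :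
    Continuous (mapF ξ v) := by
  obtain ⟨C, -, hC⟩ := h.exists_term_le v
  refine continuous_pi fun i => ?_
  exact continuous_tsum (fun k => h.continuous_term v i k)
    ((summable_norm_transp_pow (hv i)).mul_left C) fun k x => hC x i k

end TopologyOmega


/-! ### Lower bounds for invariant measures and near returns -/

section InvariantMeasures

set_option linter.unusedSectionVars false

variable {A : Type*} [Fintype A] [DecidableEq A] [TopologicalSpace A] [DiscreteTopology A]
  [MeasurableSpace A] [DiscreteMeasurableSpace A] [Nonempty A] {ξ : A → List A}

theorem piece_subset_piece (hξ : ∀ a, ξ a ≠ []) {p k i : ℕ} {a b : A} {t : ℕ}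
    (ht : (iter ξ p b)[t]? = some a) :
    piece ξ (p + k) b ((((iter ξ p b).take t).flatMap (iter ξ k)).length + i) ⊆ piece ξ k a i := by
  rintro x ⟨y, hy, rfl, hx⟩
  have hlt : t < (iter ξ p (y 0)).length := (List.getElem?_eq_some_iff.1 ht).1
  have h1 := conc_spec (iter_ne_nil hξ p) y hlt
  rw [ht, pos_zero, zero_add, Option.some.injEq] at h1
  refine ⟨fun n => conc (iter ξ p) y (n + (t : ℤ)),
    shiftBy_mem_Omega (conc_mem_Omega hξ p hy) t, by simp [h1], ?_⟩
  have h2 := pos_conc_add (τ := iter ξ k) (iter_ne_nil hξ p) y 0 t hlt.le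
  rw [pos_zero, zero_add, pos_zero, zero_add] at h2
  rw [hx, conc_shift (iter_ne_nil hξ k), h2, conc_iter_add hξ]
  funext n
  congr 1
  push_cast
  ring

theorem exists_piece_subset (hξ : ∀ a, ξ a ≠ []) {p k : ℕ} {a b : A} (h : a ∈ iter ξ p b) :
    ∃ i < (iter ξ (p + k) b).length, piece ξ (p + k) b i ⊆ piece ξ k a 0 := by
  obtain ⟨t, ht⟩ := List.mem_iff_getElem?.1 h
  refine ⟨_, ?_, piece_subset_piece hξ (k := k) (i := 0) ht⟩
  rw [add_zero]
  rw [iter_add]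
  have hlt : t < (iter ξ p b).length := (List.getElem?_eq_some_iff.1 ht).1
  have := length_take_flatMap_lt (iter_ne_nil hξ k) hlt le_rfl
  rwa [List.take_length] at this

variable {ν : Measure (Omega ξ)}

theorem IsAperiodicPrimitive.measurableSet_piece (h : IsAperiodicPrimitive ξ) {k : ℕ} {a : A}
    {i : ℕ} (hi : i < (iter ξ k a).length) : MeasurableSet (piece ξ k a i) :=
  (h.isClopen_piece hi).1.measurableSet

theorem measure_piece (hξ : ∀ a, ξ a ≠ []) (hν : MeasurePreserving (shiftOmega ξ) ν ν) (k : ℕ)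
    (a : A) (i : ℕ) : ν (piece ξ k a i) = ν (piece ξ k a 0) := by
  induction i with
  | zero => rfl
  | succ i ih =>
    rw [← ih, ← shiftOmega_preimage_piece k a i,
      hν.measure_preimage (isClosed_piece hξ k a (i + 1)).measurableSet.nullMeasurableSet]

theorem measure_univ_le_sum (hξ : ∀ a, ξ a ≠ []) (hν : MeasurePreserving (shiftOmega ξ) ν ν)
    (k : ℕ) : ν Set.univ ≤ ∑ a, ((iter ξ k a).length : ENNReal) * ν (piece ξ k a 0) := by
  have hsub : (Set.univ : Set (Omega ξ)) ⊆
      ⋃ a ∈ (Finset.univ : Finset A), ⋃ i ∈ Finset.range (iter ξ k a).length, piece ξ k a i := by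
    intro x _
    obtain ⟨a, i, hi, hx⟩ := exists_mem_piece hξ k x
    simp only [Set.mem_iUnion]
    exact ⟨a, Finset.mem_univ a, i, Finset.mem_range.2 hi, hx⟩
  refine (measure_mono hsub).trans ((measure_biUnion_finset_le _ _).trans ?_)
  refine Finset.sum_le_sum fun a _ => (measure_biUnion_finset_le _ _).trans (le_of_eq ?_)
  simp [measure_piece hξ hν k a]

/-- Each base ξᵏ([a]) contains a floor of every tower of level p + k. These towers fill Ω and all
heights are comparable, so the bases have measure at least of order 1/|ξᵏ(a')|, uniformly in the
invariant measure. -/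
theorem IsAperiodicPrimitive.exists_measure_univ_le (h : IsAperiodicPrimitive ξ) :
    ∃ K : ℕ, ∀ (ν : Measure (Omega ξ)), MeasurePreserving (shiftOmega ξ) ν ν →
      ∀ k a a', ν Set.univ ≤ (K * (iter ξ k a').length : ℕ) * ν (piece ξ k a 0) := by
  obtain ⟨p, hp⟩ := exists_forall_mem_iter h.ne_nil h.primitive
  obtain ⟨C, -, hC⟩ := exists_length_iter_le h.ne_nil h.primitive
  obtain ⟨H, hH⟩ := (Set.finite_range fun a => (iter ξ p a).length).bddAbove
  refine ⟨H * C, fun ν hν k a a' => ?_⟩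
  choose i hi hsub using fun b => exists_piece_subset h.ne_nil (k := k) (hp p le_rfl a b)
  have h1 : ∑ b, ν (piece ξ (p + k) b 0) ≤ ν (piece ξ k a 0) := by
    calc ∑ b, ν (piece ξ (p + k) b 0) = ∑ b, ν (piece ξ (p + k) b (i b)) :=
          Finset.sum_congr rfl fun b _ => (measure_piece h.ne_nil hν _ b _).symm
      _ = ν (⋃ b ∈ (Finset.univ : Finset A), piece ξ (p + k) b (i b)) := by
          rw [measure_biUnion_finset _ fun b _ => h.measurableSet_piece (hi b)]
          intro b _ b' _ hbb
          exact Set.disjoint_left.2 fun x hx hx' => hbb (h.piece_unique (hi b) (hi b') hx hx').1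
      _ ≤ _ := measure_mono (Set.iUnion₂_subset fun b _ => hsub b)
  refine (measure_univ_le_sum h.ne_nil hν (p + k)).trans ?_
  refine le_trans ?_ (mul_le_mul_right h1 _)
  rw [Finset.mul_sum]
  refine Finset.sum_le_sum fun b _ => mul_le_mul_left (Nat.cast_le.2 ?_) _
  rw [iter_add, mul_assoc]
  exact (length_flatMap_le _ fun c => hC k c a').trans
    (Nat.mul_le_mul_right _ (hH ⟨b, rfl⟩))

/-- The points that agree near the origin with their translate by `m`. -/
def nearReturn (ξ : A → List A) (R m : ℕ) : Set (Omega ξ) :=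
  {x | ∀ n : ℤ, |n| ≤ R → x.1 (n + m) = x.1 n}

theorem measurableSet_nearReturn (R m : ℕ) : MeasurableSet (nearReturn ξ R m) := by
  have : nearReturn ξ R m = ⋂ n ∈ {n : ℤ | |n| ≤ R}, {x | x.1 (n + m) = x.1 n} := by
    ext x
    simp [nearReturn]
  rw [this]
  refine MeasurableSet.biInter (Set.to_countable _) fun n _ => ?_
  exact (isClosed_eq ((continuous_apply (A := fun _ : ℤ => A) _).comp continuous_subtype_val)
    ((continuous_apply (A := fun _ : ℤ => A) _).comp continuous_subtype_val)).measurableSet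

/-- By properness the cell of a and the next one both begin with ξᵏ(l). If the window around the
point lies in this prefix, translation by |ξᵏ⁺¹(a)| repeats it. -/
theorem piece_subset_nearReturn (hξ : ∀ a, ξ a ≠ []) {l : A} (hl : ∀ b, (ξ b).head? = some l)
    {k R i : ℕ} (hR : R ≤ i) (hi : i + R < (iter ξ k l).length) (a : A) :
    piece ξ (k + 1) a i ⊆ nearReturn ξ R (iter ξ (k + 1) a).length := by
  rintro x ⟨y, hy, rfl, hx⟩ n hn
  have hpre : ∀ (b : A) (t : ℕ), t < (iter ξ k l).length →
      t < (iter ξ (k + 1) b).length ∧ (iter ξ (k + 1) b)[t]? = (iter ξ k l)[t]? := by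
    intro b t ht
    obtain ⟨s, hs⟩ := List.head?_eq_some_iff.1 (hl b)
    have e : iter ξ (k + 1) b = iter ξ k l ++ s.flatMap (iter ξ k) := by
      rw [add_comm k 1, iter_add, iter_one, hs, List.flatMap_cons]
    rw [e, List.getElem?_append_left ht, List.length_append]
    exact ⟨by omega, rfl⟩
  have hσ := iter_ne_nil hξ (k + 1)
  rw [abs_le] at hn
  obtain ⟨t, ht⟩ := Int.eq_ofNat_of_zero_le (show 0 ≤ n + i by omega)
  have hlt : t < (iter ξ k l).length := by omega
  have e0 := conc_spec hσ y (j := 0) (hpre (y 0) t hlt).1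
  have e1 := conc_spec hσ y (j := 1) (hpre (y 1) t hlt).1
  rw [(hpre _ t hlt).2] at e0 e1
  have hpos := pos_add_one (iter ξ (k + 1)) y 0
  rw [pos_zero, zero_add, zero_add] at hpos
  rw [pos_zero, zero_add] at e0
  rw [hpos] at e1
  have e2 := Option.some.inj (e1.symm.trans e0)
  simp only [hx]
  rw [ht, ← e2]
  congr 1
  omega

/-- Once |ξᵏ(l)| ≥ 4R, at least half of the first |ξᵏ(l)| floors over a consist of near returns.
Their share of the total mass does not depend on R, k or the invariant measure. -/
theorem IsAperiodicPrimitive.exists_measure_nearReturn (h : IsAperiodicPrimitive ξ)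
    (hprop : IsProper ξ) (hlen : ∀ b, Tendsto (fun n => (iter ξ n b).length) atTop atTop) :
    ∃ c : ℕ, ∀ R : ℕ, ∃ k₀, ∀ k ≥ k₀, ∀ a, ∀ (ν : Measure (Omega ξ)),
      MeasurePreserving (shiftOmega ξ) ν ν →
        ν Set.univ ≤ c * ν (nearReturn ξ R (iter ξ (k + 1) a).length) := by
  obtain ⟨⟨l, hl⟩, -⟩ := hprop
  obtain ⟨K, hK⟩ := h.exists_measure_univ_le
  obtain ⟨C, -, hC⟩ := exists_length_iter_le h.ne_nil h.primitive
  refine ⟨K * ((iter ξ 1 l).length * C * 2), fun R => ?_⟩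
  obtain ⟨k₀, hk₀⟩ := eventually_atTop.1 ((hlen l).eventually_ge_atTop (4 * R))
  refine ⟨k₀, fun k hk a ν hν => ?_⟩
  have hR := hk₀ k hk
  have hm : ((iter ξ k l).length - 2 * R : ℕ) * ν (piece ξ (k + 1) a 0) ≤
      ν (nearReturn ξ R (iter ξ (k + 1) a).length) := by
    have hlt : ∀ i ∈ Finset.Ico R ((iter ξ k l).length - R), i < (iter ξ (k + 1) a).length := by
      intro i hi
      rw [Finset.mem_Ico] at hi
      obtain ⟨s, hs⟩ := List.head?_eq_some_iff.1 (hl a)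
      rw [add_comm k 1, iter_add, iter_one, hs, List.flatMap_cons, List.length_append]
      omega
    calc _ = ∑ i ∈ Finset.Ico R ((iter ξ k l).length - R), ν (piece ξ (k + 1) a i) := by
          simp only [measure_piece h.ne_nil hν (k + 1) a, Finset.sum_const, Nat.card_Ico,
            nsmul_eq_mul]
          congr 2
          omega
      _ = ν (⋃ i ∈ Finset.Ico R ((iter ξ k l).length - R), piece ξ (k + 1) a i) := by
          rw [measure_biUnion_finset _ fun i hi => h.measurableSet_piece (hlt i hi)]
          intro i hi j hj hij
          exact Set.disjoint_left.2 fun x hx hx' =>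
            hij (h.piece_unique (hlt i hi) (hlt j hj) hx hx').2
      _ ≤ _ := measure_mono (Set.iUnion₂_subset fun i hi => by
          rw [Finset.mem_Ico] at hi
          exact piece_subset_nearReturn h.ne_nil hl hi.1 (by omega) a)
  refine (hK ν hν (k + 1) a l).trans ?_
  refine le_trans ?_ (mul_le_mul_right hm _)
  rw [← mul_assoc]
  refine mul_le_mul_left ?_ _
  norm_cast
  have h1 : (iter ξ (k + 1) l).length ≤ (iter ξ 1 l).length * (C * (iter ξ k l).length) := by
    rw [add_comm k 1, iter_add]
    exact length_flatMap_le _ fun c => hC k c l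
  calc K * (iter ξ (k + 1) l).length
      ≤ K * ((iter ξ 1 l).length * (C * (2 * ((iter ξ k l).length - 2 * R)))) := by
        gcongr
        refine h1.trans ?_
        gcongr
        omega
    _ = _ := by ring

theorem exists_forall_agree_lt {g : Omega ξ → ℂ} (hg : Continuous g) {ε : ℝ} (hε : 0 < ε) :
    ∃ R : ℕ, ∀ y y' : Omega ξ, (∀ n : ℤ, |n| ≤ R → y.1 n = y'.1 n) → ‖g y - g y'‖ ≤ ε := by
  have h1 : ∀ x : Omega ξ, ∃ R : ℕ, ∀ y : Omega ξ, (∀ n : ℤ, |n| ≤ R → y.1 n = x.1 n) →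
      ‖g y - g x‖ ≤ ε / 2 := by
    intro x
    have hU : g ⁻¹' Metric.closedBall (g x) (ε / 2) ∈ 𝓝 x :=
      hg.continuousAt (Metric.closedBall_mem_nhds _ (by positivity))
    obtain ⟨U, hU, hsub⟩ := mem_nhds_subtype _ _ _ |>.1 hU
    obtain ⟨R, hR⟩ := exists_agree_subset hU
    refine ⟨R, fun y hy => ?_⟩
    have : y ∈ g ⁻¹' Metric.closedBall (g x) (ε / 2) := hsub (hR y.1 hy)
    simpa [dist_eq_norm] using this
  choose R hR using h1
  obtain ⟨t, -, ht⟩ := isCompact_univ.elim_nhds_subcover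
    (fun x : Omega ξ => {y | ∀ n : ℤ, |n| ≤ R x → y.1 n = x.1 n})
    fun x _ => continuous_subtype_val.continuousAt (eventually_agree x.1 (R x))
  refine ⟨t.sup R, fun y y' hy => ?_⟩
  obtain ⟨x, hxt, hx⟩ := Set.mem_iUnion₂.1 (ht (Set.mem_univ y))
  have hle : ((R x : ℕ) : ℤ) ≤ (t.sup R : ℕ) := by exact_mod_cast Finset.le_sup (f := R) hxt
  have h1 := hR x y hx
  have h2 := hR x y' fun n hn => (hy n (hn.trans hle)).symm.trans (hx n hn)
  calc ‖g y - g y'‖ ≤ ‖g y - g x‖ + ‖g x - g y'‖ := norm_sub_le_norm_sub_add_norm_sub _ _ _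
    _ ≤ ε / 2 + ε / 2 := by rw [norm_sub_rev (g x)]; gcongr
    _ = ε := by ring

end InvariantMeasures


/-! ### Eigenvalues along the lengths of the words ξᵏ(a) -/

section Eigenvalues

set_option linter.unusedSectionVars false

variable {A : Type*} [Fintype A] [DecidableEq A] [TopologicalSpace A] [DiscreteTopology A]
  [MeasurableSpace A] [DiscreteMeasurableSpace A] {ξ : A → List A}

/-- A measurable representative of an eigenfunction. -/
theorem IsEigenvalue.exists_measurable {X : Type*} [MeasurableSpace X] {μ : Measure X}
    [IsFiniteMeasure μ] {T : X → X} (hT : MeasurePreserving T μ μ) {l : ℂ}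
    (h : IsEigenvalue μ T l) : ∃ f : X → ℂ, Measurable f ∧ Integrable f μ ∧ ¬ f =ᵐ[μ] 0 ∧
      ∀ m : ℕ, (fun x => f (T^[m] x)) =ᵐ[μ] fun x => l ^ m * f x := by
  obtain ⟨f, hf, hf0, hfT⟩ := h
  have e := hf.1.ae_eq_mk
  refine ⟨hf.1.mk f, hf.1.stronglyMeasurable_mk.measurable,
    (hf.integrable (by norm_num)).congr e, fun h0 => hf0 (e.trans h0), fun m => ?_⟩
  have h1 : (fun x => hf.1.mk f (T x)) =ᵐ[μ] fun x => l * hf.1.mk f x := by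
    filter_upwards [e, hT.quasiMeasurePreserving.ae_eq_comp e, hfT] with x h1 h2 h3
    simp only [Function.comp_apply] at h2
    rw [← h2, ← h1, h3]
  induction m with
  | zero => simp
  | succ m ih =>
    filter_upwards [ih, (hT.iterate m).quasiMeasurePreserving.ae_eq_comp h1] with x h2 h3
    simp only [Function.comp_apply] at h3
    rw [Function.iterate_succ_apply', h3, h2, pow_succ']
    ring

theorem measurePreserving_withDensity {X : Type*} [MeasurableSpace X] {μ : Measure X} {T : X → X}
    (hT : MeasurePreserving T μ μ) {ρ : X → ENNReal} (hρ : Measurable ρ)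
    (h : (fun x => ρ (T x)) =ᵐ[μ] ρ) :
    MeasurePreserving T (μ.withDensity ρ) (μ.withDensity ρ) := by
  refine ⟨hT.measurable, Measure.ext fun B hB => ?_⟩
  rw [Measure.map_apply hT.measurable hB, withDensity_apply _ hB,
    withDensity_apply _ (hT.measurable hB), ← hT.setLIntegral_comp_preimage hB hρ]
  exact lintegral_congr_ae (ae_restrict_of_ae (h.mono fun _ hx => hx.symm))

variable [Nonempty A] {μ : Measure (Omega ξ)} [IsFiniteMeasure μ]

/-- On a near return (lᵐ − 1)f = f∘Sᵐ − f, where f is close to g in L¹ at both points, and g takes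
close values there because the points agree near the origin. The three errors add up to the bound.
-/
theorem enorm_sub_one_mul_le (hμ : MeasurePreserving (shiftOmega ξ) μ μ) {l : ℂ}
    {f : Omega ξ → ℂ} (hf : Measurable f) {m R : ℕ}
    (hfm : (fun x => f ((shiftOmega ξ)^[m] x)) =ᵐ[μ] fun x => l ^ m * f x)
    {g : Omega ξ → ℂ} (hg : Continuous g) {δ : ℝ}
    (hgR : ∀ y y' : Omega ξ, (∀ n : ℤ, |n| ≤ R → y.1 n = y'.1 n) → ‖g y - g y'‖ ≤ δ)
    (hfg : ∫⁻ x, ‖f x - g x‖ₑ ∂μ ≤ ENNReal.ofReal δ) :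
    ‖l ^ m - 1‖ₑ * (μ.withDensity fun x => ‖f x‖ₑ) (nearReturn ξ R m) ≤
      ENNReal.ofReal δ * (2 + μ Set.univ) := by
  have hE := measurableSet_nearReturn (ξ := ξ) R m
  have hm : Measurable fun x => ‖f x - g x‖ₑ := (hf.sub hg.measurable).enorm
  rw [withDensity_apply _ hE, ← lintegral_const_mul _ hf.enorm]
  calc ∫⁻ x in nearReturn ξ R m, ‖l ^ m - 1‖ₑ * ‖f x‖ₑ ∂μ
      ≤ ∫⁻ x in nearReturn ξ R m, (‖f ((shiftOmega ξ)^[m] x) - g ((shiftOmega ξ)^[m] x)‖ₑ +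
          ENNReal.ofReal δ + ‖f x - g x‖ₑ) ∂μ := by
        refine lintegral_mono_ae ((ae_restrict_iff' hE).2 ?_)
        filter_upwards [hfm] with x hx hxE
        have e : (l ^ m - 1) * f x = f ((shiftOmega ξ)^[m] x) - f x := by rw [hx]; ring
        have hg' : ‖g ((shiftOmega ξ)^[m] x) - g x‖ₑ ≤ ENNReal.ofReal δ := by
          rw [← ofReal_norm]
          refine ENNReal.ofReal_le_ofReal (hgR _ _ fun n hn => ?_)
          rw [coe_iterate_shiftOmega, iterate_shift]
          exact hxE n hn
        rw [← enorm_mul, e, show f ((shiftOmega ξ)^[m] x) - f x =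
          (f ((shiftOmega ξ)^[m] x) - g ((shiftOmega ξ)^[m] x)) +
            (g ((shiftOmega ξ)^[m] x) - g x) - (f x - g x) by ring]
        exact (enorm_sub_le.trans (add_le_add (enorm_add_le _ _) le_rfl)).trans (by gcongr)
    _ ≤ ∫⁻ x, (‖f ((shiftOmega ξ)^[m] x) - g ((shiftOmega ξ)^[m] x)‖ₑ +
          ENNReal.ofReal δ + ‖f x - g x‖ₑ) ∂μ := lintegral_mono' Measure.restrict_le_self le_rfl
    _ = (∫⁻ x, ‖f x - g x‖ₑ ∂μ) + ENNReal.ofReal δ * μ Set.univ + ∫⁻ x, ‖f x - g x‖ₑ ∂μ := by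
        rw [lintegral_add_right _ hm, lintegral_add_right _ measurable_const, lintegral_const,
          (hμ.iterate m).lintegral_comp hm]
    _ ≤ _ := by
        refine (add_le_add (add_le_add hfg le_rfl) hfg).trans (le_of_eq ?_)
        ring

/-- As |l| = 1, the measure |f|μ is invariant too, so near returns carry a fixed share of it.
Weighting by |f| avoids any lower bound on |f|, and ergodicity as well. -/
theorem IsAperiodicPrimitive.tendsto_pow_length (h : IsAperiodicPrimitive ξ)
    (hprop : IsProper ξ) (hlen : ∀ b, Tendsto (fun n => (iter ξ n b).length) atTop atTop)
    (hμ : MeasurePreserving (shiftOmega ξ) μ μ) {l : ℂ} (hl : ‖l‖ = 1)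
    (he : IsEigenvalue μ (shiftOmega ξ) l) (a : A) :
    Tendsto (fun k => l ^ (iter ξ k a).length) atTop (𝓝 1) := by
  obtain ⟨f, hf, hfi, hf0, hfm⟩ := he.exists_measurable hμ
  set ν := μ.withDensity fun x => ‖f x‖ₑ with hνdef
  have hν : MeasurePreserving (shiftOmega ξ) ν ν := by
    refine measurePreserving_withDensity hμ hf.enorm ?_
    filter_upwards [hfm 1] with x hx
    simp only [Function.iterate_one, pow_one] at hx
    rw [hx, enorm_mul, ← ofReal_norm, hl]
    simp
  have hνu : ν Set.univ = ∫⁻ x, ‖f x‖ₑ ∂μ := by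
    rw [withDensity_apply _ MeasurableSet.univ, Measure.restrict_univ]
  have hν0 : ν Set.univ ≠ 0 := by
    rw [hνu, Ne, lintegral_eq_zero_iff hf.enorm]
    intro h0
    exact hf0 (h0.mono fun x hx => by simpa using hx)
  have hνt : ν Set.univ ≠ ⊤ := by
    rw [hνu]
    exact hfi.2.ne
  obtain ⟨c, hc⟩ := h.exists_measure_nearReturn hprop hlen
  have hM : 0 < (ν Set.univ).toReal := ENNReal.toReal_pos hν0 hνt
  set D : ℝ := c * (2 + (μ Set.univ).toReal) + 1 with hD
  have hDpos : 0 < D := by positivity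
  rw [← tendsto_add_atTop_iff_nat 1, Metric.tendsto_atTop]
  intro ε hε
  -- Chosen so that cδ(2 + μ(Ω)) ≤ δD is half of ε ν(Ω).
  set δ : ℝ := ε * (ν Set.univ).toReal / D / 2 with hδ
  have hδpos : 0 < δ := by positivity
  obtain ⟨g, hfg, -⟩ := hfi.exists_boundedContinuous_lintegral_sub_le
    (ε := ENNReal.ofReal δ) (by simpa using hδpos)
  obtain ⟨R, hR⟩ := exists_forall_agree_lt g.continuous hδpos
  obtain ⟨k₀, hk₀⟩ := hc R
  refine ⟨k₀, fun k hk => ?_⟩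
  have h1 := hk₀ k hk a ν hν
  have h2 := enorm_sub_one_mul_le hμ hf (hfm (iter ξ (k + 1) a).length) g.continuous hR hfg
  set m := (iter ξ (k + 1) a).length
  have h3 : ‖l ^ m - 1‖ₑ * ν Set.univ ≤ c * (ENNReal.ofReal δ * (2 + μ Set.univ)) := by
    calc ‖l ^ m - 1‖ₑ * ν Set.univ ≤ ‖l ^ m - 1‖ₑ * (c * ν (nearReturn ξ R m)) := by gcongr
      _ = c * (‖l ^ m - 1‖ₑ * ν (nearReturn ξ R m)) := by ring
      _ ≤ _ := by gcongr
  have h4 := ENNReal.toReal_mono (by finiteness) h3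
  rw [ENNReal.toReal_mul, ENNReal.toReal_mul, ENNReal.toReal_mul, toReal_enorm,
    ENNReal.toReal_add (by finiteness) (by finiteness), ENNReal.toReal_ofReal hδpos.le,
    ENNReal.toReal_natCast, ENNReal.toReal_ofNat] at h4
  rw [dist_eq_norm]
  have h5 : ‖l ^ m - 1‖ * (ν Set.univ).toReal < ε * (ν Set.univ).toReal := by
    calc _ ≤ _ := h4
      _ = δ * (D - 1) := by rw [hD]; ring
      _ ≤ δ * D := by gcongr; linarith
      _ = ε * (ν Set.univ).toReal / 2 := by rw [hδ]; field_simp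
      _ < _ := by linarith [mul_pos hε hM]
  exact lt_of_mul_lt_mul_right h5 hM.le

theorem tendsto_sub_round_of_tendsto_exp {α : ℝ} {m : ℕ → ℕ}
    (h : Tendsto (fun k => Complex.exp (2 * (Real.pi : ℂ) * Complex.I * (α : ℂ)) ^ m k) atTop
      (𝓝 1)) : Tendsto (fun k => α * m k - round (α * m k)) atTop (𝓝 0) := by
  have h1 : Tendsto (fun k => AddCircle.homeomorphCircle (T := 1) one_ne_zero
      ((α * m k : ℝ) : AddCircle (1 : ℝ))) atTop (𝓝 1) := by
    refine (Topology.IsEmbedding.subtypeVal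
      (p := fun z : ℂ => z ∈ Submonoid.unitSphere ℂ)).tendsto_nhds_iff.2 (h.congr fun k => ?_)
    change _ = (AddCircle.homeomorphCircle (T := 1) one_ne_zero
      ((α * m k : ℝ) : AddCircle (1 : ℝ)) : ℂ)
    rw [AddCircle.homeomorphCircle_apply, AddCircle.toCircle_apply_mk,
      Circle.coe_exp, ← Complex.exp_nat_mul]
    congr 1
    push_cast
    ring
  have h2 := ((AddCircle.homeomorphCircle (T := 1) one_ne_zero).symm.continuous.tendsto 1).comp h1
  have h3 : (AddCircle.homeomorphCircle (T := 1) one_ne_zero).symm 1 = 0 := by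
    rw [Homeomorph.symm_apply_eq, AddCircle.homeomorphCircle_apply, AddCircle.toCircle_zero]
  rw [h3] at h2
  have h4 := h2.norm
  simp only [Function.comp_def, Homeomorph.symm_apply_apply, norm_zero] at h4
  rw [tendsto_zero_iff_abs_tendsto_zero]
  refine h4.congr fun k => ?_
  exact UnitAddCircle.norm_eq

end Eigenvalues


/-! ### Consequences of Hypotheses P -/

section Hypotheses

set_option linter.unusedSectionVars false

theorem eq_zero_of_sum_mul_eq_intCast {n : ℕ} {α : Fin n → ℝ}
    (hα : LinearIndependent ℚ (Fin.cons 1 α : Fin (n + 1) → ℝ)) {k : Fin n → ℤ} {z : ℤ}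
    (h : ∑ i, (k i : ℝ) * α i = z) : k = 0 := by
  have h1 := Fintype.linearIndependent_iff.1 hα (Fin.cons (-(z : ℚ)) fun i => (k i : ℚ)) (by
    rw [Fin.sum_univ_succ]
    simp only [Fin.cons_zero, Fin.cons_succ, Rat.smul_def, Rat.cast_neg, Rat.cast_intCast, h]
    ring)
  funext i
  simpa using h1 i.succ

theorem ne_nil_of_isProper {A : Type*} {ξ : A → List A} (h : IsProper ξ) (a : A) : ξ a ≠ [] := by
  obtain ⟨⟨l, hl⟩, -⟩ := h
  intro h0
  simpa [h0] using hl a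

variable {A : Type*} [Fintype A] [DecidableEq A] [TopologicalSpace A] [DiscreteTopology A]
  [MeasurableSpace A] [DiscreteMeasurableSpace A] {ξ : A → List A}
  {μ : Measure (Omega ξ)} {n : ℕ} {α : Fin n → ℝ}

theorem perron_pos_of_mul_abs_eq_one {β d : ℝ} (h : β * |d| = 1) : 0 < β := by
  by_contra! hβ
  have := mul_nonpos_of_nonpos_of_nonneg hβ (abs_nonneg d)
  linarith

/-- On the zero space the determinant is 1, which would give β = 1, but β > 1. -/
theorem HypothesesP.pos (hP : HypothesesP ξ μ α) : 0 < n := by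
  rw [Nat.pos_iff_ne_zero]
  rintro rfl
  obtain ⟨β, hβ, hd⟩ := hP.perron_det
  have h1 := (norm_le_one_of_isCharRoot hβ (perron_pos_of_mul_abs_eq_one hd) hP.unique_root).1
  rw [LinearMap.det_eq_one_of_finrank_eq_zero hP.dim_eq] at hd
  simp at hd
  linarith

/-- If S^q were the identity, an eigenfunction would give e^{2πiqα} = 1, against the irrationality
of α. -/
theorem HypothesesP.isAperiodicPrimitive [IsProbabilityMeasure μ]
    (hμ : MeasurePreserving (shiftOmega ξ) μ μ) (hP : HypothesesP ξ μ α) :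
    IsAperiodicPrimitive ξ := by
  refine ⟨ne_nil_of_isProper hP.proper, hP.primitive, fun q hq hper => ?_⟩
  obtain ⟨f, hf, -, hf0, hfm⟩ := (hP.eigenvalue ⟨0, hP.pos⟩).exists_measurable hμ
  have hid : ∀ x, (shiftOmega ξ)^[q] x = x := by
    intro x
    apply Subtype.ext
    rw [coe_iterate_shiftOmega, iterate_shift]
    exact funext (hper x.1 x.2)
  have h1 := hfm q
  simp only [hid] at h1
  have h2 : ∃ᵐ x ∂μ, f x ≠ 0 := fun h => hf0 (h.mono fun x hx => not_not.1 hx)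
  obtain ⟨x, hx, hx0⟩ := (h2.and_eventually h1).exists
  rw [eq_comm, mul_eq_right₀ hx, ← Complex.exp_nat_mul, Complex.exp_eq_one_iff] at hx0
  obtain ⟨z, hz⟩ := hx0
  have h3 : ((q : ℝ) * α ⟨0, hP.pos⟩) = z := by
    have h2pi : (2 * (Real.pi : ℂ) * Complex.I) ≠ 0 := Complex.two_pi_I_ne_zero
    have : ((q : ℂ) * (α ⟨0, hP.pos⟩ : ℂ)) = z := by
      apply mul_right_cancel₀ h2pi
      rw [← hz]
      ring
    exact_mod_cast this
  have h4 := eq_zero_of_sum_mul_eq_intCast hP.indep (k := Pi.single ⟨0, hP.pos⟩ (q : ℤ)) (z := z) (by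
    rw [Finset.sum_eq_single ⟨0, hP.pos⟩]
    · simpa using h3
    · intro i _ hi
      simp [Pi.single_eq_of_ne hi]
    · simp)
  have := congrFun h4 ⟨0, hP.pos⟩
  simp at this
  omega

theorem HypothesesP.exists_isSplitting [Nonempty A] [IsProbabilityMeasure μ]
    (hμ : MeasurePreserving (shiftOmega ξ) μ μ) (hP : HypothesesP ξ μ α) :
    ∃ (v : Fin n → A → ℝ) (w : Fin n → A → ℤ), IsSplitting ξ α v w := by
  have h := hP.isAperiodicPrimitive hμ
  obtain ⟨β, hβ, hd⟩ := hP.perron_det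
  obtain ⟨m, T, hc, hT⟩ := exists_pow_eq_pow_succ_mul h.ne_nil h.primitive hβ hP.unique_root hd
  have h1 : ∀ i, ∃ (v : A → ℝ) (w : A → ℤ), (∀ a, α i = v a + w a) ∧
      Tendsto (fun k => (transp ξ ^ k) v) atTop (𝓝 0) := by
    intro i
    refine exists_splitting hc hT fun a => ?_
    refine tendsto_sub_round_of_tendsto_exp ?_
    refine h.tendsto_pow_length hP.proper hP.subst.2 hμ ?_ (hP.eigenvalue i) a
    rw [Complex.norm_exp]
    simp
  choose v w hs ht using h1
  exact ⟨v, w, hs, ht⟩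

end Hypotheses

/-! ### The map to the torus and its equivariance -/

section TorusValuedMap

set_option linter.unusedSectionVars false

variable {A : Type*} [Fintype A] [DecidableEq A] [Nonempty A] {ξ : A → List A} {n : ℕ}
  {α : Fin n → ℝ} {v : Fin n → A → ℝ} {w : Fin n → A → ℤ}

theorem IsSplitting.transp_pow_apply_eq (hs : IsSplitting ξ α v w) (i : Fin n) (k : ℕ) (a : A) :
    ∃ z : ℤ, (transp ξ ^ k) (v i) a = α i * (iter ξ k a).length - z := by
  refine ⟨((incidence ℤ ξ)ᵀ ^ k *ᵥ w i) a, ?_⟩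
  have h1 : v i = α i • (1 : A → ℝ) - fun a => (w i a : ℝ) := by
    funext b
    simp [hs.split i b]
  conv_lhs => rw [h1, map_sub, map_smul, transp_intCast]
  simp [transp_pow_one]

/-- At the letter a, Lᵏv(i) is α_i|ξᵏ(a)| up to an integer. The cells between two successive
entrances have total length the difference of the entrance times, so the partial sums telescope
modulo 1. -/
theorem IsAperiodicPrimitive.term_eq (h : IsAperiodicPrimitive ξ) (hs : IsSplitting ξ α v w)
    {x : ℤ → A} (hx : x ∈ Omega ξ) (i : Fin n) (k : ℕ) : ∃ z : ℤ,
      term ξ v x i k = α i * entranceTime ξ (k + 1) x - α i * entranceTime ξ k x - z := by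
  choose z hz using hs.transp_pow_apply_eq i k
  rw [term, h.visits_dotProduct k hx]
  have h1 : (entranceTime ξ (k + 1) x : ℝ) = entranceTime ξ k x +
      ∑ l ∈ Finset.range (entranceTime ξ 1 ((desub ξ)^[k] x)),
        ((iter ξ k ((desub ξ)^[k] x l)).length : ℝ) := by
    have := (h.shift_entranceTime k hx).2
    rw [pos_natCast] at this
    exact_mod_cast this
  refine ⟨∑ l ∈ Finset.range (entranceTime ξ 1 ((desub ξ)^[k] x)), z ((desub ξ)^[k] x l), ?_⟩
  simp only [hz, Finset.sum_sub_distrib, h1, ← Finset.mul_sum, Int.cast_sum]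
  ring

theorem IsAperiodicPrimitive.coe_sum_term (h : IsAperiodicPrimitive ξ) (hs : IsSplitting ξ α v w)
    {x : ℤ → A} (hx : x ∈ Omega ξ) (i : Fin n) (K : ℕ) :
    ((∑ k ∈ Finset.range K, term ξ v x i k : ℝ) : UnitAddCircle) =
      ((α i * entranceTime ξ K x : ℝ) : UnitAddCircle) := by
  induction K with
  | zero =>
    have := entranceTime_eq_zero h.ne_nil (k := 0) hx
    rw [conc_iter_zero] at this
    simp [this]
  | succ K ih =>
    obtain ⟨z, hz⟩ := h.term_eq hs hx i K
    have h1 : ((z : ℝ) : UnitAddCircle) = 0 := by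
      rw [AddCircle.coe_eq_zero_iff]
      exact ⟨z, by simp⟩
    rw [Finset.sum_range_succ, AddCircle.coe_add, ih, hz, AddCircle.coe_sub, AddCircle.coe_sub, h1]
    abel

/-- The shift lowers the entrance time by 1, except on ξᴷ(Ω), where it jumps from 0 to |ξᴷ(a)| − 1.
There the error α_i|ξᴷ(a)| is, up to an integer, a coordinate of Lᴷv(i). -/
theorem IsAperiodicPrimitive.norm_entranceTime_shift_le (h : IsAperiodicPrimitive ξ)
    (hs : IsSplitting ξ α v w) {x : ℤ → A} (hx : x ∈ Omega ξ) (i : Fin n) (K : ℕ) :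
    ‖((α i * entranceTime ξ K (shift x) : ℝ) : UnitAddCircle) -
      ((α i * entranceTime ξ K x : ℝ) : UnitAddCircle) + (α i : UnitAddCircle)‖ ≤
        ‖(transp ξ ^ K) (v i)‖ := by
  rw [← AddCircle.coe_sub, ← AddCircle.coe_add]
  rcases Nat.eq_zero_or_pos (entranceTime ξ K x) with h0 | h0
  · have h1 := shift_entranceTime_mem h.ne_nil K hx
    rw [h0, mem_image_onSeq_iff h.ne_nil] at h1
    obtain ⟨y, hy, e⟩ := h1
    have e' : x = conc (iter ξ K) y := e
    have h2 := h.entranceTime_shift_conc (k := K) hy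
    rw [← e'] at h2
    obtain ⟨z, hz⟩ := hs.transp_pow_apply_eq i K (y 0)
    have h3 : α i * entranceTime ξ K (shift x) - α i * entranceTime ξ K x + α i =
        (transp ξ ^ K) (v i) (y 0) + z := by
      rw [hz, h0, ← h2]
      push_cast
      ring
    rw [h3, UnitAddCircle.norm_eq, round_add_intCast]
    push_cast
    rw [add_sub_add_right_eq_sub]
    refine (round_le _ 0).trans ?_
    simpa using norm_le_pi_norm ((transp ξ ^ K) (v i)) (y 0)
  · have h1 := entranceTime_shift_of_pos h.ne_nil hx h0
    have h3 : α i * entranceTime ξ K (shift x) - α i * entranceTime ξ K x + α i = 0 := by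
      rw [← h1]
      push_cast
      ring
    rw [h3]
    simp

variable [TopologicalSpace A] [DiscreteTopology A]

theorem IsAperiodicPrimitive.tendsto_entranceTime (h : IsAperiodicPrimitive ξ)
    (hs : IsSplitting ξ α v w) (x : Omega ξ) (i : Fin n) :
    Tendsto (fun K => ((α i * entranceTime ξ K x.1 : ℝ) : UnitAddCircle)) atTop
      (𝓝 (toTorus (mapF ξ v x) i)) := by
  have h1 := (h.summable_term (hs.tendsto i) x).hasSum.tendsto_sum_nat
  have h2 := ((AddCircle.continuous_mk' (1 : ℝ)).tendsto _).comp h1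
  exact h2.congr fun K => h.coe_sum_term hs x.2 i K

theorem IsAperiodicPrimitive.toTorus_mapF_shiftOmega (h : IsAperiodicPrimitive ξ)
    (hs : IsSplitting ξ α v w) (x : Omega ξ) :
    toTorus (mapF ξ v (shiftOmega ξ x)) = toTorus (mapF ξ v x) + -toTorus α := by
  funext i
  have h1 := ((h.tendsto_entranceTime hs (shiftOmega ξ x) i).sub
    (h.tendsto_entranceTime hs x i)).add_const (α i : UnitAddCircle)
  have h2 := squeeze_zero_norm (fun K => h.norm_entranceTime_shift_le hs x.2 i K)
    (tendsto_zero_iff_norm_tendsto_zero.1 (hs.tendsto i))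
  have h3 := tendsto_nhds_unique h1 h2
  simp only [Pi.add_apply, Pi.neg_apply]
  change _ = _ + -(α i : UnitAddCircle)
  rw [← sub_eq_zero, ← h3]
  abel

theorem mFourier_neg_toTorus_ne_one
    (hα : LinearIndependent ℚ (Fin.cons 1 α : Fin (n + 1) → ℝ)) (k : Fin n → ℤ) (hk : k ≠ 0) :
    UnitAddTorus.mFourier k (-toTorus α) ≠ 1 := by
  intro h
  apply hk
  have e : UnitAddTorus.mFourier k (-toTorus α) =
      Complex.exp ((2 * Real.pi * Complex.I) * ((∑ i, -((k i : ℝ) * α i) : ℝ) : ℂ)) := by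
    rw [UnitAddTorus.mFourier, ContinuousMap.coe_mk]
    push_cast
    rw [Finset.mul_sum, Complex.exp_sum]
    refine Finset.prod_congr rfl fun i _ => ?_
    change fourier (k i) (-(α i : UnitAddCircle)) = _
    rw [← AddCircle.coe_neg, fourier_coe_apply]
    congr 1
    push_cast
    ring
  rw [e, Complex.exp_eq_one_iff] at h
  obtain ⟨z, hz⟩ := h
  refine eq_zero_of_sum_mul_eq_intCast hα (z := -z) ?_
  rw [mul_comm (z : ℂ)] at hz
  have h1 := mul_left_cancel₀ Complex.two_pi_I_ne_zero hz
  have h2 : ∑ i, -((k i : ℝ) * α i) = z := by exact_mod_cast h1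
  rw [Finset.sum_neg_distrib] at h2
  push_cast
  linarith

end TorusValuedMap


/-! ### Volumes of the images of the pieces -/

section Volumes

set_option linter.unusedSectionVars false

variable {A : Type*} [Fintype A] [DecidableEq A] [Nonempty A] [TopologicalSpace A]
  [DiscreteTopology A] {ξ : A → List A} {n : ℕ} {v : Fin n → A → ℝ}

/-- The first k visit vectors of ξᵏ(x) vanish and the others are those of x, so applying ξᵏ amounts
to replacing v by Lᵏv. -/
theorem IsAperiodicPrimitive.mapF_conc (h : IsAperiodicPrimitive ξ)
    (hv : ∀ i, Tendsto (fun k : ℕ => (transp ξ ^ k) (v i)) atTop (𝓝 0)) (k : ℕ) {x y : Omega ξ}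
    (hy : y.1 = conc (iter ξ k) x.1) :
    mapF ξ v y = mapF ξ (fun i => (transp ξ ^ k) (v i)) x := by
  funext i
  have h1 := (h.summable_term (hv i) y).sum_add_tsum_nat_add k
  have h2 : ∑ l ∈ Finset.range k, term ξ v y.1 i l = 0 := by
    refine Finset.sum_eq_zero fun l hl => ?_
    simp [term, hy, h.visits_conc_of_lt (Finset.mem_range.1 hl) x.2, dotProduct]
  rw [h2, zero_add] at h1
  rw [mapF, ← h1, mapF]
  congr 1
  funext l
  rw [term, term, hy, add_comm l k]
  simp only [h.visits_conc_add k l x.2]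
  rw [← Module.End.mul_apply, ← pow_add, add_comm l k]

theorem IsAperiodicPrimitive.image_mapF_piece (h : IsAperiodicPrimitive ξ)
    (hv : ∀ i, Tendsto (fun k : ℕ => (transp ξ ^ k) (v i)) atTop (𝓝 0)) (k : ℕ) (a : A) :
    mapF ξ v '' piece ξ k a 0 = mapF ξ (fun i => (transp ξ ^ k) (v i)) '' piece ξ 0 a 0 := by
  ext p
  constructor
  · rintro ⟨x, ⟨y, hy, ha, e⟩, rfl⟩
    have e' : x.1 = conc (iter ξ k) y := by simpa using e
    exact ⟨⟨y, hy⟩, ⟨y, hy, ha, by simp [conc_iter_zero]⟩,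
      (h.mapF_conc hv k (x := ⟨y, hy⟩) e').symm⟩
  · rintro ⟨x, ⟨y, hy, ha, e⟩, rfl⟩
    have e' : x.1 = y := by simpa [conc_iter_zero] using e
    exact ⟨⟨conc (iter ξ k) x.1, conc_mem_Omega h.ne_nil k x.2⟩,
      ⟨x.1, x.2, by rw [e', ha], by simp⟩, h.mapF_conc hv k rfl⟩

theorem IsAperiodicPrimitive.mapF_eq_mulVec (h : IsAperiodicPrimitive ξ) {u : Fin n → A → ℝ}
    (hv : ∀ i, Tendsto (fun k : ℕ => (transp ξ ^ k) (v i)) atTop (𝓝 0))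
    {B : Matrix (Fin n) (Fin n) ℝ} (hu : ∀ j, u j = ∑ i, B i j • v i) (x : Omega ξ) :
    mapF ξ u x = Matrix.toLin' Bᵀ (mapF ξ v x) := by
  funext j
  have h1 : ∀ k, term ξ u x.1 j k = ∑ i, B i j * term ξ v x.1 i k := by
    intro k
    simp only [term, hu, map_sum, map_smul, dotProduct_sum, dotProduct_smul, smul_eq_mul]
  simp only [mapF, h1, Matrix.toLin'_apply, Matrix.mulVec, dotProduct, Matrix.transpose_apply]
  rw [Summable.tsum_finsetSum fun i _ => (h.summable_term (hv i) x).mul_left _]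
  exact Finset.sum_congr rfl fun i _ => tsum_mul_left

theorem tendsto_transp_pow_pow {u : A → ℝ}
    (hu : Tendsto (fun k : ℕ => (transp ξ ^ k) u) atTop (𝓝 0)) (m : ℕ) :
    Tendsto (fun k : ℕ => (transp ξ ^ k) ((transp ξ ^ m) u)) atTop (𝓝 0) := by
  refine ((tendsto_add_atTop_iff_nat m).2 hu).congr fun k => ?_
  rw [pow_add]
  rfl

/-- The matrix of the transpose of the incidence matrix on a basis of the stable space. -/
theorem exists_matrix_stableSpace {u : Fin n → A → ℝ} (hu : ∀ i, u i ∈ stableSpace ξ)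
    (hli : LinearIndependent ℝ u) (hn : Module.finrank ℝ (stableSpace ξ) = n) :
    ∃ B : Matrix (Fin n) (Fin n) ℝ, (∀ j, transp ξ (u j) = ∑ i, B i j • u i) ∧
      B.det = LinearMap.det ((transp ξ).restrict (transp_mem_stableSpace ξ)) := by
  have hli' : LinearIndependent ℝ fun i => (⟨u i, hu i⟩ : stableSpace ξ) :=
    LinearIndependent.of_comp (stableSpace ξ).subtype hli
  have hcard : Fintype.card (Fin n) = Module.finrank ℝ (stableSpace ξ) := by simp [hn]
  let b : Module.Basis (Fin n) ℝ (stableSpace ξ) :=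
    basisOfLinearIndependentOfCardEqFinrank' _ hli' hcard
  have hb : ∀ i, b i = ⟨u i, hu i⟩ := fun i => by simp [b]
  refine ⟨LinearMap.toMatrix b b ((transp ξ).restrict (transp_mem_stableSpace ξ)), fun j => ?_,
    LinearMap.det_toMatrix b _⟩
  have h1 := b.sum_repr ((transp ξ).restrict (transp_mem_stableSpace ξ) (b j))
  have h2 := congrArg (stableSpace ξ).subtype h1
  simp only [map_sum, map_smul, hb, Submodule.subtype_apply] at h2
  simp only [LinearMap.toMatrix_apply, hb]
  exact h2.symm

theorem IsAperiodicPrimitive.volume_image_mapF (h : IsAperiodicPrimitive ξ)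
    (hv : ∀ i, Tendsto (fun k : ℕ => (transp ξ ^ k) (v i)) atTop (𝓝 0))
    {B : Matrix (Fin n) (Fin n) ℝ} (hB : ∀ j, transp ξ (v j) = ∑ i, B i j • v i) (k : ℕ)
    (E : Set (Omega ξ)) :
    volume (mapF ξ (fun i => (transp ξ ^ k) (v i)) '' E) =
      ENNReal.ofReal |B.det| ^ k * volume (mapF ξ v '' E) := by
  induction k with
  | zero => simp
  | succ k ih =>
    have h1 : mapF ξ (fun i => (transp ξ ^ (k + 1)) (v i)) =
        Matrix.toLin' Bᵀ ∘ mapF ξ (fun i => (transp ξ ^ k) (v i)) := by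
      funext x
      refine h.mapF_eq_mulVec (fun i => tendsto_transp_pow_pow (hv i) k) (fun j => ?_) x
      rw [pow_succ, Module.End.mul_apply, hB, map_sum]
      simp
    rw [h1, Set.image_comp, Measure.addHaar_image_linearMap, ih, LinearMap.det_toLin',
      Matrix.det_transpose, pow_succ']
    ring

/-- The vectors Lᵐv(i) lie in Eˢ, are independent, and are as many as its dimension, so they form a
basis; the vectors v(i) need not lie in Eˢ, hence the start at level m. Each further level applies a
linear map of determinant det L on Eˢ to the image. -/
theorem IsAperiodicPrimitive.exists_volume_piece_le (h : IsAperiodicPrimitive ξ)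
    {m : ℕ} {T : Matrix A A ℤ} (hT : (incidence ℤ ξ)ᵀ ^ m = (incidence ℤ ξ)ᵀ ^ (m + 1) * T)
    {α : Fin n → ℝ} {w : Fin n → A → ℤ} (hs : IsSplitting ξ α v w)
    (hα : LinearIndependent ℚ (Fin.cons 1 α : Fin (n + 1) → ℝ))
    (hn : Module.finrank ℝ (stableSpace ξ) = n) :
    ∃ C : ENNReal, C ≠ ⊤ ∧ ∀ k a, volume (mapF ξ v '' piece ξ (m + k) a 0) ≤
      ENNReal.ofReal |LinearMap.det ((transp ξ).restrict (transp_mem_stableSpace ξ))| ^ k * C := by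
  have hu : ∀ i, (transp ξ ^ m) (v i) ∈ stableSpace ξ := fun i =>
    ⟨tendsto_transp_pow_pow (hs.tendsto i) m, pow_transp_mem_range hT (v i)⟩
  obtain ⟨B, hB, hdet⟩ := exists_matrix_stableSpace hu (hs.linearIndependent h.ne_nil hα m) hn
  have hv := fun i => tendsto_transp_pow_pow (hs.tendsto i) m
  refine ⟨volume (mapF ξ (fun i => (transp ξ ^ m) (v i)) '' Set.univ), ?_, fun k a => ?_⟩
  · exact (isCompact_univ.image (h.continuous_mapF hv)).measure_ne_top
  · have e : (fun i => (transp ξ ^ (m + k)) (v i)) =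
        fun i => (transp ξ ^ k) ((transp ξ ^ m) (v i)) := by
      funext i
      rw [add_comm, pow_add, Module.End.mul_apply]
    rw [h.image_mapF_piece hs.tendsto, e, h.volume_image_mapF hv hB, hdet]
    gcongr
    exact Set.subset_univ _

end Volumes


/-! ### Pieces of high level separate points -/

section Separation

set_option linter.unusedSectionVars false

variable {A : Type*} [Nonempty A] {ξ : A → List A}

/-- Points in the same piece agree on the cell of the origin. By properness they also agree on the
end ξᵏ(l') of the cell before it and on the beginning ξᵏ(l) of the cell after it. -/
theorem conc_eq_of_isProper (hξ : ∀ a, ξ a ≠ []) {l l' : A} (hl : ∀ b, (ξ b).head? = some l)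
    (hl' : ∀ b, (ξ b).getLast? = some l') {k i : ℕ} {y z : ℤ → A} (h0 : y 0 = z 0)
    (hi : i < (iter ξ (k + 1) (y 0)).length) {n : ℤ} (hn : |n| < (iter ξ k l).length)
    (hn' : |n| < (iter ξ k l').length) :
    conc (iter ξ (k + 1)) y (n + i) = conc (iter ξ (k + 1)) z (n + i) := by
  have hσ := iter_ne_nil hξ (k + 1)
  have key : ∀ (j : ℤ) (t t' : ℕ), t < (iter ξ (k + 1) (y j)).length →
      t' < (iter ξ (k + 1) (z j)).length →
      (iter ξ (k + 1) (y j))[t]? = (iter ξ (k + 1) (z j))[t']? →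
      pos (iter ξ (k + 1)) y j + t = n + i → pos (iter ξ (k + 1)) z j + t' = n + i →
      conc (iter ξ (k + 1)) y (n + i) = conc (iter ξ (k + 1)) z (n + i) := by
    intro j t t' ht ht' e e1 e2
    rw [conc_spec hσ y ht, conc_spec hσ z ht', e1, e2] at e
    exact Option.some.inj e
  have hsplit : ∀ b, iter ξ (k + 1) b = (ξ b).flatMap (iter ξ k) := fun b => by
    rw [add_comm k 1, iter_add, iter_one]
  have hpos : ∀ u : ℤ → A, pos (iter ξ (k + 1)) u 1 = (iter ξ (k + 1) (u 0)).length := fun u => by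
    have := pos_add_one (iter ξ (k + 1)) u 0
    rwa [pos_zero, zero_add, zero_add] at this
  have hneg : ∀ u : ℤ → A, pos (iter ξ (k + 1)) u (-1) = -(iter ξ (k + 1) (u (-1))).length :=
    fun u => by
      have := pos_add_one (iter ξ (k + 1)) u (-1)
      rw [neg_add_cancel, pos_zero] at this
      linarith
  rw [abs_lt] at hn hn'
  rcases lt_or_ge (n + i) 0 with h1 | h1
  · have hsuf : ∀ b, ∃ s, iter ξ (k + 1) b = s ++ iter ξ k l' := fun b => by
      obtain ⟨s, hs⟩ := List.getLast?_eq_some_iff.1 (hl' b)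
      exact ⟨s.flatMap (iter ξ k), by rw [hsplit, hs]; simp⟩
    obtain ⟨s, hs⟩ := hsuf (y (-1))
    obtain ⟨s', hs'⟩ := hsuf (z (-1))
    obtain ⟨t, ht⟩ := Int.eq_ofNat_of_zero_le
      (show 0 ≤ n + i + (iter ξ k l').length by omega)
    refine key (-1) (s.length + t) (s'.length + t) ?_ ?_ ?_ ?_ ?_
    · rw [hs, List.length_append]
      omega
    · rw [hs', List.length_append]
      omega
    · rw [hs, hs', List.getElem?_append_right (by omega), List.getElem?_append_right (by omega)]
      simp
    · rw [hneg, hs, List.length_append]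
      push_cast
      omega
    · rw [hneg, hs', List.length_append]
      push_cast
      omega
  · rcases lt_or_ge (n + i) (iter ξ (k + 1) (y 0)).length with h2 | h2
    · obtain ⟨t, ht⟩ := Int.eq_ofNat_of_zero_le h1
      have hlt : t < (iter ξ (k + 1) (y 0)).length := by omega
      refine key 0 t t hlt (h0 ▸ hlt) (by rw [h0]) ?_ ?_
      · rw [pos_zero]
        omega
      · rw [pos_zero]
        omega
    · obtain ⟨t, ht⟩ := Int.eq_ofNat_of_zero_le
        (show 0 ≤ n + i - (iter ξ (k + 1) (y 0)).length by omega)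
      have hpre : ∀ b, t < (iter ξ (k + 1) b).length ∧
          (iter ξ (k + 1) b)[t]? = (iter ξ k l)[t]? := fun b => by
        obtain ⟨s, hs⟩ := List.head?_eq_some_iff.1 (hl b)
        rw [hsplit, hs, List.flatMap_cons, List.getElem?_append_left (by omega),
          List.length_append]
        exact ⟨by omega, rfl⟩
      refine key 1 t t (hpre _).1 (hpre _).1 (by rw [(hpre _).2, (hpre _).2]) ?_ ?_
      · rw [hpos]
        omega
      · rw [hpos, ← h0]
        omega

theorem eventually_not_mem_piece (hprop : IsProper ξ)
    (hlen : ∀ b, Tendsto (fun n => (iter ξ n b).length) atTop atTop) {x y : Omega ξ}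
    (hxy : x ≠ y) : ∀ᶠ k in atTop, ∀ a, ∀ i < (iter ξ k a).length,
      x ∈ piece ξ k a i → y ∉ piece ξ k a i := by
  have hξ := ne_nil_of_isProper hprop
  obtain ⟨⟨l, hl⟩, l', hl'⟩ := hprop
  obtain ⟨n, hn⟩ : ∃ n, x.1 n ≠ y.1 n := by
    by_contra! h
    exact hxy (Subtype.ext (funext h))
  have h1 : ∀ᶠ k in atTop, n.natAbs < (iter ξ k l).length ∧ n.natAbs < (iter ξ k l').length :=
    ((hlen l).eventually_gt_atTop _).and ((hlen l').eventually_gt_atTop _)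
  obtain ⟨k₀, hk₀⟩ := eventually_atTop.1 h1
  filter_upwards [eventually_ge_atTop (k₀ + 1)] with k hk a i hi
  obtain ⟨k, rfl⟩ := Nat.exists_eq_add_of_le' (show 1 ≤ k by omega)
  rintro ⟨x', hx', rfl, ex⟩ ⟨y', hy', h0, ey⟩
  apply hn
  obtain ⟨h2, h3⟩ := hk₀ k (by omega)
  rw [ex, ey]
  exact conc_eq_of_isProper hξ hl hl' h0.symm hi (by rw [Int.abs_eq_natAbs]; omega)
    (by rw [Int.abs_eq_natAbs]; omega)

end Separation

/-! ### Fibre cardinalities as limits of counts of pieces -/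

section Counting

open Classical in
/-- The number of pieces of level `k` whose image contains `t`. -/
noncomputable def hitCount {A : Type*} [Fintype A] [Nonempty A] (ξ : A → List A) {X : Type*}
    (G : Omega ξ → X) (k : ℕ) (t : X) : ENNReal :=
  ∑ a, ∑ i ∈ Finset.range (iter ξ k a).length, (G '' piece ξ k a i).indicator 1 t

set_option linter.unusedSectionVars false

variable {A : Type*} [Fintype A] [DecidableEq A] [Nonempty A] [TopologicalSpace A]
  [DiscreteTopology A] {ξ : A → List A} {X : Type*}
  {G : Omega ξ → X}

open Classical in
theorem hitCount_eq_card (k : ℕ) (t : X) : hitCount ξ G k t =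
    ((Finset.univ.sigma fun a => Finset.range (iter ξ k a).length).filter
      fun q => t ∈ G '' piece ξ k q.1 q.2).card := by
  rw [hitCount, Finset.sum_sigma', Finset.card_filter]
  push_cast
  refine Finset.sum_congr rfl fun q _ => ?_
  simp [Set.indicator_apply]

/-- Choose a point of the fibre in each piece that is hit; the pieces are disjoint, so these points
are distinct. -/
theorem IsAperiodicPrimitive.hitCount_le (h : IsAperiodicPrimitive ξ) (k : ℕ) (t : X) :
    hitCount ξ G k t ≤ ({x | G x = t}.encard : ENNReal) := by
  classical
  rw [hitCount_eq_card]
  set D := (Finset.univ.sigma fun a => Finset.range (iter ξ k a).length).filter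
      fun q => t ∈ G '' piece ξ k q.1 q.2 with hD
  have h1 : ∀ q ∈ D, q.2 < (iter ξ k q.1).length ∧ ∃ x ∈ piece ξ k q.1 q.2, G x = t := by
    intro q hq
    simp only [hD, Finset.mem_filter, Finset.mem_sigma, Finset.mem_univ, Finset.mem_range,
      true_and] at hq
    exact hq
  have : Nonempty (Omega ξ) ∨ D = ∅ := by
    rcases D.eq_empty_or_nonempty with h0 | ⟨q, hq⟩
    · exact Or.inr h0
    · obtain ⟨-, x, -⟩ := h1 q hq
      exact Or.inl ⟨x⟩
  rcases this with hne | h0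
  swap
  · simp [h0]
  choose! x hx hG using fun q hq => (h1 q hq).2
  have hle : (D : Set (Σ _ : A, ℕ)).encard ≤ {x | G x = t}.encard := by
    refine Set.encard_le_encard_of_injOn (f := x) (fun q hq => hG q hq) ?_
    intro q hq q' hq' e
    obtain ⟨e1, e2⟩ := h.piece_unique (h1 q hq).1 (h1 q' hq').1 (hx q hq) (e ▸ hx q' hq')
    exact Sigma.ext e1 (heq_of_eq e2)
  rw [Set.encard_coe_eq_coe_finsetCard] at hle
  have := ENat.toENNReal_le.2 hle
  simpa using this

/-- N points of the fibre lie in N distinct pieces as soon as the level is high enough. -/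
theorem eventually_le_hitCount (hprop : IsProper ξ)
    (hlen : ∀ b, Tendsto (fun n => (iter ξ n b).length) atTop atTop) {t : X} {N : ℕ}
    (hN : (N : ℕ∞) ≤ {x | G x = t}.encard) : ∀ᶠ k in atTop, (N : ENNReal) ≤ hitCount ξ G k t := by
  classical
  have hξ := ne_nil_of_isProper hprop
  obtain ⟨s, hs, hcard⟩ := Set.exists_subset_encard_eq hN
  have hfin : s.Finite := Set.finite_of_encard_eq_coe hcard
  have h1 : ∀ᶠ k in atTop, ∀ x ∈ s, ∀ y ∈ s, x ≠ y → ∀ a, ∀ i < (iter ξ k a).length,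
      x ∈ piece ξ k a i → y ∉ piece ξ k a i := by
    refine (eventually_all_finite hfin).2 fun x _ => (eventually_all_finite hfin).2 fun y _ => ?_
    by_cases hxy : x = y
    · simp [hxy]
    · filter_upwards [eventually_not_mem_piece hprop hlen hxy] with k hk _
      exact hk
  filter_upwards [h1] with k hk
  rw [hitCount_eq_card]
  choose a i hi hmem using exists_mem_piece hξ k
  have hle : s.encard ≤ (((Finset.univ.sigma fun a => Finset.range (iter ξ k a).length).filter
      fun q => t ∈ G '' piece ξ k q.1 q.2 : Finset (Σ _ : A, ℕ)) : Set (Σ _ : A, ℕ)).encard := by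
    refine Set.encard_le_encard_of_injOn (f := fun x => ⟨a x, i x⟩) ?_ ?_
    · intro x hx
      simp only [Finset.coe_filter, Finset.mem_sigma, Finset.mem_univ, Finset.mem_range, true_and]
      exact ⟨hi x, x, hmem x, hs hx⟩
    · intro x hx y hy e
      by_contra hxy
      simp only [Sigma.mk.injEq, heq_eq_eq] at e
      exact hk x hx y hy hxy _ _ (hi x) (hmem x) (e.1 ▸ e.2 ▸ hmem y)
  rw [hcard, Set.encard_coe_eq_coe_finsetCard] at hle
  exact_mod_cast hle

/-- This gives at once the measurability of the fibre cardinality and, through Fatou's lemma, a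
bound for its integral. -/
theorem IsAperiodicPrimitive.liminf_hitCount (h : IsAperiodicPrimitive ξ) (hprop : IsProper ξ)
    (hlen : ∀ b, Tendsto (fun n => (iter ξ n b).length) atTop atTop) (t : X) :
    liminf (fun k => hitCount ξ G k t) atTop = ({x | G x = t}.encard : ENNReal) := by
  apply le_antisymm
  · exact liminf_le_of_frequently_le' (Frequently.of_forall fun k => h.hitCount_le k t)
  · have h1 : ∀ N : ℕ, (N : ℕ∞) ≤ {x | G x = t}.encard →
        (N : ENNReal) ≤ liminf (fun k => hitCount ξ G k t) atTop := fun N hN =>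
      le_liminf_of_le (by isBoundedDefault) (eventually_le_hitCount hprop hlen hN)
    rcases eq_or_ne {x | G x = t}.encard ⊤ with e | e
    · rw [e] at h1 ⊢
      rw [ENat.toENNReal_top, top_le_iff]
      exact ENNReal.eq_top_of_forall_nnreal_le fun r => by
        obtain ⟨N, hN⟩ := exists_nat_ge r
        exact le_trans (by exact_mod_cast hN) (h1 N le_top)
    · obtain ⟨N, hN⟩ := ENat.ne_top_iff_exists.1 e
      rw [← hN] at h1 ⊢
      simpa using h1 N le_rfl

end Counting

/-! ### Equivariance of the fibres and the uniform bound on the counts -/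

section Fibres

set_option linter.unusedSectionVars false

variable {A : Type*} {ξ : A → List A}

theorem bijective_shiftOmega : Function.Bijective (shiftOmega ξ) := by
  constructor
  · intro x y e
    apply Subtype.ext
    funext n
    have := congrFun (congrArg Subtype.val e) (n - 1)
    simpa [shiftOmega, shift] using this
  · intro x
    refine ⟨⟨fun n => x.1 (n + -1), shiftBy_mem_Omega x.2 (-1)⟩, Subtype.ext (funext fun n => ?_)⟩
    simp [shiftOmega, shift]

theorem image_shiftOmega_fibre {X : Type*} [AddGroup X] {G : Omega ξ → X} {c : X}
    (hG : ∀ x, G (shiftOmega ξ x) = G x + c) (t : X) :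
    shiftOmega ξ '' {x | G x = t} = {x | G x = t + c} := by
  ext y
  obtain ⟨x, rfl⟩ := bijective_shiftOmega.2 y
  rw [bijective_shiftOmega.1.mem_set_image]
  simp [hG]

variable [Fintype A] [DecidableEq A] [Nonempty A] [TopologicalSpace A] [DiscreteTopology A] {n : ℕ}

theorem image_piece_succ {X : Type*} [AddGroup X] {G : Omega ξ → X} {c : X}
    (hG : ∀ x, G (shiftOmega ξ x) = G x + c) (k : ℕ) (a : A) (i : ℕ) :
    G '' piece ξ k a (i + 1) = (fun t => t + c) '' (G '' piece ξ k a i) := by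
  rw [← shiftOmega_preimage_piece k a i, Set.image_image]
  simp only [← hG]
  rw [← Set.image_image G (shiftOmega ξ), Set.image_preimage_eq _ bijective_shiftOmega.2]

theorem torusMeasure_image_piece {G : Omega ξ → Fin n → UnitAddCircle} {c : Fin n → UnitAddCircle}
    (hG : ∀ x, G (shiftOmega ξ x) = G x + c) (k : ℕ) (a : A) (i : ℕ) :
    torusMeasure n (G '' piece ξ k a i) = torusMeasure n (G '' piece ξ k a 0) := by
  induction i with
  | zero => rfl
  | succ i ih => rw [image_piece_succ hG, Set.image_add_right, measure_preimage_add_right, ih]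

theorem measurableSet_image_piece (hξ : ∀ a, ξ a ≠ []) {G : Omega ξ → Fin n → UnitAddCircle}
    (hG : Continuous G) (k : ℕ) (a : A) (i : ℕ) : MeasurableSet (G '' piece ξ k a i) :=
  ((isClosed_piece hξ k a i).isCompact.image hG).isClosed.measurableSet

theorem measurable_hitCount (hξ : ∀ a, ξ a ≠ []) {G : Omega ξ → Fin n → UnitAddCircle}
    (hG : Continuous G) (k : ℕ) : Measurable (hitCount ξ G k) := by
  refine Finset.measurable_fun_sum _ fun a _ => Finset.measurable_fun_sum _ fun i _ => ?_
  exact measurable_one.indicator (measurableSet_image_piece hξ hG k a i)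

theorem lintegral_hitCount (hξ : ∀ a, ξ a ≠ []) {G : Omega ξ → Fin n → UnitAddCircle}
    (hG : Continuous G) {c : Fin n → UnitAddCircle}
    (hGc : ∀ x, G (shiftOmega ξ x) = G x + c) (k : ℕ) :
    ∫⁻ t, hitCount ξ G k t ∂torusMeasure n =
      ∑ a, ((iter ξ k a).length : ENNReal) * torusMeasure n (G '' piece ξ k a 0) := by
  have hm := measurableSet_image_piece hξ hG k
  simp only [hitCount]
  rw [lintegral_finsetSum _ fun a _ => Finset.measurable_fun_sum _ fun i _ =>
    measurable_one.indicator (hm a i)]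
  refine Finset.sum_congr rfl fun a _ => ?_
  rw [lintegral_finsetSum _ fun i _ => measurable_one.indicator (hm a i)]
  simp [lintegral_indicator_one (hm a _), torusMeasure_image_piece hGc k a]

/-- At level m + j a tower has at most C'βᵐ⁺ʲ floors, all with images of the same measure, at most
Cδʲ. The hypothesis βδ = 1 makes the product independent of j. -/
theorem IsAperiodicPrimitive.exists_lintegral_hitCount_le (h : IsAperiodicPrimitive ξ)
    (hu : ∃! z : ℂ, IsCharRoot ξ z ∧ 1 < ‖z‖) {β : ℝ} (hβ : IsPerronNumber ξ β)
    (hd : β * |LinearMap.det ((transp ξ).restrict (transp_mem_stableSpace ξ))| = 1)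
    {α : Fin n → ℝ} {v : Fin n → A → ℝ} {w : Fin n → A → ℤ} (hs : IsSplitting ξ α v w)
    (hα : LinearIndependent ℚ (Fin.cons 1 α : Fin (n + 1) → ℝ))
    (hn : Module.finrank ℝ (stableSpace ξ) = n) :
    ∃ M : ENNReal, M ≠ ⊤ ∧ ∀ᶠ k in atTop,
      ∫⁻ t, hitCount ξ (fun x => toTorus (mapF ξ v x)) k t ∂torusMeasure n ≤ M := by
  obtain ⟨m, T, -, hT⟩ := exists_pow_eq_pow_succ_mul h.ne_nil h.primitive hβ hu hd
  obtain ⟨C, hC, hvol⟩ := h.exists_volume_piece_le hT hs hα hn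
  have hβ0 := perron_pos_of_mul_abs_eq_one hd
  obtain ⟨C', hC', hlen⟩ := exists_length_iter_le_mul_pow h.ne_nil h.primitive hβ hβ0
  refine ⟨Fintype.card A * (ENNReal.ofReal (C' * β ^ m) * C), by finiteness, ?_⟩
  filter_upwards [eventually_ge_atTop m] with k hk
  obtain ⟨j, rfl⟩ := Nat.exists_eq_add_of_le hk
  rw [lintegral_hitCount (G := fun x => toTorus (mapF ξ v x)) h.ne_nil
    (continuous_toTorus.comp (h.continuous_mapF hs.tendsto))
    (h.toTorus_mapF_shiftOmega hs)]
  set δ := |LinearMap.det ((transp ξ).restrict (transp_mem_stableSpace ξ))|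
  have h1 : ∀ a, ((iter ξ (m + j) a).length : ENNReal) *
      torusMeasure n ((fun x => toTorus (mapF ξ v x)) '' piece ξ (m + j) a 0) ≤
        ENNReal.ofReal (C' * β ^ m) * C := by
    intro a
    have h2 : torusMeasure n ((fun x => toTorus (mapF ξ v x)) '' piece ξ (m + j) a 0) ≤
        ENNReal.ofReal δ ^ j * C := by
      rw [← Set.image_image toTorus (mapF ξ v)]
      exact (torusMeasure_image_toTorus_le _).trans (hvol j a)
    have h3 : ((iter ξ (m + j) a).length : ENNReal) ≤ ENNReal.ofReal (C' * β ^ (m + j)) := by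
      rw [← ENNReal.ofReal_natCast]
      exact ENNReal.ofReal_le_ofReal (hlen _ a)
    refine (mul_le_mul' h3 h2).trans (le_of_eq ?_)
    rw [← mul_assoc, ← ENNReal.ofReal_pow (abs_nonneg _), ← ENNReal.ofReal_mul (by positivity),
      pow_add, show C' * (β ^ m * β ^ j) * δ ^ j = C' * β ^ m * (β * δ) ^ j by rw [mul_pow]; ring,
      hd, one_pow, mul_one]
  refine (Finset.sum_le_sum fun a _ => h1 a).trans (le_of_eq ?_)
  simp

end Fibres

/-! ### Conclusion -/

section Main

variable {A : Type*} [Fintype A] [DecidableEq A] [TopologicalSpace A] [DiscreteTopology A]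
  [MeasurableSpace A] [DiscreteMeasurableSpace A] [Nonempty A] {ξ : A → List A}
  {μ : Measure (Omega ξ)} [IsProbabilityMeasure μ] {n : ℕ} {α : Fin n → ℝ}

theorem HypothesesP.exists_ae_fibreCard_eq (hμ : MeasurePreserving (shiftOmega ξ) μ μ)
    (hP : HypothesesP ξ μ α) {v : Fin n → A → ℝ} {w : Fin n → A → ℤ} (hs : IsSplitting ξ α v w) :
    ∃ c : ℕ, ∀ᵐ x ∂μ, fibreCard ξ v x = (c : ℕ∞) := by
  have h := hP.isAperiodicPrimitive hμ
  obtain ⟨β, hβ, hd⟩ := hP.perron_det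
  set G : Omega ξ → Fin n → UnitAddCircle := fun x => toTorus (mapF ξ v x) with hGdef
  have hG : Continuous G := continuous_toTorus.comp (h.continuous_mapF hs.tendsto)
  have hGS : ∀ x, G (shiftOmega ξ x) = G x + -toTorus α := h.toTorus_mapF_shiftOmega hs
  have hfour := mFourier_neg_toTorus_ne_one hP.indep
  have hN := h.liminf_hitCount hP.proper hP.subst.2 (G := G)
  have hmeas : Measurable fun t => ({x | G x = t}.encard : ENNReal) := by
    simp only [← hN]
    exact Measurable.liminf fun k => measurable_hitCount h.ne_nil hG k
  obtain ⟨M, hM, hle⟩ := h.exists_lintegral_hitCount_le hP.unique_root hβ hd hs hP.indep hP.dim_eq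
  -- Fatou's lemma applied to the counts of pieces.
  have hint : ∫⁻ t, ({x | G x = t}.encard : ENNReal) ∂torusMeasure n ≠ ⊤ := by
    simp only [← hN]
    exact ne_top_of_le_ne_top hM ((lintegral_liminf_le fun k =>
      measurable_hitCount h.ne_nil hG k).trans (liminf_le_of_frequently_le' hle.frequently))
  obtain ⟨c, hc⟩ := exists_ae_eq_natCast (N := fun t => {x | G x = t}.encard) hfour
    (fun c => by
      convert hmeas (measurableSet_singleton (c : ENNReal)) using 1
      ext t
      simp [← ENat.toENNReal_coe])
    (fun t => by
      rw [← image_shiftOmega_fibre hGS, bijective_shiftOmega.1.encard_image])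
    (by
      filter_upwards [ae_lt_top hmeas hint] with t ht
      simpa using ht.ne)
  -- The image of μ is invariant under the rotation by −α, so it is Haar measure; what holds almost
  -- everywhere on the torus then holds μ-almost everywhere on Ω.
  have hmap : μ.map G = torusMeasure n := by
    have : IsProbabilityMeasure (μ.map G) := Measure.isProbabilityMeasure_map hG.aemeasurable
    refine eq_torusMeasure ⟨measurable_add_const _, ?_⟩ hfour
    rw [Measure.map_map (measurable_add_const _) hG.measurable]
    conv_rhs => rw [← hμ.map_eq, Measure.map_map hG.measurable hμ.measurable]
    congr 1
    exact funext fun x => (hGS x).symm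
  rw [← hmap] at hc
  exact ⟨c, ae_of_ae_map hG.aemeasurable hc⟩

end Main

end PisotSubst

theorem mainTheorem6 {A : Type*} [Fintype A] [DecidableEq A] [MeasurableSpace A]
    [DiscreteMeasurableSpace A] (ξ : A → List A)
    (μ : MeasureTheory.Measure (PisotSubst.Omega ξ)) [MeasureTheory.IsProbabilityMeasure μ]
    (hμ : MeasureTheory.MeasurePreserving (PisotSubst.shiftOmega ξ) μ μ)
    {n : ℕ} (α : Fin n → ℝ) (hP : PisotSubst.HypothesesP ξ μ α) :
    (∃ (v : Fin n → A → ℝ) (w : Fin n → A → ℤ), PisotSubst.IsSplitting ξ α v w) ∧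
    ∀ (v : Fin n → A → ℝ) (w : Fin n → A → ℤ), PisotSubst.IsSplitting ξ α v w →
      (∀ (x : PisotSubst.Omega ξ) (i : Fin n), Summable (PisotSubst.term ξ v x.1 i)) ∧
      ∃ c : ℕ, ∀ᵐ x ∂μ, PisotSubst.fibreCard ξ v x = (c : ℕ∞) := by
  -- The statement puts no topology on A; the discrete one turns Ω into a compact space.
  let : TopologicalSpace A := ⊥
  have : DiscreteTopology A := ⟨rfl⟩
  have : Nonempty A := by
    obtain ⟨x⟩ := μ.nonempty_of_neZero
    exact ⟨x.1 0⟩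
  exact ⟨hP.exists_isSplitting hμ, fun v w hs =>
    ⟨fun x i => (hP.isAperiodicPrimitive hμ).summable_term (hs.tendsto i) x,
      hP.exists_ae_fibreCard_eq hμ hs⟩⟩
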